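/- Let $n\ge 1$, let $\sigma,\omega$ be positive locally finite Borel measures on $\mathbb R^n$, let $1<p<\infty$ and $p'=p/(p-1)$. Cubes have sides parallel to the coordinate axes and positive side length; $|Q|$ is the Lebesgue measure of $Q$, and functions and kernels are complex valued. Kernels. Let $K(x,y)$ be defined on $\mathbb R^n\times\mathbb R^n$ and measurable in $y$. We say that $K$ satisfies the size and smoothness conditions if, for some constant $C$ and all $x\neq y$, $$|K(x,y)|\le C|x-y|^{-n},\qquad |K(x,y)-K(x',y)|\le C\,\delta\!\left(\tfrac{|x-x'|}{|x-y|}\right)|x-y|^{-n}\quad\text{if } \tfrac{|x-x'|}{|x-y|}\le\tfrac12,$$ where $\delta$ is nondecreasing on $[0,1]$ with $\delta(0)=0$ and $\int_0^1\delta(s)\frac{ds}{s}<\infty$. The kernel is standard if moreover $\int_{B(y,2\varepsilon)^c}|K(x,y)-K(x,y')|\,dx\le C$ for all $y$, $\varepsilon>0$, $y'\in B(y,\varepsilon)$. A bounded linear operator $T$ on $L^q(\mathbb R^n)$, for some $1<q<\infty$, is a standard singular integral operator with kernel $K$ if $K$ is standard and $Tf(x)=\int K(x,y)f(y)\,dy$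 for a.e. $x\notin\operatorname{supp}f$ whenever $f\in L^q(\mathbb R^n)$ has compact support. Operators. Fix smooth functions $\zeta,\eta$ on $\mathbb R$, $\zeta$ nondecreasing with $\zeta=0$ on $(-\infty,\frac12]$ and $\zeta=1$ on $[1,\infty)$, $\eta$ nonincreasing with $\eta=1$ on $(-\infty,1]$ and $\eta=0$ on $[2,\infty)$. Put $$T_\flat(f\sigma)(x)=\sup_{0<\varepsilon<R<\infty}\left|\int K(x,y)\,\zeta\!\left(\tfrac{|x-y|}{\varepsilon}\right)\eta\!\left(\tfrac{|x-y|}{R}\right)f(y)\,d\sigma(y)\right|,$$ $$T_\natural(f\sigma)(x)=\sup_{\boldsymbol\varepsilon,R}\left|\int K(x,y)\,\zeta_{\boldsymbol\varepsilon}(x-y)\,\eta\!\left(\tfrac{|x-y|}{R}\right)f(y)\,d\sigma(y)\right|,\quad \zeta_{\boldsymbol\varepsilon}(v)=1-\prod_{k=1}^n\left[1-\left\{\zeta\!\left(\tfrac{v_k}{\varepsilon_{2k-1}}\right)+\zeta\!\left(\tfrac{-v_k}{\varepsilon_{2k}}\right)\right\}\right],$$ the last supremum being over all $R<\infty$ and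 $\boldsymbol\varepsilon=(\varepsilon_1,\dots,\varepsilon_{2n})$ with $0<\varepsilon_i<R$ and $\frac14\le\varepsilon_i/\varepsilon_j\le4$ for all $i,j$. Let $\mathcal M(f\sigma)(x)=\sup_{Q\ni x}\frac1{|Q|}\int_Q|f|\,d\sigma$, the supremum being over cubes, and $\|F\|_{L^{p,\infty}(\omega)}=\sup_{\lambda>0}\lambda\,\omega(\{|F|>\lambda\})^{1/p}$. For $S\in\{\mathcal M,T_\natural,T_\flat\}$ consider, with a finite constant $C$ independent of $f$ and $Q$, $$\mathrm{(W)}_S\qquad \|S(f\sigma)\|_{L^{p,\infty}(\omega)}\le C\|f\|_{L^p(\sigma)},\qquad f\in L^p(\sigma);$$ $$\mathrm{(D)}_S\qquad \int_Q S(\chi_Qf\sigma)\,d\omega\le C\left(\int_Q|f|^p\,d\sigma\right)^{1/p}\omega(Q)^{1/p'}\qquad\text{for all cubes } Q \text{ and } f\in L^p(\sigma).$$ Then: (1) If $K$ satisfies the size and smoothness conditions and $\mathrm{(W)}_{\mathcal M}$ holds, then $\mathrm{(W)}_{T_\natural}$ holds if and only if $\mathrm{(D)}_{T_\natural}$ holds.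 (2) If $K$ satisfies the size and smoothness conditions and $\mathrm{(W)}_{\mathcal M}$ holds, then $\mathrm{(W)}_{T_\flat}$ holds if and only if $\mathrm{(D)}_{T_\flat}$ holds. (3) Suppose that $\sigma,\omega$ are absolutely continuous with respect to Lebesgue measure, that $\mathrm{(W)}_{\mathcal M}$ holds, and that $T$ is a standard singular integral operator with kernel $K$. If $\mathrm{(W)}_{T_\natural}$ or $\mathrm{(W)}_{T_\flat}$ holds, then there is $C<\infty$ such that $\|T(f\sigma)\|_{L^{p,\infty}(\omega)}\le C\|f\|_{L^p(\sigma)}$ for all $f\in L^p(\sigma)$ for which $f\sigma$ (the product of $f$ and the Lebesgue density of $\sigma$) is bounded with compact support. (4) Let $c>0$ and let $K_1,\dots,K_J$ be standard kernels such that for each unit vector $\mathbf u$ there is $j$ with $|K_j(x,x+t\mathbf u)|\ge c\,t^{-n}$ for all $x\in\mathbb R^n$ and $t>0$. Suppose that $\sigma(\{x\})\,\omega(\{x\})=0$ for all $x\in\mathbb R^n$. Then $\mathrm{(W)}_{(T_j)_\flat}$ holds for all $1\le j\le J$ if and only if the $A_p$ condition $$\left[\frac{\omega(Q)}{|Q|}\right]^{1/p}\left[\frac{\sigma(Q)}{|Q|}\right]^{1/p'}\le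 C\qquad\text{for all cubes }Q$$ holds and $\mathrm{(D)}_{(T_j)_\flat}$ holds for all $1\le j\le J$. -/

import Mathlib

open MeasureTheory Set
open scoped ENNReal NNReal

noncomputable section

/-- The Euclidean space `ℝⁿ`. -/
abbrev RSp (n : ℕ) : Type := EuclideanSpace ℝ (Fin n)

/-- The closed cube with sides parallel to the axes, lower corner `a` and side length `l`. -/
def cube {n : ℕ} (a : RSp n) (l : ℝ) : Set (RSp n) :=
  {y | ∀ i, y i ∈ Icc (a i) (a i + l)}

/-! ### Kernels -/

/-- A Dini modulus of continuity on `[0,1]`. -/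
structure IsDiniModulus (δ : ℝ → ℝ) : Prop where
  mono : MonotoneOn δ (Icc 0 1)
  zero : δ 0 = 0
  dini : IntegrableOn (fun s => δ s / s) (Ioc 0 1) volume

/-- The size condition and the Dini smoothness condition in the first variable. -/
structure IsSizeSmoothKernel {n : ℕ} (K : RSp n → RSp n → ℂ) : Prop where
  meas : ∀ x, Measurable (K x)
  bounds : ∃ (C : ℝ) (δ : ℝ → ℝ), IsDiniModulus δ ∧
    (∀ x y, x ≠ y → ‖K x y‖ ≤ C / ‖x - y‖ ^ n) ∧
    (∀ x x' y, x ≠ y → ‖x - x'‖ / ‖x - y‖ ≤ 1 / 2 →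
      ‖K x y - K x' y‖ ≤ C * δ (‖x - x'‖ / ‖x - y‖) / ‖x - y‖ ^ n)

/-- The Hörmander condition in the second variable. -/
def HormanderCondition {n : ℕ} (K : RSp n → RSp n → ℂ) : Prop :=
  ∃ C : ℝ≥0, ∀ (y : RSp n) (ε : ℝ), 0 < ε → ∀ y' ∈ Metric.ball y ε,
    ∫⁻ x in (Metric.ball y (2 * ε))ᶜ, ‖K x y - K x y'‖ₑ ≤ C

/-- Standard kernels. -/
structure IsStandardKernel {n : ℕ} (K : RSp n → RSp n → ℂ) : Prop
    extends IsSizeSmoothKernel K where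
  hormander : HormanderCondition K

/-- `T`, a bounded linear operator on `L^q(ℝⁿ)` with `1 < q < ∞`, is a standard singular integral
operator with kernel `K`. A compact set `S` off which `f` vanishes a.e. is a compact set containing
the support of the class `f`; the least such `S` is the support itself. -/
structure IsStandardSIO {n : ℕ} (q : ℝ≥0∞) [Fact (1 ≤ q)] (K : RSp n → RSp n → ℂ)
    (T : Lp ℂ q (volume : Measure (RSp n)) →L[ℂ] Lp ℂ q (volume : Measure (RSp n))) : Prop where
  one_lt : 1 < q
  ne_top : q ≠ ∞
  kernel : IsStandardKernel K
  rel : ∀ (f : Lp ℂ q (volume : Measure (RSp n))) (S : Set (RSp n)), IsCompact S →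
    (∀ᵐ x, x ∉ S → f x = 0) → ∀ᵐ x, x ∉ S → T f x = ∫ y, K x y * f y

/-! ### Truncations and maximal operators -/

/-- The pair of smooth cutoff profiles: `ζ` cuts off near the singularity, `η` at infinity. -/
structure IsCutoffPair (ζ η : ℝ → ℝ) : Prop where
  smooth_zeta : ContDiff ℝ ((⊤ : ℕ∞) : WithTop ℕ∞) ζ
  smooth_eta : ContDiff ℝ ((⊤ : ℕ∞) : WithTop ℕ∞) η
  zeta_zero : ∀ t ≤ 1 / 2, ζ t = 0
  zeta_one : ∀ t, 1 ≤ t → ζ t = 1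
  zeta_mono : Monotone ζ
  eta_zero : ∀ t, 2 ≤ t → η t = 0
  eta_one : ∀ t ≤ 1, η t = 1
  eta_anti : Antitone η

/-- The smoothly truncated integral `T_{ε,R}(fσ)(x)`. -/
def truncFlat {n : ℕ} (ζ η : ℝ → ℝ) (K : RSp n → RSp n → ℂ) (σ : Measure (RSp n))
    (ε R : ℝ) (f : RSp n → ℂ) (x : RSp n) : ℂ :=
  ∫ y, K x y * ((ζ (‖x - y‖ / ε) * η (‖x - y‖ / R) : ℝ) : ℂ) * f y ∂σ

/-- The maximal singular integral `T_♭(fσ)(x)`. -/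
def maxFlat {n : ℕ} (ζ η : ℝ → ℝ) (K : RSp n → RSp n → ℂ) (σ : Measure (RSp n))
    (f : RSp n → ℂ) (x : RSp n) : ℝ≥0∞ :=
  ⨆ (ε : ℝ) (R : ℝ) (_ : 0 < ε ∧ ε < R), ‖truncFlat ζ η K σ ε R f x‖ₑ

/-- The noncentered cutoff `ζ_𝛆(v)`, where `ε (k, 0)` acts for `v k > 0` and `ε (k, 1)` for
`v k < 0`. -/
def boxCutoff {n : ℕ} (ζ : ℝ → ℝ) (ε : Fin n × Fin 2 → ℝ) (v : RSp n) : ℝ :=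
  1 - ∏ k, (1 - (ζ (v k / ε (k, 0)) + ζ (-v k / ε (k, 1))))

/-- The noncentered smoothly truncated integral `T_{𝛆,R}(fσ)(x)`. -/
def truncNatural {n : ℕ} (ζ η : ℝ → ℝ) (K : RSp n → RSp n → ℂ) (σ : Measure (RSp n))
    (ε : Fin n × Fin 2 → ℝ) (R : ℝ) (f : RSp n → ℂ) (x : RSp n) : ℂ :=
  ∫ y, K x y * ((boxCutoff ζ ε (x - y) * η (‖x - y‖ / R) : ℝ) : ℂ) * f y ∂σ

/-- The strongly maximal singular integral `T_♮(fσ)(x)`: the supremum over all noncentered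
truncations of controlled eccentricity. -/
def maxNatural {n : ℕ} (ζ η : ℝ → ℝ) (K : RSp n → RSp n → ℂ) (σ : Measure (RSp n))
    (f : RSp n → ℂ) (x : RSp n) : ℝ≥0∞ :=
  ⨆ (ε : Fin n × Fin 2 → ℝ) (R : ℝ)
    (_ : (∀ i, 0 < ε i ∧ ε i < R) ∧ ∀ i j, ε i / ε j ∈ Icc (1 / 4 : ℝ) 4),
    ‖truncNatural ζ η K σ ε R f x‖ₑ

/-- The maximal function `M(fσ)(x)` over all cubes containing `x`. -/
def maxCube {n : ℕ} (σ : Measure (RSp n)) (f : RSp n → ℂ) (x : RSp n) : ℝ≥0∞ :=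
  ⨆ (a : RSp n) (l : ℝ) (_ : 0 < l ∧ x ∈ cube a l),
    (∫⁻ y in cube a l, ‖f y‖ₑ ∂σ) / volume (cube a l)

/-! ### The two weight conditions -/

/-- The weak `L^p(ω)` quasinorm `sup_{λ > 0} λ ω(F > λ)^{1/p}`. -/
def weakNorm {n : ℕ} (p : ℝ) (ω : Measure (RSp n)) (F : RSp n → ℝ≥0∞) : ℝ≥0∞ :=
  ⨆ t : ℝ≥0, (t : ℝ≥0∞) * ω {x | (t : ℝ≥0∞) < F x} ^ (1 / p)

/-- The weak type inequality `‖S(fσ)‖_{L^{p,∞}(ω)} ≤ C ‖f‖_{L^p(σ)}`; here `S f` stands for the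
operator applied to `fσ`. -/
def WeakTypeBound {n : ℕ} (p : ℝ) (σ ω : Measure (RSp n))
    (S : (RSp n → ℂ) → RSp n → ℝ≥0∞) : Prop :=
  ∃ C : ℝ≥0, ∀ f : RSp n → ℂ, MemLp f (ENNReal.ofReal p) σ →
    weakNorm p ω (S f) ≤ C * eLpNorm f (ENNReal.ofReal p) σ

/-- The dual cube testing condition
`∫_Q S(χ_Q f σ) dω ≤ C (∫_Q |f|^p dσ)^{1/p} ω(Q)^{1/p'}`. -/
def CubeTesting {n : ℕ} (p : ℝ) (σ ω : Measure (RSp n))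
    (S : (RSp n → ℂ) → RSp n → ℝ≥0∞) : Prop :=
  ∃ C : ℝ≥0, ∀ (a : RSp n) (l : ℝ), 0 < l → ∀ f : RSp n → ℂ, MemLp f (ENNReal.ofReal p) σ →
    ∫⁻ x in cube a l, S ((cube a l).indicator f) x ∂ω ≤
      C * eLpNorm f (ENNReal.ofReal p) (σ.restrict (cube a l)) *
        ω (cube a l) ^ (1 / p.conjExponent)

/-- The two weight `A_p` condition. -/
def ApCondition {n : ℕ} (p : ℝ) (σ ω : Measure (RSp n)) : Prop :=
  ∃ C : ℝ≥0, ∀ (a : RSp n) (l : ℝ), 0 < l →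
    (ω (cube a l) / volume (cube a l)) ^ (1 / p) *
      (σ (cube a l) / volume (cube a l)) ^ (1 / p.conjExponent) ≤ C

/-- The weak type inequality for the untruncated operator `T`, over all `f ∈ L^p(σ)` for which
`fσ`, i.e. `f` times the Lebesgue density of `σ`, is bounded with compact support. -/
def WeakTypeBoundSIO {n : ℕ} (p : ℝ) (σ ω : Measure (RSp n)) (q : ℝ≥0∞) [Fact (1 ≤ q)]
    (T : Lp ℂ q (volume : Measure (RSp n)) →L[ℂ] Lp ℂ q (volume : Measure (RSp n))) : Prop :=
  ∃ C : ℝ≥0, ∀ (f : RSp n → ℂ) (g : Lp ℂ q (volume : Measure (RSp n))),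
    MemLp f (ENNReal.ofReal p) σ →
    (g =ᵐ[volume] fun x => f x * (((σ.rnDeriv volume x).toReal : ℝ) : ℂ)) →
    MemLp g ∞ volume →
    (∃ S : Set (RSp n), IsCompact S ∧ ∀ᵐ x, x ∉ S → g x = 0) →
    weakNorm p ω (fun x => ‖T g x‖ₑ) ≤ C * eLpNorm f (ENNReal.ofReal p) σ

end

/-! Both families of truncations consist of continuous cutoffs bounded by `1` that are regular at
the scale of `‖v‖`, contain functions equal to `1` on arbitrary annuli, and allow the hole at the
origin to be enlarged (`IsCutoffClass`). The maximal operator `maxOp` of such a class is lower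
semicontinuous and satisfies a maximum principle: for a neighbourhood `E` of `x` of size `ρ` and any
`z` with `‖x - z‖ ≤ ρ / 2`, its value at `x` is at most its value at `x` for `f` restricted to `E`,
plus its value at `z` for `f` itself, plus a multiple of the maximal function at `x`
(`KernelBounds.exists_maximum_principle`). The constant one in front of the value at `z` is what
makes the good-`λ` argument work.

The weak type inequality implies the testing condition by Kolmogorov's inequality
(`WeakTypeBound.cubeTesting`). Conversely, for `f` of compact support the level set `{maxOp f > t}`
is open and proper, hence has a Whitney covering. By the maximum principle, at a point of a Whitney
cube where `maxOp f` exceeds `2 t` and the maximal function is at most a small multiple of `t`, the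
operator applied to the restriction of `f` to the triple of the cube exceeds `t / 2`. The testing
condition on the triples, Young's inequality and the bounded overlap of the triples bound the
measure of `{maxOp f > 2 t}` by a small multiple of that of `{maxOp f > t}` and the desired bound
(`measure_two_mul_lt_le`). This is iterated, with an a priori bound that comes from the comparison
of `maxOp f` with the maximal function away from the support of `f`
(`CubeTesting.weakTypeBound_maxOp`). The outcome is `weakTypeBound_maxOp_iff`, valid for both
classes.

For an operator `T` with a standard kernel and `g` of compact support, `|T g|` is almost everywhere
bounded by the maximal truncation of `g` plus a multiple of its maximal function
(`IsStandardSIO.exists_enorm_le`), by Lebesgue differentiation of averages over small balls. The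
weak type inequality therefore passes from the truncations to `T`.

The `A_p` condition implies the weak type inequality for the maximal function by a Vitali covering
argument (`ApCondition.weakTypeBound_maxCube`). In the opposite direction, testing an elliptic
family of operators on the conjugate phases of their kernels gives an `A_p` inequality
`ω(P)^{1/p} σ(P')^{1/p'} ≤ C |P|` for cubes `P`, `P'` of equal side at a comparable distance
(`exists_rpow_measure_cube_mul_le`). If `ω` and `σ` have no common point mass, `ω(Q) σ(Q)` is at
most the sum of `ω(P ∩ Q) σ(P' ∩ Q)` over a Whitney decomposition of `Q × Q` off the diagonal into
such pairs. With `θ = min(p, p') > 1`, each product is at most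
`(C |P|)^θ ω(Q)^{1 - θ/p} σ(Q)^{1 - θ/p'}`, and the sum over the scales is geometric, which gives
the `A_p` condition on `Q` (`apCondition_of_separated`). -/

open scoped Topology

/-! ### Cubes and the maximal function -/

lemma norm_le_of_forall_abs_le {n : ℕ} {v : RSp n} {b : ℝ} (hb : 0 ≤ b) (h : ∀ i, |v i| ≤ b) :
    ‖v‖ ≤ n * b := by
  have h1 : ‖v‖ ^ 2 ≤ (n * b) ^ 2 := by
    rw [EuclideanSpace.norm_sq_eq]
    calc ∑ i, ‖v i‖ ^ 2 ≤ ∑ _i : Fin n, b ^ 2 := by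
          gcongr with i
          exact h i
      _ = n * b ^ 2 := by simp
      _ ≤ (n : ℝ) ^ 2 * b ^ 2 := by
          gcongr
          rcases Nat.eq_zero_or_pos n with rfl | hn
          · simp
          · have : (1 : ℝ) ≤ n := by exact_mod_cast hn
            nlinarith
      _ = (n * b) ^ 2 := by ring
  exact abs_le_of_sq_le_sq' h1 (by positivity) |>.2

lemma abs_apply_le_norm {n : ℕ} (v : RSp n) (i : Fin n) : |v i| ≤ ‖v‖ :=
  PiLp.norm_apply_le v i

lemma cube_eq_preimage {n : ℕ} (a : RSp n) (l : ℝ) :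
    cube a l = (MeasurableEquiv.toLp 2 (Fin n → ℝ)).symm ⁻¹'
      Icc (fun i => a i) (fun i => a i + l) := by
  ext y
  simp only [cube, mem_ofPred_eq, mem_preimage, mem_Icc, Pi.le_def]
  exact forall_and

lemma isClosed_cube {n : ℕ} (a : RSp n) (l : ℝ) : IsClosed (cube a l) := by
  have : cube a l = ⋂ i, (fun y : RSp n => y i) ⁻¹' Icc (a i) (a i + l) := by
    ext y; simp [cube]
  rw [this]
  exact isClosed_iInter fun i => isClosed_Icc.preimage (by fun_prop)

lemma measurableSet_cube {n : ℕ} (a : RSp n) (l : ℝ) : MeasurableSet (cube a l) :=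
  (isClosed_cube a l).measurableSet

lemma volume_cube {n : ℕ} (a : RSp n) {l : ℝ} (hl : 0 ≤ l) :
    volume (cube a l) = ENNReal.ofReal (l ^ n) := by
  rw [cube_eq_preimage,
    (EuclideanSpace.volume_preserving_symm_measurableEquiv_toLp (Fin n)).measure_preimage
      measurableSet_Icc.nullMeasurableSet, Real.volume_Icc_pi]
  simp [ENNReal.ofReal_pow hl]

lemma volume_cube_ne_zero {n : ℕ} (a : RSp n) {l : ℝ} (hl : 0 < l) : volume (cube a l) ≠ 0 := by
  rw [volume_cube a hl.le]
  simp only [ne_eq, ENNReal.ofReal_eq_zero, not_le]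
  positivity

lemma volume_cube_ne_top {n : ℕ} (a : RSp n) {l : ℝ} (hl : 0 < l) : volume (cube a l) ≠ ∞ := by
  rw [volume_cube a hl.le]
  exact ENNReal.ofReal_ne_top

lemma norm_sub_le_of_mem_cube {n : ℕ} {a x y : RSp n} {l : ℝ} (hl : 0 ≤ l) (hx : x ∈ cube a l)
    (hy : y ∈ cube a l) : ‖x - y‖ ≤ n * l := by
  refine norm_le_of_forall_abs_le hl fun i => ?_
  have h1 := hx i
  have h2 := hy i
  simp only [mem_Icc] at h1 h2
  rw [PiLp.sub_apply, abs_le]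
  constructor <;> linarith

lemma cube_subset_closedBall {n : ℕ} {a x : RSp n} {l : ℝ} (hl : 0 ≤ l) (hx : x ∈ cube a l) :
    cube a l ⊆ Metric.closedBall x (n * l) := fun y hy => by
  rw [Metric.mem_closedBall, dist_eq_norm]
  exact norm_sub_le_of_mem_cube hl hy hx

lemma isCompact_cube {n : ℕ} (a : RSp n) {l : ℝ} (hl : 0 ≤ l) : IsCompact (cube a l) := by
  refine Metric.isCompact_of_isClosed_isBounded (isClosed_cube a l) ?_
  have ha : a ∈ cube a l := fun i => ⟨le_rfl, by linarith⟩
  exact Metric.isBounded_closedBall.subset (cube_subset_closedBall hl ha)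

lemma measure_cube_ne_top {n : ℕ} (μ : Measure (RSp n)) [IsLocallyFiniteMeasure μ] (a : RSp n)
    (l : ℝ) : μ (cube a l) ≠ ∞ := by
  rcases le_or_gt 0 l with hl | hl
  · exact (isCompact_cube a hl).measure_lt_top.ne
  · have : IsCompact (cube a l) :=
      Metric.isCompact_of_isClosed_isBounded (isClosed_cube a l) <| by
        rcases Set.eq_empty_or_nonempty (cube a l) with h | ⟨x, hx⟩
        · simp [h]
        · rcases Nat.eq_zero_or_pos n with rfl | hn
          · exact (Set.toFinite _).isBounded
          · have h := hx ⟨0, hn⟩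
            simp only [mem_Icc] at h
            linarith
    exact this.measure_lt_top.ne

/-- The cube with centre `x` and side length `2 * r`. -/
noncomputable def centeredCorner {n : ℕ} (x : RSp n) (r : ℝ) : RSp n :=
  WithLp.toLp 2 fun i => x i - r

@[simp] lemma centeredCorner_apply {n : ℕ} (x : RSp n) (r : ℝ) (i : Fin n) :
    centeredCorner x r i = x i - r := rfl

lemma closedBall_subset_cube {n : ℕ} (x : RSp n) (r : ℝ) :
    Metric.closedBall x r ⊆ cube (centeredCorner x r) (2 * r) := by
  intro y hy i
  rw [Metric.mem_closedBall, dist_eq_norm] at hy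
  have := (abs_apply_le_norm (y - x) i).trans hy
  rw [PiLp.sub_apply, abs_le] at this
  simp only [centeredCorner_apply, mem_Icc]
  constructor <;> linarith

lemma setLIntegral_cube_le {n : ℕ} (σ : Measure (RSp n)) (f : RSp n → ℂ) {x a : RSp n} {l : ℝ}
    (hl : 0 < l) (hx : x ∈ cube a l) :
    ∫⁻ y in cube a l, ‖f y‖ₑ ∂σ ≤ volume (cube a l) * maxCube σ f x := by
  rw [mul_comm, ← ENNReal.div_le_iff (volume_cube_ne_zero a hl) (volume_cube_ne_top a hl)]
  unfold maxCube
  exact le_iSup_of_le a (le_iSup_of_le l (le_iSup_of_le ⟨hl, hx⟩ le_rfl))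

lemma setLIntegral_closedBall_le {n : ℕ} (σ : Measure (RSp n)) (f : RSp n → ℂ) {x w : RSp n}
    {r : ℝ} (hr : 0 < r) (hw : w ∈ Metric.closedBall x r) :
    ∫⁻ y in Metric.closedBall x r, ‖f y‖ₑ ∂σ ≤ ENNReal.ofReal ((2 * r) ^ n) * maxCube σ f w := by
  rw [← volume_cube (centeredCorner x r) (by positivity : 0 ≤ 2 * r)]
  exact (lintegral_mono_set (closedBall_subset_cube x r)).trans
    (setLIntegral_cube_le σ f (by positivity) (closedBall_subset_cube x r hw))

/-! ### Kernel estimates -/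

lemma IsDiniModulus.nonneg {δ : ℝ → ℝ} (h : IsDiniModulus δ) {s : ℝ} (hs : s ∈ Icc (0 : ℝ) 1) :
    0 ≤ δ s := by
  rw [← h.zero]
  exact h.mono ⟨le_rfl, zero_le_one⟩ hs hs.1

/-- The Dini sum `∑ δ(2^{-k-1})`. -/
noncomputable def diniSum (δ : ℝ → ℝ) : ℝ≥0∞ := ∑' k : ℕ, ENNReal.ofReal (δ ((1 / 2) ^ (k + 1)))

lemma IsDiniModulus.diniSum_ne_top {δ : ℝ → ℝ} (h : IsDiniModulus δ) : diniSum δ ≠ ∞ := by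
  have key : diniSum δ ≤ 2 * ∫⁻ s in Ioc (0 : ℝ) 1, ENNReal.ofReal (δ s / s) := by
    have hsub : (⋃ k : ℕ, Ioc ((1 / 2 : ℝ) ^ (k + 1)) ((1 / 2) ^ k)) ⊆ Ioc 0 1 := by
      refine iUnion_subset fun k s hs => ⟨lt_trans (by positivity) hs.1, hs.2.trans ?_⟩
      exact pow_le_one₀ (by norm_num) (by norm_num)
    have hdisj : Pairwise (Function.onFun Disjoint
        fun k : ℕ => Ioc ((1 / 2 : ℝ) ^ (k + 1)) ((1 / 2) ^ k)) := by
      have hanti : Antitone fun k : ℕ => (1 / 2 : ℝ) ^ k := fun i j hij =>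
        pow_le_pow_of_le_one (by norm_num) (by norm_num) hij
      exact hanti.pairwise_disjoint_on_Ioc_succ
    calc diniSum δ
        ≤ ∑' k : ℕ, 2 * ∫⁻ s in Ioc ((1 / 2 : ℝ) ^ (k + 1)) ((1 / 2) ^ k),
            ENNReal.ofReal (δ s / s) := by
          refine ENNReal.tsum_le_tsum fun k => ?_
          set r : ℝ := (1 / 2) ^ (k + 1) with hr
          have hr0 : 0 < r := by positivity
          have hr2 : (1 / 2 : ℝ) ^ k = 2 * r := by rw [hr, pow_succ]; ring
          have hr1 : 2 * r ≤ 1 := by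
            rw [← hr2]; exact pow_le_one₀ (by norm_num) (by norm_num)
          have hδ0 : 0 ≤ δ r := h.nonneg ⟨hr0.le, by linarith⟩
          rw [hr2]
          calc ENNReal.ofReal (δ r)
              = 2 * ∫⁻ _s in Ioc r (2 * r), ENNReal.ofReal (δ r / (2 * r)) := by
                rw [setLIntegral_const, Real.volume_Ioc, ← ENNReal.ofReal_mul (by positivity),
                  ← ENNReal.ofReal_ofNat 2, ← ENNReal.ofReal_mul (by norm_num)]
                congr 1
                field_simp
                ring
            _ ≤ 2 * ∫⁻ s in Ioc r (2 * r), ENNReal.ofReal (δ s / s) := by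
                gcongr 2 * ?_
                refine setLIntegral_mono' measurableSet_Ioc fun s hs => ?_
                refine ENNReal.ofReal_le_ofReal ?_
                have h1 : δ r ≤ δ s := h.mono ⟨hr0.le, by linarith⟩
                  ⟨by linarith [hs.1], by linarith [hs.2]⟩ hs.1.le
                have hs0 : 0 < s := hr0.trans hs.1
                exact div_le_div₀ (hδ0.trans h1) h1 hs0 hs.2
      _ = 2 * ∫⁻ s in ⋃ k : ℕ, Ioc ((1 / 2 : ℝ) ^ (k + 1)) ((1 / 2) ^ k),
            ENNReal.ofReal (δ s / s) := by
          rw [ENNReal.tsum_mul_left, lintegral_iUnion (fun _ => measurableSet_Ioc) hdisj]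
      _ ≤ _ := by gcongr
  refine ne_top_of_le_ne_top (ENNReal.mul_ne_top (by simp) ?_) key
  refine ne_top_of_le_ne_top h.dini.2.ne (lintegral_mono fun s => ?_)
  rw [Real.enorm_eq_ofReal_abs]
  exact ENNReal.ofReal_le_ofReal (le_abs_self _)

lemma IsDiniModulus.exists_lt {δ : ℝ → ℝ} (h : IsDiniModulus δ) {ε : ℝ} (hε : 0 < ε) :
    ∃ τ : ℝ, 0 < τ ∧ τ ≤ 1 / 2 ∧ δ τ < ε := by
  have h1 := ENNReal.tendsto_atTop_zero_of_tsum_ne_top h.diniSum_ne_top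
  have h2 := (h1.eventually_lt_const (ENNReal.ofReal_pos.2 hε)).exists
  obtain ⟨k, hk⟩ := h2
  refine ⟨(1 / 2) ^ (k + 1), by positivity, ?_, (ENNReal.ofReal_lt_ofReal_iff hε).1 hk⟩
  exact pow_le_of_le_one (by norm_num) (by norm_num) (by simp)

/-- The modulus `δ(s) + L s`, which a kernel of modulus `δ` has after multiplication by a cutoff
function that is Lipschitz at the scale of its argument. -/
lemma IsDiniModulus.add_linear {δ : ℝ → ℝ} (h : IsDiniModulus δ) {L : ℝ} (hL : 0 ≤ L) :
    IsDiniModulus fun s => δ s + L * s where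
  mono := fun s hs t ht hst => add_le_add (h.mono hs ht hst) (by gcongr)
  zero := by simp [h.zero]
  dini := by
    have h2 : IntegrableOn (fun _ : ℝ => L) (Ioc 0 1) volume :=
      integrableOn_const (by simp)
    refine (h.dini.add h2).congr_fun (fun s hs => ?_) measurableSet_Ioc
    have := hs.1.ne'
    simp only [Pi.add_apply]
    field_simp

/-- Size and smoothness bounds of a kernel, with given constant and modulus. -/
structure KernelBounds {n : ℕ} (C : ℝ) (δ : ℝ → ℝ) (k : RSp n → RSp n → ℂ) : Prop where
  meas : ∀ x, Measurable (k x)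
  nonneg : 0 ≤ C
  dini : IsDiniModulus δ
  size : ∀ x y, x ≠ y → ‖k x y‖ ≤ C / ‖x - y‖ ^ n
  smooth : ∀ x x' y, x ≠ y → ‖x - x'‖ / ‖x - y‖ ≤ 1 / 2 →
      ‖k x y - k x' y‖ ≤ C * δ (‖x - x'‖ / ‖x - y‖) / ‖x - y‖ ^ n

lemma IsSizeSmoothKernel.exists_kernelBounds {n : ℕ} {K : RSp n → RSp n → ℂ}
    (h : IsSizeSmoothKernel K) : ∃ C δ, KernelBounds C δ K := by
  obtain ⟨C, δ, hδ, h1, h2⟩ := h.bounds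
  refine ⟨max C 0, δ, h.meas, le_max_right _ _, hδ, fun x y hxy => (h1 x y hxy).trans ?_,
    fun x x' y hxy ht => (h2 x x' y hxy ht).trans ?_⟩
  · gcongr; exact le_max_left _ _
  · have : 0 ≤ δ (‖x - x'‖ / ‖x - y‖) := hδ.nonneg ⟨by positivity, ht.trans (by norm_num)⟩
    gcongr; exact le_max_left _ _

/-- The smoothness bound integrated against `fσ` over the dyadic annuli around `x`: the Dini
condition makes the sum converge. The maximal function may be taken at any point `w` near `x`. -/
lemma KernelBounds.lintegral_sub_le {n : ℕ} {C : ℝ} {δ : ℝ → ℝ} {k : RSp n → RSp n → ℂ}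
    (hk : KernelBounds C δ k) (σ : Measure (RSp n)) (f : RSp n → ℂ) {x z w : RSp n}
    {ρ : ℝ} (hρ : 0 < ρ) (hxz : ‖x - z‖ ≤ ρ / 2) (hw : w ∈ Metric.closedBall x ρ) :
    ∫⁻ y in (Metric.ball x ρ)ᶜ, ‖k x y - k z y‖ₑ * ‖f y‖ₑ ∂σ ≤
      ENNReal.ofReal (C * 4 ^ n) * diniSum δ * maxCube σ f w := by
  let A : ℕ → Set (RSp n) := fun j =>
    (fun y => ‖x - y‖) ⁻¹' Ico (2 ^ j * ρ) (2 ^ (j + 1) * ρ)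
  have hcover : (Metric.ball x ρ)ᶜ ⊆ ⋃ j, A j := by
    intro y hy
    have hy1 : ρ ≤ ‖x - y‖ := by
      simpa [dist_eq_norm, norm_sub_rev] using hy
    obtain ⟨j, hj1, hj2⟩ := exists_nat_pow_near (x := ‖x - y‖ / ρ) (y := (2 : ℝ))
      (by rwa [le_div_iff₀ hρ, one_mul]) (by norm_num)
    refine mem_iUnion.2 ⟨j, ?_, ?_⟩
    · rwa [le_div_iff₀ hρ] at hj1
    · rwa [div_lt_iff₀ hρ] at hj2
  have hA : ∀ j, MeasurableSet (A j) := fun j => by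
    have hm : Measurable fun y : RSp n => ‖x - y‖ := by fun_prop
    exact hm measurableSet_Ico
  have hann : ∀ j : ℕ, ∫⁻ y in A j, ‖k x y - k z y‖ₑ * ‖f y‖ₑ ∂σ ≤
      ENNReal.ofReal (C * 4 ^ n) * ENNReal.ofReal (δ ((1 / 2) ^ (j + 1))) * maxCube σ f w := by
    intro j
    set d := δ ((1 / 2) ^ (j + 1)) with hd
    have h12 : ((1 : ℝ) / 2) ^ (j + 1) ∈ Icc (0 : ℝ) 1 :=
      ⟨by positivity, pow_le_one₀ (by norm_num) (by norm_num)⟩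
    have hd0 : 0 ≤ d := hk.dini.nonneg h12
    have hC := hk.nonneg
    have hpt : ∀ y ∈ A j, ‖k x y - k z y‖ₑ * ‖f y‖ₑ ≤
        ENNReal.ofReal (C * d / (2 ^ j * ρ) ^ n) * ‖f y‖ₑ := by
      rintro y ⟨hy1, hy2⟩
      gcongr
      have hpos : 0 < ‖x - y‖ := lt_of_lt_of_le (by positivity) hy1
      have hne : x ≠ y := fun h => by simp [h] at hpos
      have hratio : ‖x - z‖ / ‖x - y‖ ≤ (1 / 2) ^ (j + 1) := by
        rw [div_le_iff₀ hpos]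
        calc ‖x - z‖ ≤ ρ / 2 := hxz
          _ = (1 / 2) ^ (j + 1) * (2 ^ j * ρ) := by
              rw [pow_succ, div_pow, one_pow]; field_simp
          _ ≤ _ := by gcongr
      have hhalf : ((1 : ℝ) / 2) ^ (j + 1) ≤ 1 / 2 :=
        pow_le_of_le_one (by norm_num) (by norm_num) (by simp)
      have h3 := hk.smooth x z y hne (hratio.trans hhalf)
      rw [← ofReal_norm]
      refine ENNReal.ofReal_le_ofReal (h3.trans ?_)
      have h4 : δ (‖x - z‖ / ‖x - y‖) ≤ d :=
        hk.dini.mono ⟨by positivity, hratio.trans h12.2⟩ h12 hratio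
      gcongr
    calc ∫⁻ y in A j, ‖k x y - k z y‖ₑ * ‖f y‖ₑ ∂σ
        ≤ ∫⁻ y in A j, ENNReal.ofReal (C * d / (2 ^ j * ρ) ^ n) * ‖f y‖ₑ ∂σ :=
          setLIntegral_mono' (hA j) hpt
      _ = ENNReal.ofReal (C * d / (2 ^ j * ρ) ^ n) * ∫⁻ y in A j, ‖f y‖ₑ ∂σ :=
          lintegral_const_mul' _ _ ENNReal.ofReal_ne_top
      _ ≤ ENNReal.ofReal (C * d / (2 ^ j * ρ) ^ n) *
            (ENNReal.ofReal ((2 * (2 ^ (j + 1) * ρ)) ^ n) * maxCube σ f w) := by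
          gcongr
          refine le_trans (lintegral_mono_set ?_)
            (setLIntegral_closedBall_le σ f (x := x) (r := 2 ^ (j + 1) * ρ) (by positivity)
              (Metric.closedBall_subset_closedBall
                (le_mul_of_one_le_left hρ.le (one_le_pow₀ one_le_two)) hw))
          rintro y ⟨-, hy2⟩
          rw [Metric.mem_closedBall, dist_eq_norm, norm_sub_rev]
          exact hy2.le
      _ = _ := by
          rw [← mul_assoc, ← ENNReal.ofReal_mul (by positivity),
            ← ENNReal.ofReal_mul (by positivity)]
          congr 2
          have : (2 * (2 ^ (j + 1) * ρ)) = 4 * (2 ^ j * ρ) := by ring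
          rw [this, mul_pow 4]
          field_simp
  calc ∫⁻ y in (Metric.ball x ρ)ᶜ, ‖k x y - k z y‖ₑ * ‖f y‖ₑ ∂σ
      ≤ ∫⁻ y in ⋃ j, A j, ‖k x y - k z y‖ₑ * ‖f y‖ₑ ∂σ := lintegral_mono_set hcover
    _ ≤ ∑' j, ∫⁻ y in A j, ‖k x y - k z y‖ₑ * ‖f y‖ₑ ∂σ := lintegral_iUnion_le _ _
    _ ≤ ∑' j : ℕ, ENNReal.ofReal (C * 4 ^ n) * ENNReal.ofReal (δ ((1 / 2) ^ (j + 1))) *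
          maxCube σ f w := ENNReal.tsum_le_tsum hann
    _ = _ := by rw [ENNReal.tsum_mul_right, ENNReal.tsum_mul_left, diniSum]

lemma KernelBounds.enorm_le {n : ℕ} {C : ℝ} {δ : ℝ → ℝ} {k : RSp n → RSp n → ℂ}
    (hk : KernelBounds C δ k) {x y : RSp n} {r : ℝ} (hr : 0 < r) (hxy : r ≤ ‖x - y‖) :
    ‖k x y‖ₑ ≤ ENNReal.ofReal (C / r ^ n) := by
  have hpos : 0 < ‖x - y‖ := hr.trans_le hxy
  have hne : x ≠ y := fun h => by simp [h] at hpos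
  rw [← ofReal_norm]
  refine ENNReal.ofReal_le_ofReal ((hk.size x y hne).trans ?_)
  have := hk.nonneg
  gcongr

/-! ### Truncations by a class of cutoff functions -/

/-- A cutoff function of `x - y` that vanishes near `0` and far away, and is Lipschitz at the scale
of its argument with constant `L`. -/
structure IsCutoff {n : ℕ} (L : ℝ) (φ : RSp n → ℝ) : Prop where
  cont : Continuous φ
  abs_le_one : ∀ v, |φ v| ≤ 1
  zero_near : ∃ r : ℝ, 0 < r ∧ ∀ v, ‖v‖ ≤ r → φ v = 0
  zero_far : ∃ R : ℝ, 0 < R ∧ ∀ v, R ≤ ‖v‖ → φ v = 0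
  regular : ∀ v w, ‖v - w‖ ≤ ‖v‖ / 2 → |φ v - φ w| * ‖v‖ ≤ L * ‖v - w‖

/-- A class of cutoff functions with uniform bounds that is closed under enlarging the inner hole
to any radius `ρ` (at the cost of changing the function on `‖v‖ < A ρ`), and that contains functions
equal to `1` on arbitrary annuli. These are the only properties of the two families of truncations
that the comparison of the maximal operators with the maximal function needs. -/
structure IsCutoffClass {n : ℕ} (A L : ℝ) (Φ : Set (RSp n → ℝ)) : Prop where
  one_lt : 1 < A
  nonneg : 0 ≤ L
  isCutoff : ∀ φ ∈ Φ, IsCutoff L φ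
  modify : ∀ φ ∈ Φ, ∀ ρ : ℝ, 0 < ρ → (∀ v, A * ρ ≤ ‖v‖ → φ v = 0) ∨
    ∃ ψ ∈ Φ, (∀ v, ‖v‖ ≤ ρ → ψ v = 0) ∧ ∀ v, A * ρ ≤ ‖v‖ → φ v = ψ v
  exists_one : ∀ ρ R : ℝ, 0 < ρ → ∃ φ ∈ Φ, (∀ v, ‖v‖ ≤ ρ → φ v = 0) ∧
    ∀ v, A * ρ ≤ ‖v‖ → ‖v‖ ≤ R → φ v = 1

lemma isCutoff_zero {n : ℕ} {L : ℝ} (hL : 0 ≤ L) : IsCutoff L (fun _ : RSp n => (0 : ℝ)) where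
  cont := continuous_const
  abs_le_one := by simp
  zero_near := ⟨1, one_pos, by simp⟩
  zero_far := ⟨1, one_pos, by simp⟩
  regular := fun v w _ => by simp; positivity

/-- The kernel `K(x,y)` multiplied by the cutoff `φ(x - y)`. -/
noncomputable def cutKernel {n : ℕ} (K : RSp n → RSp n → ℂ) (φ : RSp n → ℝ) (x y : RSp n) : ℂ :=
  K x y * (φ (x - y) : ℂ)

/-- The integral of `fσ` against the kernel `K` truncated by `φ`. -/
noncomputable def truncOp {n : ℕ} (K : RSp n → RSp n → ℂ) (σ : Measure (RSp n)) (φ : RSp n → ℝ)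
    (f : RSp n → ℂ) (x : RSp n) : ℂ :=
  ∫ y, cutKernel K φ x y * f y ∂σ

/-- The maximal operator over the truncations by cutoff functions in `Φ`. -/
noncomputable def maxOp {n : ℕ} (K : RSp n → RSp n → ℂ) (σ : Measure (RSp n))
    (Φ : Set (RSp n → ℝ)) (f : RSp n → ℂ) (x : RSp n) : ℝ≥0∞ :=
  ⨆ φ ∈ Φ, ‖truncOp K σ φ f x‖ₑ

lemma enorm_truncOp_le_maxOp {n : ℕ} (K : RSp n → RSp n → ℂ) (σ : Measure (RSp n))
    {Φ : Set (RSp n → ℝ)} {φ : RSp n → ℝ} (hφ : φ ∈ Φ) (f : RSp n → ℂ) (x : RSp n) :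
    ‖truncOp K σ φ f x‖ₑ ≤ maxOp K σ Φ f x := by
  unfold maxOp
  exact le_iSup₂_of_le φ hφ le_rfl

lemma KernelBounds.cut {n : ℕ} {C L : ℝ} {δ : ℝ → ℝ} {K : RSp n → RSp n → ℂ}
    (hK : KernelBounds C δ K) (hL : 0 ≤ L) {φ : RSp n → ℝ} (hφ : IsCutoff L φ) :
    KernelBounds C (fun s => δ s + L * s) (cutKernel K φ) where
  meas := fun x => by
    have h1 := hK.meas x
    have h2 := hφ.cont.measurable
    unfold cutKernel
    fun_prop
  nonneg := hK.nonneg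
  dini := hK.dini.add_linear hL
  size := fun x y hxy => by
    rw [cutKernel, norm_mul, Complex.norm_real, Real.norm_eq_abs]
    exact (mul_le_of_le_one_right (norm_nonneg _) (hφ.abs_le_one _)).trans (hK.size x y hxy)
  smooth := fun x x' y hxy hr => by
    have hpos : 0 < ‖x - y‖ := norm_pos_iff.2 (sub_ne_zero.2 hxy)
    have hvw : x - y - (x' - y) = x - x' := by abel
    have hreg := hφ.regular (x - y) (x' - y) (by
      rw [hvw]; rw [div_le_iff₀ hpos] at hr; linarith)
    rw [hvw, ← le_div_iff₀ hpos] at hreg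
    have h1 := hK.size x y hxy
    have h2 := hK.smooth x x' y hxy hr
    have hsplit : cutKernel K φ x y - cutKernel K φ x' y =
        K x y * ((φ (x - y) - φ (x' - y) : ℝ) : ℂ) +
          (K x y - K x' y) * (φ (x' - y) : ℂ) := by
      simp only [cutKernel, Complex.ofReal_sub]; ring
    calc ‖cutKernel K φ x y - cutKernel K φ x' y‖
        ≤ ‖K x y‖ * |φ (x - y) - φ (x' - y)| + ‖K x y - K x' y‖ * |φ (x' - y)| := by
          rw [hsplit]
          refine (norm_add_le _ _).trans_eq ?_
          rw [norm_mul, norm_mul, Complex.norm_real, Complex.norm_real, Real.norm_eq_abs,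
            Real.norm_eq_abs]
      _ ≤ C / ‖x - y‖ ^ n * (L * ‖x - x'‖ / ‖x - y‖) +
            C * δ (‖x - x'‖ / ‖x - y‖) / ‖x - y‖ ^ n := by
          refine add_le_add ?_ ((mul_le_of_le_one_right (norm_nonneg _) (hφ.abs_le_one _)).trans h2)
          have := hK.nonneg
          gcongr
      _ = C * (δ (‖x - x'‖ / ‖x - y‖) + L * (‖x - x'‖ / ‖x - y‖)) / ‖x - y‖ ^ n := by ring

lemma IsCutoff.cutKernel_eq_zero {n : ℕ} {φ : RSp n → ℝ} {K : RSp n → RSp n → ℂ} {x y : RSp n}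
    (h : φ (x - y) = 0) : cutKernel K φ x y = 0 := by
  simp [cutKernel, h]

lemma LocallyIntegrable.integrableOn_closedBall {n : ℕ} {σ : Measure (RSp n)} {f : RSp n → ℂ}
    (hf : LocallyIntegrable f σ) (x : RSp n) (R : ℝ) :
    IntegrableOn f (Metric.closedBall x R) σ :=
  hf.integrableOn_isCompact (isCompact_closedBall x R)

section
variable {n : ℕ} {C L : ℝ} {δ : ℝ → ℝ} {K : RSp n → RSp n → ℂ} {σ : Measure (RSp n)}
  {φ : RSp n → ℝ} {f : RSp n → ℂ}

lemma KernelBounds.norm_cutKernel_le (hK : KernelBounds C δ K) (hL : 0 ≤ L) (hφ : IsCutoff L φ)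
    {r : ℝ} (hr : 0 < r) (h0 : ∀ v, ‖v‖ ≤ r → φ v = 0) (x y : RSp n) :
    ‖cutKernel K φ x y‖ ≤ C / r ^ n := by
  have hC := hK.nonneg
  by_cases h : ‖x - y‖ ≤ r
  · rw [IsCutoff.cutKernel_eq_zero (h0 _ h), norm_zero]
    positivity
  · push Not at h
    have hne : x ≠ y := by rintro rfl; simp at h; linarith
    refine ((hK.cut hL hφ).size x y hne).trans ?_
    gcongr

lemma KernelBounds.integrable_cutKernel_mul (hK : KernelBounds C δ K) (hL : 0 ≤ L)
    (hφ : IsCutoff L φ) (hf : LocallyIntegrable f σ) (x : RSp n) :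
    Integrable (fun y => cutKernel K φ x y * f y) σ := by
  obtain ⟨r, hr, h0⟩ := hφ.zero_near
  obtain ⟨R, hR, h1⟩ := hφ.zero_far
  have hint : Integrable ((Metric.closedBall x R).indicator fun y => C / r ^ n * ‖f y‖) σ := by
    rw [integrable_indicator_iff Metric.isClosed_closedBall.measurableSet]
    exact (LocallyIntegrable.integrableOn_closedBall hf x R).norm.const_mul _
  refine hint.mono' (((hK.cut hL hφ).meas x).aestronglyMeasurable.mul
    hf.aestronglyMeasurable) (Filter.Eventually.of_forall fun y => ?_)
  by_cases hy : y ∈ Metric.closedBall x R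
  · rw [indicator_of_mem hy, norm_mul]
    gcongr
    exact hK.norm_cutKernel_le hL hφ hr h0 x y
  · rw [indicator_of_notMem hy, IsCutoff.cutKernel_eq_zero, zero_mul, norm_zero]
    refine h1 _ ?_
    rw [Metric.mem_closedBall, dist_eq_norm, norm_sub_rev] at hy
    exact (not_le.1 hy).le

lemma KernelBounds.continuousAt (hK : KernelBounds C δ K) {x y : RSp n} (hxy : x ≠ y) :
    ContinuousAt (fun x' => K x' y) x := by
  have hpos : 0 < ‖x - y‖ := norm_pos_iff.2 (sub_ne_zero.2 hxy)
  have hC := hK.nonneg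
  rw [Metric.continuousAt_iff]
  intro ε hε
  obtain ⟨τ, hτ0, hτ1, hτ⟩ := hK.dini.exists_lt (ε := ε * ‖x - y‖ ^ n / (C + 1)) (by positivity)
  refine ⟨τ * ‖x - y‖, by positivity, fun {x'} hx' => ?_⟩
  have hratio : ‖x - x'‖ / ‖x - y‖ ≤ τ := by
    rw [div_le_iff₀ hpos, norm_sub_rev, ← dist_eq_norm]
    exact hx'.le
  rw [dist_eq_norm, norm_sub_rev]
  refine (hK.smooth x x' y hxy (hratio.trans hτ1)).trans_lt ?_
  have h1 : δ (‖x - x'‖ / ‖x - y‖) ≤ δ τ :=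
    hK.dini.mono ⟨by positivity, by linarith⟩ ⟨hτ0.le, by linarith⟩ hratio
  have h0 : 0 ≤ δ (‖x - x'‖ / ‖x - y‖) := hK.dini.nonneg ⟨by positivity, by linarith⟩
  rw [div_lt_iff₀ (by positivity)]
  rw [lt_div_iff₀ (by positivity)] at hτ
  nlinarith

lemma KernelBounds.continuous_truncOp (hK : KernelBounds C δ K) (hL : 0 ≤ L)
    (hφ : IsCutoff L φ) (hf : LocallyIntegrable f σ) : Continuous (truncOp K σ φ f) := by
  obtain ⟨r, hr, h0⟩ := hφ.zero_near
  obtain ⟨R, hR, h1⟩ := hφ.zero_far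
  rw [continuous_iff_continuousAt]
  intro x
  have hint : Integrable ((Metric.closedBall x (R + 1)).indicator
      fun y => C / r ^ n * ‖f y‖) σ := by
    rw [integrable_indicator_iff Metric.isClosed_closedBall.measurableSet]
    exact (LocallyIntegrable.integrableOn_closedBall hf x (R + 1)).norm.const_mul _
  unfold truncOp
  refine continuousAt_of_dominated (Filter.Eventually.of_forall fun x' =>
    ((hK.cut hL hφ).meas x').aestronglyMeasurable.mul hf.aestronglyMeasurable) ?_ hint
    (Filter.Eventually.of_forall fun y => ?_)
  · filter_upwards [Metric.ball_mem_nhds x one_pos] with x' hx'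
    refine Filter.Eventually.of_forall fun y => ?_
    by_cases hy : y ∈ Metric.closedBall x (R + 1)
    · rw [indicator_of_mem hy, norm_mul]
      gcongr
      exact hK.norm_cutKernel_le hL hφ hr h0 x' y
    · rw [indicator_of_notMem hy, IsCutoff.cutKernel_eq_zero, zero_mul, norm_zero]
      refine h1 _ ?_
      rw [Metric.mem_closedBall, not_le] at hy
      rw [Metric.mem_ball] at hx'
      have := dist_triangle_right y x x'
      rw [← dist_eq_norm, dist_comm]
      rw [dist_comm x x'] at this
      linarith
  · refine ContinuousAt.mul ?_ continuousAt_const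
    by_cases hxy : x = y
    · have hev : ∀ᶠ x' in 𝓝 x, cutKernel K φ x' y = 0 := by
        filter_upwards [Metric.closedBall_mem_nhds x hr] with x' hx'
        rw [Metric.mem_closedBall, dist_eq_norm, hxy] at hx'
        exact IsCutoff.cutKernel_eq_zero (h0 _ hx')
      exact (continuousAt_const (y := (0 : ℂ))).congr (hev.mono fun _ h => h.symm)
    · unfold cutKernel
      refine (hK.continuousAt hxy).mul ?_
      have := hφ.cont
      fun_prop

lemma KernelBounds.lowerSemicontinuous_maxOp {A : ℝ} {Φ : Set (RSp n → ℝ)}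
    (hK : KernelBounds C δ K) (hΦ : IsCutoffClass A L Φ) (hf : LocallyIntegrable f σ) :
    LowerSemicontinuous (maxOp K σ Φ f) := by
  unfold maxOp
  refine lowerSemicontinuous_iSup fun φ => lowerSemicontinuous_iSup fun hφ => ?_
  exact (hK.continuous_truncOp hΦ.nonneg (hΦ.isCutoff φ hφ) hf).enorm.lowerSemicontinuous

/-- Comparison of two truncations at neighbouring points: if `φ` and `ψ` agree outside the ball of
radius `A ρ` and `ψ` vanishes within `ρ`, then moving from `x` to `z` costs a multiple of the
maximal function. -/
lemma KernelBounds.enorm_truncOp_le {A θ ρ : ℝ} {ψ : RSp n → ℝ} {E : Set (RSp n)}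
    {x z w : RSp n} (hK : KernelBounds C δ K) (hL : 0 ≤ L) (hφ : IsCutoff L φ)
    (hψ : IsCutoff L ψ) (hA : 1 < A) (hθ : 0 < θ) (hρ : 0 < ρ)
    (hf : LocallyIntegrable f σ) (hE : MeasurableSet E)
    (hE1 : Metric.ball x (θ * ρ) ⊆ E) (hE2 : E ⊆ Metric.closedBall x ρ) (hxz : ‖x - z‖ ≤ ρ / 2)
    (hw : w ∈ Metric.closedBall x ρ)
    (hψ0 : ∀ v, ‖v‖ ≤ ρ → ψ v = 0) (heq : ∀ v, A * ρ ≤ ‖v‖ → φ v = ψ v) :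
    ‖truncOp K σ φ (Eᶜ.indicator f) x‖ₑ ≤ ‖truncOp K σ ψ f z‖ₑ +
      (ENNReal.ofReal (C * 4 ^ n) * diniSum (fun s => δ s + L * s) +
        ENNReal.ofReal (C * (1 / θ ^ n + 1) * (2 * A) ^ n)) * maxCube σ f w := by
  have hC := hK.nonneg
  have hA0 : 0 < A := by linarith
  have hi1 := hK.integrable_cutKernel_mul hL hφ (hf.indicator hE.compl) x
  have hi2 := hK.integrable_cutKernel_mul hL hψ hf z
  have hsub : truncOp K σ φ (Eᶜ.indicator f) x = truncOp K σ ψ f z +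
      ∫ y, (cutKernel K φ x y * Eᶜ.indicator f y - cutKernel K ψ z y * f y) ∂σ := by
    rw [integral_sub hi1 hi2]; simp [truncOp]
  rw [hsub]
  refine (enorm_add_le _ _).trans ?_
  gcongr
  refine (enorm_integral_le_lintegral_enorm _).trans ?_
  rw [← lintegral_add_compl _ (Metric.isOpen_ball (x := x) (ε := A * ρ)).measurableSet,
    add_mul, add_comm]
  refine add_le_add ?_ ?_
  · -- Outside the ball of radius `A ρ` the two truncations coincide and smoothness applies.
    have h1 : ∀ y ∈ (Metric.ball x (A * ρ))ᶜ,
        ‖cutKernel K φ x y * Eᶜ.indicator f y - cutKernel K ψ z y * f y‖ₑ ≤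
          ‖cutKernel K ψ x y - cutKernel K ψ z y‖ₑ * ‖f y‖ₑ := by
      intro y hy
      have hy' : A * ρ ≤ ‖x - y‖ := by simpa [dist_eq_norm, norm_sub_rev] using hy
      have hyE : y ∈ Eᶜ := fun h => by
        have := hE2 h
        rw [Metric.mem_closedBall, dist_eq_norm, norm_sub_rev] at this
        nlinarith
      rw [indicator_of_mem hyE, ← enorm_mul, sub_mul]
      simp only [cutKernel, heq _ hy', le_refl]
    refine (setLIntegral_mono' Metric.isOpen_ball.measurableSet.compl h1).trans ?_
    refine (lintegral_mono_set (compl_subset_compl.2 (Metric.ball_subset_ball ?_))).trans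
      ((hK.cut hL hψ).lintegral_sub_le σ f hρ hxz hw)
    nlinarith
  · -- Inside the ball both kernels are bounded by a multiple of `ρ⁻ⁿ`.
    have h1 : ∀ y ∈ Metric.ball x (A * ρ),
        ‖cutKernel K φ x y * Eᶜ.indicator f y - cutKernel K ψ z y * f y‖ₑ ≤
          ENNReal.ofReal (C / (θ * ρ) ^ n + C / ρ ^ n) * ‖f y‖ₑ := by
      intro y _
      rw [ENNReal.ofReal_add (by positivity) (by positivity), add_mul]
      refine (enorm_sub_le).trans ?_
      rw [enorm_mul, enorm_mul]
      refine add_le_add ?_ ?_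
      · by_cases hyE : y ∈ E
        · simp [hyE]
        · rw [indicator_of_mem (show y ∈ Eᶜ from hyE)]
          gcongr
          refine (hK.cut hL hφ).enorm_le (by positivity) ?_
          by_contra hlt
          exact hyE (hE1 (by rw [Metric.mem_ball, dist_eq_norm, norm_sub_rev]; exact not_le.1 hlt))
      · gcongr
        rw [← ofReal_norm]
        exact ENNReal.ofReal_le_ofReal (hK.norm_cutKernel_le hL hψ hρ hψ0 z y)
    calc ∫⁻ y in Metric.ball x (A * ρ),
          ‖cutKernel K φ x y * Eᶜ.indicator f y - cutKernel K ψ z y * f y‖ₑ ∂σ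
        ≤ ∫⁻ y in Metric.ball x (A * ρ),
            ENNReal.ofReal (C / (θ * ρ) ^ n + C / ρ ^ n) * ‖f y‖ₑ ∂σ :=
          setLIntegral_mono' Metric.isOpen_ball.measurableSet h1
      _ = ENNReal.ofReal (C / (θ * ρ) ^ n + C / ρ ^ n) *
            ∫⁻ y in Metric.ball x (A * ρ), ‖f y‖ₑ ∂σ :=
          lintegral_const_mul' _ _ ENNReal.ofReal_ne_top
      _ ≤ ENNReal.ofReal (C / (θ * ρ) ^ n + C / ρ ^ n) *
            (ENNReal.ofReal ((2 * (A * ρ)) ^ n) * maxCube σ f w) := by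
          gcongr
          exact (lintegral_mono_set Metric.ball_subset_closedBall).trans
            (setLIntegral_closedBall_le σ f (by positivity)
              (Metric.closedBall_subset_closedBall (le_mul_of_one_le_left hρ.le hA.le) hw))
      _ = _ := by
          rw [← mul_assoc, ← ENNReal.ofReal_mul (by positivity)]
          congr 2
          have : (2 * (A * ρ)) = (2 * A) * ρ := by ring
          rw [this, mul_pow (2 * A) ρ, mul_pow θ ρ]
          field_simp

/-- The part of a truncation that comes from outside a neighbourhood `E` of `x` is at most the
value of the maximal operator at a nearby point `z`, with constant one, plus a multiple of the
maximal function at any nearby point `w`. -/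
lemma KernelBounds.exists_truncOp_compl_le {A θ : ℝ} {Φ : Set (RSp n → ℝ)}
    (hK : KernelBounds C δ K) (hΦ : IsCutoffClass A L Φ) (hθ : 0 < θ) :
    ∃ C₁ : ℝ≥0, ∀ (σ : Measure (RSp n)) (f : RSp n → ℂ), LocallyIntegrable f σ →
      ∀ (ρ : ℝ) (x z w : RSp n) (E : Set (RSp n)), 0 < ρ → MeasurableSet E →
        Metric.ball x (θ * ρ) ⊆ E → E ⊆ Metric.closedBall x ρ → ‖x - z‖ ≤ ρ / 2 →
        w ∈ Metric.closedBall x ρ → ∀ φ ∈ Φ,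
          ‖truncOp K σ φ (Eᶜ.indicator f) x‖ₑ ≤ maxOp K σ Φ f z + C₁ * maxCube σ f w := by
  have hfin : ENNReal.ofReal (C * 4 ^ n) * diniSum (fun s => δ s + L * s) +
        ENNReal.ofReal (C * (1 / θ ^ n + 1) * (2 * A) ^ n) ≠ ∞ :=
    ENNReal.add_ne_top.2 ⟨ENNReal.mul_ne_top ENNReal.ofReal_ne_top
      (hK.dini.add_linear hΦ.nonneg).diniSum_ne_top, ENNReal.ofReal_ne_top⟩
  obtain ⟨C₁, hC₁⟩ : ∃ c : ℝ≥0, (c : ℝ≥0∞) = _ := ⟨_, ENNReal.coe_toNNReal hfin⟩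
  refine ⟨C₁, fun σ f hf ρ x z w E hρ hE hE1 hE2 hxz hw φ hφ => ?_⟩
  rw [hC₁]
  have hcut := hΦ.isCutoff φ hφ
  rcases hΦ.modify φ hφ ρ hρ with h0 | ⟨ψ, hψ, hψ0, heq⟩
  · refine (hK.enorm_truncOp_le hΦ.nonneg hcut (isCutoff_zero hΦ.nonneg) hΦ.one_lt hθ hρ hf hE
      hE1 hE2 hxz hw (fun _ _ => rfl) h0).trans ?_
    refine add_le_add ?_ le_rfl
    simp [truncOp, cutKernel]
  · refine (hK.enorm_truncOp_le hΦ.nonneg hcut (hΦ.isCutoff ψ hψ) hΦ.one_lt hθ hρ hf hE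
      hE1 hE2 hxz hw hψ0 heq).trans ?_
    exact add_le_add (enorm_truncOp_le_maxOp K σ hψ _ _) le_rfl

lemma KernelBounds.maxOp_le_indicator_add {A : ℝ} {Φ : Set (RSp n → ℝ)} {E : Set (RSp n)}
    {x : RSp n} {B : ℝ≥0∞} (hK : KernelBounds C δ K) (hΦ : IsCutoffClass A L Φ)
    (hf : LocallyIntegrable f σ) (hE : MeasurableSet E)
    (hB : ∀ φ ∈ Φ, ‖truncOp K σ φ (Eᶜ.indicator f) x‖ₑ ≤ B) :
    maxOp K σ Φ f x ≤ maxOp K σ Φ (E.indicator f) x + B := by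
  rw [maxOp]
  refine iSup₂_le fun φ hφ => ?_
  have hcut := hΦ.isCutoff φ hφ
  have hadd : truncOp K σ φ f x =
      truncOp K σ φ (E.indicator f) x + truncOp K σ φ (Eᶜ.indicator f) x := by
    unfold truncOp
    rw [← integral_add (hK.integrable_cutKernel_mul hΦ.nonneg hcut (hf.indicator hE) x)
      (hK.integrable_cutKernel_mul hΦ.nonneg hcut (hf.indicator hE.compl) x)]
    congr 1 with y
    rw [← mul_add, indicator_self_add_compl_apply]
  rw [hadd]
  exact (enorm_add_le _ _).trans (add_le_add (enorm_truncOp_le_maxOp K σ hφ _ _) (hB φ hφ))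

/-- The maximum principle for the maximal truncations. -/
lemma KernelBounds.exists_maximum_principle {A θ : ℝ} {Φ : Set (RSp n → ℝ)}
    (hK : KernelBounds C δ K) (hΦ : IsCutoffClass A L Φ) (hθ : 0 < θ) :
    ∃ C₁ : ℝ≥0, ∀ (σ : Measure (RSp n)) (f : RSp n → ℂ), LocallyIntegrable f σ →
      ∀ (ρ : ℝ) (x z : RSp n) (E : Set (RSp n)), 0 < ρ → MeasurableSet E →
        Metric.ball x (θ * ρ) ⊆ E → E ⊆ Metric.closedBall x ρ → ‖x - z‖ ≤ ρ / 2 →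
          maxOp K σ Φ f x ≤ maxOp K σ Φ (E.indicator f) x +
            (maxOp K σ Φ f z + C₁ * maxCube σ f x) := by
  obtain ⟨C₁, hC₁⟩ := hK.exists_truncOp_compl_le hΦ hθ
  refine ⟨C₁, fun σ f hf ρ x z E hρ hE hE1 hE2 hxz => ?_⟩
  exact hK.maxOp_le_indicator_add hΦ hf hE (hC₁ σ f hf ρ x z x E hρ hE hE1 hE2 hxz
    (Metric.mem_closedBall_self hρ.le))

/-- Away from the support of `f` the maximal operator is controlled by the total mass of `fσ`. -/
lemma KernelBounds.maxOp_le_of_support {A r : ℝ} {Φ : Set (RSp n → ℝ)} {x : RSp n}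
    (hK : KernelBounds C δ K) (hΦ : IsCutoffClass A L Φ) (hr : 0 < r)
    (hsupp : ∀ y, f y ≠ 0 → r ≤ ‖x - y‖) :
    maxOp K σ Φ f x ≤ ENNReal.ofReal (C / r ^ n) * ∫⁻ y, ‖f y‖ₑ ∂σ := by
  rw [maxOp]
  refine iSup₂_le fun φ hφ => ?_
  refine (enorm_integral_le_lintegral_enorm _).trans ?_
  rw [← lintegral_const_mul' _ _ ENNReal.ofReal_ne_top]
  refine lintegral_mono fun y => ?_
  rw [enorm_mul]
  by_cases hy : f y = 0
  · simp [hy]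
  · gcongr
    exact (hK.cut hΦ.nonneg (hΦ.isCutoff φ hφ)).enorm_le hr (hsupp y hy)

end

/-! ### Whitney cubes -/

/-- The concentric dilate by the factor `3` of the cube with lower corner `a` and side `l`. -/
def tripleCube {n : ℕ} (a : RSp n) (l : ℝ) : Set (RSp n) := cube (centeredCorner a l) (3 * l)

lemma cube_subset_tripleCube {n : ℕ} {a : RSp n} {l : ℝ} (hl : 0 ≤ l) :
    cube a l ⊆ tripleCube a l := fun x hx i => by
  have := hx i
  simp only [mem_Icc, centeredCorner_apply] at this ⊢
  constructor <;> linarith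

lemma ball_subset_tripleCube {n : ℕ} {a x : RSp n} {l : ℝ} (hx : x ∈ cube a l) :
    Metric.ball x l ⊆ tripleCube a l := fun y hy i => by
  have h1 := hx i
  rw [Metric.mem_ball, dist_eq_norm] at hy
  have h2 := (abs_apply_le_norm (y - x) i).trans hy.le
  rw [PiLp.sub_apply, abs_le] at h2
  simp only [mem_Icc, centeredCorner_apply] at h1 ⊢
  constructor <;> linarith

/-- The lower corner of the grid cube of side `s` with integer position `m`. -/
noncomputable def gridCorner {n : ℕ} (s : ℝ) (m : Fin n → ℤ) : RSp n :=
  WithLp.toLp 2 fun i => m i * s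

@[simp] lemma gridCorner_apply {n : ℕ} (s : ℝ) (m : Fin n → ℤ) (i : Fin n) :
    gridCorner s m i = m i * s := rfl

lemma exists_mem_cube_gridCorner {n : ℕ} {s : ℝ} (hs : 0 < s) (x : RSp n) :
    x ∈ cube (gridCorner s fun i => ⌊x i / s⌋) s := fun i => by
  have h1 := Int.floor_le (x i / s)
  have h2 := (Int.lt_floor_add_one (x i / s)).le
  rw [le_div_iff₀ hs] at h1
  rw [div_le_iff₀ hs] at h2
  simp only [mem_Icc, gridCorner_apply]
  constructor <;> linarith

lemma tsum_indicator_tripleCube_gridCorner_le {n : ℕ} {s : ℝ} (hs : 0 < s) (x : RSp n) :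
    ∑' m : Fin n → ℤ, (tripleCube (gridCorner s m) s).indicator (fun _ => (1 : ℝ≥0∞)) x ≤
      4 ^ n := by
  let F : Finset (Fin n → ℤ) := Fintype.piFinset fun i => Finset.Icc ⌈x i / s - 2⌉ ⌊x i / s + 1⌋
  have hF : F.card ≤ 4 ^ n := by
    rw [Fintype.card_piFinset]
    calc ∏ i, (Finset.Icc ⌈x i / s - 2⌉ ⌊x i / s + 1⌋).card ≤ ∏ _i : Fin n, 4 := by
          refine Finset.prod_le_prod' fun i _ => ?_
          rw [Int.card_Icc, Int.toNat_le]
          have h1 := Int.floor_le (x i / s + 1)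
          have h2 := Int.le_ceil (x i / s - 2)
          have : (⌊x i / s + 1⌋ : ℝ) + 1 - ⌈x i / s - 2⌉ ≤ 4 := by linarith
          exact_mod_cast this
      _ = 4 ^ n := by simp
  rw [tsum_eq_sum (s := F)]
  · calc ∑ m ∈ F, (tripleCube (gridCorner s m) s).indicator (fun _ => (1 : ℝ≥0∞)) x
        ≤ ∑ _m ∈ F, 1 := Finset.sum_le_sum fun m _ => indicator_le_self' (by simp) x
      _ = (F.card : ℝ≥0∞) := by simp
      _ ≤ 4 ^ n := by exact_mod_cast hF
  · intro m hm
    refine indicator_of_notMem (fun hx => hm ?_) _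
    rw [Fintype.mem_piFinset]
    intro i
    have := hx i
    simp only [mem_Icc, centeredCorner_apply, gridCorner_apply] at this
    rw [Finset.mem_Icc, Int.ceil_le, Int.le_floor]
    have h1 : x i / s ≤ m i + 2 := by rw [div_le_iff₀ hs]; linarith
    have h2 : (m i : ℝ) - 1 ≤ x i / s := by rw [le_div_iff₀ hs]; linarith
    constructor <;> linarith

/-- The data of a Whitney covering of an open set `Ω`: cubes that cover `Ω`, whose triples lie in
`Ω` and overlap boundedly, and whose distance to the complement is comparable to their size. -/
structure IsWhitneyCover {n : ℕ} {ι : Type} (Ω : Set (RSp n)) (a : ι → RSp n) (l : ι → ℝ) :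
    Prop where
  pos : ∀ i, 0 < l i
  cover : Ω ⊆ ⋃ i, cube (a i) (l i)
  triple : ∀ i, tripleCube (a i) (l i) ⊆ Ω
  near : ∀ i, ∃ z, z ∉ Ω ∧ ∀ x ∈ cube (a i) (l i), ‖x - z‖ ≤ 18 * n * l i
  overlap : ∀ x, ∑' i, (tripleCube (a i) (l i)).indicator (fun _ => (1 : ℝ≥0∞)) x ≤ 2 * 4 ^ n

/-- The Whitney cubes are the grid cubes of side `2 ^ k` that meet the layer of points whose
distance to the complement lies in `[8 n 2 ^ k, 16 n 2 ^ k)`. -/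
lemma exists_isWhitneyCover {n : ℕ} (hn : 1 ≤ n) {Ω : Set (RSp n)} (hΩ : IsOpen Ω)
    (hne : Ωᶜ.Nonempty) :
    ∃ (ι : Type) (_ : Countable ι) (a : ι → RSp n) (l : ι → ℝ), IsWhitneyCover Ω a l := by
  have hn0 : (0 : ℝ) < n := by exact_mod_cast hn
  let d : RSp n → ℝ := fun x => Metric.infDist x Ωᶜ
  have hd : ∀ x y, d x ≤ d y + ‖x - y‖ := fun x y => by
    rw [← dist_eq_norm]; exact Metric.infDist_le_infDist_add_dist
  have hdΩ : ∀ x, 0 < d x → x ∈ Ω := fun x hx => by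
    by_contra hcon
    have := Metric.infDist_zero_of_mem (show x ∈ Ωᶜ from hcon)
    exact hx.ne' this
  let P : ℤ × (Fin n → ℤ) → Prop := fun p =>
    ∃ w ∈ cube (gridCorner ((2 : ℝ) ^ p.1) p.2) (2 ^ p.1),
      8 * n * (2 : ℝ) ^ p.1 ≤ d w ∧ d w < 16 * n * (2 : ℝ) ^ p.1
  have htriple : ∀ p, P p → ∀ x ∈ tripleCube (gridCorner ((2 : ℝ) ^ p.1) p.2) (2 ^ p.1),
      5 * n * (2 : ℝ) ^ p.1 ≤ d x ∧ d x < 19 * n * (2 : ℝ) ^ p.1 := by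
    rintro p ⟨w, hw, h1, h2⟩ x hx
    have hs : (0 : ℝ) < 2 ^ p.1 := by positivity
    have hxw := norm_sub_le_of_mem_cube (by positivity) hx (cube_subset_tripleCube hs.le hw)
    have h3 := hd x w
    have h4 := hd w x
    rw [norm_sub_rev] at h4
    constructor <;> linarith
  refine ⟨{p // P p}, inferInstance, fun p => gridCorner ((2 : ℝ) ^ p.1.1) p.1.2,
    fun p => 2 ^ p.1.1, fun p => by positivity, fun x hx => ?_, fun p x hx => ?_, fun p => ?_,
    fun x => ?_⟩
  · have hdx : 0 < d x := by
      have := (hΩ.isClosed_compl.notMem_iff_infDist_pos hne).1 (show x ∉ Ωᶜ from fun h => h hx)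
      exact this
    obtain ⟨k, hk1, hk2⟩ := exists_mem_Ico_zpow (x := d x / (8 * n)) (y := (2 : ℝ))
      (by positivity) (by norm_num)
    have hk1' : 8 * n * (2 : ℝ) ^ k ≤ d x := by
      rw [le_div_iff₀ (by positivity)] at hk1; linarith
    have hk2' : d x < 16 * n * (2 : ℝ) ^ k := by
      rw [div_lt_iff₀ (by positivity), zpow_add_one₀ (by norm_num)] at hk2; linarith
    have hmem := exists_mem_cube_gridCorner (show (0 : ℝ) < 2 ^ k by positivity) x
    exact mem_iUnion.2 ⟨⟨(k, _), x, hmem, hk1', hk2'⟩, hmem⟩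
  · refine hdΩ x (lt_of_lt_of_le (by positivity) (htriple p.1 p.2 x hx).1)
  · obtain ⟨w, hw, h1, h2⟩ := p.2
    have hs : (0 : ℝ) < 2 ^ p.1.1 := by positivity
    obtain ⟨z, hz, hwz⟩ := (Metric.infDist_lt_iff hne).1 h2
    refine ⟨z, hz, fun x hx => ?_⟩
    have h3 := norm_sub_le_of_mem_cube hs.le hx hw
    rw [dist_eq_norm] at hwz
    have h4 := norm_sub_le_norm_sub_add_norm_sub x w z
    nlinarith [mul_pos hn0 hs]
  · let g : ℤ × (Fin n → ℤ) → ℝ≥0∞ := fun p => {p | P p}.indicator (fun p =>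
      (tripleCube (gridCorner ((2 : ℝ) ^ p.1) p.2) (2 ^ p.1)).indicator (fun _ => (1 : ℝ≥0∞)) x) p
    have hg : ∀ p : {p // P p}, (tripleCube (gridCorner ((2 : ℝ) ^ p.1.1) p.1.2)
        (2 ^ p.1.1)).indicator (fun _ => (1 : ℝ≥0∞)) x = g p.1 := fun p => by
      simp only [g]; rw [indicator_of_mem (show p.1 ∈ {p | P p} from p.2)]
    simp only [hg]
    refine (ENNReal.tsum_comp_le_tsum_of_injective Subtype.val_injective g).trans ?_
    refine le_of_eq_of_le (ENNReal.tsum_prod (f := fun k m => g (k, m))) ?_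
    by_cases hdx : 0 < d x
    · obtain ⟨κ, hκ1, hκ2⟩ := exists_mem_Ico_zpow (x := d x / (5 * n)) (y := (2 : ℝ))
        (by positivity) (by norm_num)
      rw [tsum_eq_sum (s := Finset.Icc (κ - 1) κ)]
      · calc ∑ k ∈ Finset.Icc (κ - 1) κ, ∑' m, g (k, m) ≤ ∑ k ∈ Finset.Icc (κ - 1) κ, 4 ^ n := by
              refine Finset.sum_le_sum fun k _ => ?_
              refine le_trans (ENNReal.tsum_le_tsum fun m => ?_)
                (tsum_indicator_tripleCube_gridCorner_le (s := 2 ^ k) (by positivity) x)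
              exact indicator_le_self' (by simp) _
          _ = 2 * 4 ^ n := by simp
      · intro k hk
        rw [ENNReal.tsum_eq_zero]
        intro m
        refine indicator_apply_eq_zero.2 fun hP => indicator_of_notMem (fun hx => hk ?_) _
        obtain ⟨h1, h2⟩ := htriple _ hP x hx
        simp only at h1 h2
        rw [le_div_iff₀ (by positivity)] at hκ1
        rw [div_lt_iff₀ (by positivity)] at hκ2
        have h3 : (2 : ℝ) ^ k < 2 ^ (κ + 1) := by
          by_contra hcon
          have := mul_le_mul_of_nonneg_left (not_lt.1 hcon) hn0.le
          linarith
        have h4 : (2 : ℝ) ^ κ < 2 ^ (k + 2) := by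
          rw [zpow_add₀ (by norm_num)]
          by_contra hcon
          have := mul_le_mul_of_nonneg_left (not_lt.1 hcon) hn0.le
          have h5 : 0 < n * (2 : ℝ) ^ k := by positivity
          norm_num at this
          linarith
        rw [zpow_lt_zpow_iff_right₀ (by norm_num)] at h3 h4
        rw [Finset.mem_Icc]
        omega
    · have : ∀ p, g p = 0 := fun p => by
        refine indicator_apply_eq_zero.2 fun hP => indicator_of_notMem (fun hx => hdx ?_) _
        exact lt_of_lt_of_le (by positivity) (htriple p hP x hx).1
      simp [this]

/-! ### Weak norms -/

lemma weakNorm_le_iff {n : ℕ} {p : ℝ} (hp : 0 < p) {ω : Measure (RSp n)} {F : RSp n → ℝ≥0∞}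
    {B : ℝ≥0∞} :
    weakNorm p ω F ≤ B ↔ ∀ t : ℝ≥0, (t : ℝ≥0∞) ^ p * ω {x | (t : ℝ≥0∞) < F x} ≤ B ^ p := by
  rw [weakNorm, iSup_le_iff]
  refine forall_congr' fun t => ?_
  rw [← ENNReal.rpow_le_rpow_iff hp, ENNReal.mul_rpow_of_nonneg _ _ hp.le, ← ENNReal.rpow_mul,
    one_div_mul_cancel hp.ne', ENNReal.rpow_one]

lemma eLpNorm_ofReal_eq {n : ℕ} {p : ℝ} (hp : 0 < p) (σ : Measure (RSp n)) (f : RSp n → ℂ) :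
    eLpNorm f (ENNReal.ofReal p) σ = (∫⁻ y, ‖f y‖ₑ ^ p ∂σ) ^ (1 / p) := by
  rw [eLpNorm_eq_lintegral_rpow_enorm_toReal (by simpa using hp) ENNReal.ofReal_ne_top,
    ENNReal.toReal_ofReal hp.le]

lemma measure_lt_le_of_rpow_mul_le {α : Type*} [MeasurableSpace α] {p : ℝ} (hp : 0 < p)
    {μ : Measure α} {S : α → ℝ≥0∞} {B : ℝ≥0∞} {t : ℝ≥0} (ht : 0 < t)
    (h : (t : ℝ≥0∞) ^ p * μ {x | (t : ℝ≥0∞) < S x} ≤ B ^ p) :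
    μ {x | (t : ℝ≥0∞) < S x} ≤ (B / t) ^ p := by
  have ht0 : (t : ℝ≥0∞) ≠ 0 := by exact_mod_cast ht.ne'
  rw [ENNReal.div_rpow_of_nonneg _ _ hp.le, ENNReal.le_div_iff_mul_le, mul_comm]
  · exact h
  · left; simp [ht0]
  · left; exact ENNReal.rpow_ne_top_of_nonneg hp.le ENNReal.coe_ne_top

/-- On a set of finite measure a function of weak `L^p` is integrable, with the norm bound of
Kolmogorov's inequality. -/
lemma lintegral_le_of_weak {α : Type*} [MeasurableSpace α] {p : ℝ} (hp : 1 < p) {μ : Measure α}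
    (hμ : μ univ ≠ ∞) {S : α → ℝ≥0∞} (hS : Measurable S) {B : ℝ≥0∞} (hB : B ≠ ∞)
    (h : ∀ t : ℝ≥0, (t : ℝ≥0∞) ^ p * μ {x | (t : ℝ≥0∞) < S x} ≤ B ^ p) :
    ∫⁻ x, S x ∂μ ≤
      (1 + 2 * (1 - (2 : ℝ≥0∞) ^ (1 - p))⁻¹) * B * μ univ ^ (1 / p.conjExponent) := by
  have hp0 : 0 < p := by linarith
  -- Chop at the heights `2 ^ k * A`.
  have key : ∀ A : ℝ≥0, 0 < A → ∫⁻ x, S x ∂μ ≤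
      A * μ univ + ∑' k : ℕ, (2 ^ (k + 1) * A : ℝ≥0) * (B / (2 ^ k * A : ℝ≥0)) ^ p := by
    intro A hA
    have hpt : ∀ x, S x ≤ A + ∑' k : ℕ, {x | ((2 ^ k * A : ℝ≥0) : ℝ≥0∞) < S x}.indicator
        (fun _ => ((2 ^ (k + 1) * A : ℝ≥0) : ℝ≥0∞)) x := by
      intro x
      rcases le_or_gt (S x) A with hx | hx
      · exact hx.trans le_self_add
      refine le_trans ?_ le_add_self
      by_cases hall : ∀ k : ℕ, ((2 ^ k * A : ℝ≥0) : ℝ≥0∞) < S x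
      · have htop : ∑' _k : ℕ, (A : ℝ≥0∞) = ∞ :=
          ENNReal.tsum_const_eq_top_of_ne_zero (by exact_mod_cast hA.ne')
        refine le_top.trans (htop.symm.le.trans (ENNReal.tsum_le_tsum fun k => ?_))
        rw [indicator_of_mem (show x ∈ {x | ((2 ^ k * A : ℝ≥0) : ℝ≥0∞) < S x} from hall k)]
        exact ENNReal.coe_le_coe.2 (le_mul_of_one_le_left zero_le (one_le_pow₀ (by norm_num)))
      · push Not at hall
        classical
        have hfind := Nat.find_spec hall
        obtain ⟨j, hj⟩ : ∃ j, Nat.find hall = j + 1 := Nat.exists_eq_succ_of_ne_zero fun h0 => by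
          rw [h0] at hfind; simp at hfind; exact absurd hx (not_lt.2 hfind)
        have hlt : ((2 ^ j * A : ℝ≥0) : ℝ≥0∞) < S x :=
          not_le.1 (Nat.find_min hall (by omega : j < Nat.find hall))
        rw [hj] at hfind
        refine hfind.trans (le_trans ?_ (ENNReal.le_tsum j))
        rw [indicator_of_mem (show x ∈ {x | ((2 ^ j * A : ℝ≥0) : ℝ≥0∞) < S x} from hlt)]
    have hmeas : ∀ k : ℕ, MeasurableSet {x | ((2 ^ k * A : ℝ≥0) : ℝ≥0∞) < S x} := fun k =>
      measurableSet_lt measurable_const hS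
    refine (lintegral_mono hpt).trans ?_
    rw [lintegral_add_left measurable_const, lintegral_const, lintegral_tsum fun k =>
      (measurable_const.indicator (hmeas k)).aemeasurable]
    gcongr with k
    rw [lintegral_indicator_const (hmeas k)]
    gcongr
    exact measure_lt_le_of_rpow_mul_le hp0 (by positivity) (h _)
  rcases eq_or_ne (μ univ) 0 with hμ0 | hμ0
  · rw [Measure.measure_univ_eq_zero.1 hμ0]; simp
  rcases eq_or_ne B 0 with hB0 | hB0
  · -- Here `S` vanishes almost everywhere, and the height `A` may be taken arbitrarily small.
    subst hB0
    rw [mul_zero, zero_mul, nonpos_iff_eq_zero]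
    have h2 : ∀ A : ℝ≥0, 0 < A → ∫⁻ x, S x ∂μ ≤ A * μ univ := fun A hA => by
      simpa [hp0] using key A hA
    lift μ univ to ℝ≥0 using hμ with m hm
    by_contra hne
    have hne2 : ∫⁻ x, S x ∂μ ≠ ∞ := ne_top_of_le_ne_top (by simp) (h2 1 one_pos)
    lift ∫⁻ x, S x ∂μ to ℝ≥0 using hne2 with I hI
    have hI0 : 0 < I := pos_iff_ne_zero.2 (by exact_mod_cast hne)
    have hm0 : 0 < m := pos_iff_ne_zero.2 (by exact_mod_cast hμ0)
    have h3 := h2 (I / (2 * m)) (by positivity)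
    have h4 : I ≤ I / (2 * m) * m := by exact_mod_cast h3
    have h5 : I / (2 * m) * m = I / 2 := by field_simp
    rw [h5] at h4
    exact absurd h4 (not_le.2 (NNReal.half_lt_self hI0.ne'))
  lift μ univ to ℝ≥0 using hμ with m hm
  lift B to ℝ≥0 using hB with b hb
  have hm0 : 0 < m := pos_iff_ne_zero.2 (by exact_mod_cast hμ0)
  have hb0 : 0 < b := pos_iff_ne_zero.2 (by exact_mod_cast hB0)
  -- The two parts balance at the height `B μ(univ)^{-1/p}`.
  set A : ℝ≥0 := b * m ^ (-(1 / p)) with hA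
  have hA0 : 0 < A := by positivity
  have hterm : ∀ k : ℕ, ((2 ^ (k + 1) * A : ℝ≥0) : ℝ≥0∞) * ((b : ℝ≥0∞) / (2 ^ k * A : ℝ≥0)) ^ p =
      (2 * A * m : ℝ≥0) * ((2 : ℝ≥0∞) ^ (1 - p)) ^ k := by
    intro k
    have h1 : b / (2 ^ k * A) = (2 ^ k)⁻¹ * m ^ (1 / p) := by
      rw [hA, NNReal.rpow_neg]; field_simp
    have h2 : (m ^ (1 / p)) ^ p = m := by
      rw [← NNReal.rpow_mul, one_div_mul_cancel hp0.ne', NNReal.rpow_one]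
    have h3 : ((2 : ℝ≥0) ^ (1 - p)) ^ k = 2 ^ k * ((2 ^ k)⁻¹) ^ p := by
      rw [← NNReal.rpow_natCast, ← NNReal.rpow_mul, NNReal.inv_rpow, ← NNReal.rpow_natCast 2 k,
        ← NNReal.rpow_mul, ← NNReal.rpow_neg, ← NNReal.rpow_add two_ne_zero]
      congr 1; ring
    rw [← ENNReal.coe_div (by positivity), ← ENNReal.coe_rpow_of_nonneg _ hp0.le, h1,
      NNReal.mul_rpow, h2]
    have h4 : ((2 : ℝ≥0∞) ^ (1 - p)) ^ k = ((((2 : ℝ≥0) ^ (1 - p)) ^ k : ℝ≥0) : ℝ≥0∞) := by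
      rw [ENNReal.coe_pow, ENNReal.coe_rpow_of_ne_zero two_ne_zero]; rfl
    rw [h4, h3]
    rw [← ENNReal.coe_mul, ← ENNReal.coe_mul, pow_succ]
    congr 1
    ring
  have hAm : A * m = b * m ^ (1 / p.conjExponent) := by
    rw [hA, mul_assoc]
    congr 1
    nth_rewrite 2 [← NNReal.rpow_one m]
    rw [← NNReal.rpow_add hm0.ne']
    congr 1
    rw [Real.conjExponent]
    have : p - 1 ≠ 0 := by linarith
    field_simp
    ring
  have hq : 0 ≤ 1 / p.conjExponent := by
    have : 0 < p - 1 := by linarith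
    rw [Real.conjExponent]
    positivity
  refine (key A hA0).trans ?_
  rw [tsum_congr hterm, ENNReal.tsum_mul_left, ENNReal.tsum_geometric,
    ← ENNReal.coe_rpow_of_nonneg _ hq,
    mul_assoc (1 + 2 * (1 - (2 : ℝ≥0∞) ^ (1 - p))⁻¹), ← ENNReal.coe_mul b, ← hAm]
  push_cast
  apply le_of_eq
  ring

lemma weak_constant_ne_top {p : ℝ} (hp : 1 < p) :
    1 + 2 * (1 - (2 : ℝ≥0∞) ^ (1 - p))⁻¹ ≠ ∞ := by
  refine ENNReal.add_ne_top.2 ⟨by simp, ENNReal.mul_ne_top (by simp) (ENNReal.inv_ne_top.2 ?_)⟩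
  rw [ne_eq, tsub_eq_zero_iff_le, not_le]
  exact ENNReal.rpow_lt_one_of_one_lt_of_neg (by norm_num) (by linarith)

/-- The weak type inequality implies the testing condition, by Kolmogorov's inequality. -/
lemma WeakTypeBound.cubeTesting {n : ℕ} {p : ℝ} (hp : 1 < p) {σ ω : Measure (RSp n)}
    [IsLocallyFiniteMeasure ω] {S : (RSp n → ℂ) → RSp n → ℝ≥0∞}
    (hS : ∀ f, MemLp f (ENNReal.ofReal p) σ → Measurable (S f)) (h : WeakTypeBound p σ ω S) :
    CubeTesting p σ ω S := by
  obtain ⟨C, hC⟩ := h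
  have hp0 : 0 < p := by linarith
  obtain ⟨c, hc⟩ : ∃ c : ℝ≥0, (c : ℝ≥0∞) = _ := ⟨_, ENNReal.coe_toNNReal (weak_constant_ne_top hp)⟩
  refine ⟨c * C, fun a l _ f hf => ?_⟩
  have hf' : MemLp ((cube a l).indicator f) (ENNReal.ofReal p) σ :=
    hf.indicator (measurableSet_cube a l)
  have h1 := hC _ hf'
  rw [eLpNorm_indicator_eq_eLpNorm_restrict (measurableSet_cube a l), weakNorm_le_iff hp0] at h1
  have h2 := lintegral_le_of_weak hp (μ := ω.restrict (cube a l)) (S := S ((cube a l).indicator f))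
    (B := C * eLpNorm f (ENNReal.ofReal p) (σ.restrict (cube a l)))
    (by rw [Measure.restrict_apply_univ]; exact measure_cube_ne_top ω a l) (hS _ hf')
    (ENNReal.mul_ne_top ENNReal.coe_ne_top (hf.restrict _).2.ne)
    (fun t => le_trans (by gcongr; exact Measure.restrict_le_self) (h1 t))
  rw [Measure.restrict_apply_univ, ← hc] at h2
  refine h2.trans (le_of_eq ?_)
  push_cast
  ring

/-! ### The good-`λ` inequality -/

lemma IsWhitneyCover.tsum_measure_le {n : ℕ} {ι : Type} [Countable ι] {Ω : Set (RSp n)}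
    {a : ι → RSp n} {l : ι → ℝ} (h : IsWhitneyCover Ω a l) (hΩ : MeasurableSet Ω)
    (ν : Measure (RSp n)) : ∑' i, ν (tripleCube (a i) (l i)) ≤ 2 * 4 ^ n * ν Ω := by
  have hm : ∀ i, MeasurableSet (tripleCube (a i) (l i)) := fun i => measurableSet_cube _ _
  calc ∑' i, ν (tripleCube (a i) (l i))
      = ∫⁻ x, ∑' i, (tripleCube (a i) (l i)).indicator (fun _ => (1 : ℝ≥0∞)) x ∂ν := by
        rw [lintegral_tsum fun i => (measurable_const.indicator (hm i)).aemeasurable]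
        simp only [lintegral_indicator_const (hm _), one_mul]
    _ ≤ ∫⁻ x, Ω.indicator (fun _ => 2 * 4 ^ n) x ∂ν := by
        refine lintegral_mono fun x => ?_
        by_cases hx : x ∈ Ω
        · rw [indicator_of_mem hx]; exact h.overlap x
        · rw [indicator_of_notMem hx]
          refine (ENNReal.tsum_eq_zero.2 fun i => indicator_of_notMem (fun hi => hx ?_) _).le
          exact h.triple i hi
    _ = _ := lintegral_indicator_const hΩ _

section
variable {n : ℕ} {A C L p : ℝ} {δ : ℝ → ℝ} {K : RSp n → RSp n → ℂ} {σ ω : Measure (RSp n)}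
  {Φ : Set (RSp n → ℝ)} {f : RSp n → ℂ}

/-- On one Whitney cube: Chebyshev's inequality, the testing condition and Young's inequality. -/
lemma measure_cube_lt_le (hp : 1 < p) (hK : KernelBounds C δ K) (hΦ : IsCutoffClass A L Φ)
    [IsLocallyFiniteMeasure σ] {D : ℝ≥0} {b : RSp n} {s : ℝ}
    (hD : ∫⁻ x in cube b s, maxOp K σ Φ ((cube b s).indicator f) x ∂ω ≤
      D * eLpNorm f (ENNReal.ofReal p) (σ.restrict (cube b s)) *
        ω (cube b s) ^ (1 / p.conjExponent))
    (hf : MemLp f (ENNReal.ofReal p) σ) {t κ : ℝ≥0} (ht : 0 < t) (hκ : 0 < κ) :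
    ω (cube b s ∩ {x | (t : ℝ≥0∞) < maxOp K σ Φ ((cube b s).indicator f) x}) ≤
      ((D / (t * κ) : ℝ≥0) : ℝ≥0∞) ^ p * ∫⁻ y in cube b s, ‖f y‖ₑ ^ p ∂σ +
        (κ : ℝ≥0∞) ^ p.conjExponent * ω (cube b s) := by
  have hp0 : 0 < p := by linarith
  have hconj := Real.HolderConjugate.conjExponent hp
  have hq0 : 0 < p.conjExponent := hconj.symm.pos
  have hloc : LocallyIntegrable f σ := hf.locallyIntegrable (by simpa using hp.le)
  have hmeas : Measurable (maxOp K σ Φ ((cube b s).indicator f)) :=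
    (hK.lowerSemicontinuous_maxOp hΦ (hloc.indicator (measurableSet_cube b s))).measurable
  set X := ω (cube b s ∩ {x | (t : ℝ≥0∞) < maxOp K σ Φ ((cube b s).indicator f) x}) with hX
  set F := ∫⁻ y in cube b s, ‖f y‖ₑ ^ p ∂σ with hF
  have h1 : t * X ≤ D * F ^ (1 / p) * ω (cube b s) ^ (1 / p.conjExponent) := by
    rw [eLpNorm_ofReal_eq hp0] at hD
    refine le_trans ?_ hD
    refine le_trans ?_ (mul_meas_ge_le_lintegral hmeas t)
    gcongr
    rw [hX, inter_comm, ← Measure.restrict_apply' (measurableSet_cube b s)]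
    exact measure_mono fun x (hx : (t : ℝ≥0∞) < _) => hx.le
  have ht0 : (t : ℝ≥0∞) ≠ 0 := by exact_mod_cast ht.ne'
  have h2 : X ≤ (((D / (t * κ) : ℝ≥0) : ℝ≥0∞) * F ^ (1 / p)) *
      (κ * ω (cube b s) ^ (1 / p.conjExponent)) := by
    have h3 : ((D / (t * κ) : ℝ≥0) : ℝ≥0∞) * κ = D / t := by
      rw [← ENNReal.coe_mul, ← ENNReal.coe_div ht.ne']
      congr 1; field_simp
    calc X ≤ D * F ^ (1 / p) * ω (cube b s) ^ (1 / p.conjExponent) / t := by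
          rw [ENNReal.le_div_iff_mul_le (Or.inl ht0) (Or.inl ENNReal.coe_ne_top), mul_comm]
          exact h1
      _ = D / t * (F ^ (1 / p) * ω (cube b s) ^ (1 / p.conjExponent)) := by
          simp only [div_eq_mul_inv]; ring
      _ = _ := by rw [← h3]; ring
  refine h2.trans ((ENNReal.young_inequality _ _ hconj).trans (add_le_add ?_ ?_))
  · refine (ENNReal.div_le_of_le_mul (le_mul_of_one_le_right zero_le ?_)).trans_eq ?_
    · rw [ENNReal.one_le_ofReal]; exact hp.le
    · rw [ENNReal.mul_rpow_of_nonneg _ _ hp0.le, ← ENNReal.rpow_mul, one_div_mul_cancel hp0.ne',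
        ENNReal.rpow_one]
  · refine (ENNReal.div_le_of_le_mul (le_mul_of_one_le_right zero_le ?_)).trans_eq ?_
    · rw [ENNReal.one_le_ofReal]; exact hconj.symm.lt.le
    · rw [ENNReal.mul_rpow_of_nonneg _ _ hq0.le, ← ENNReal.rpow_mul, one_div_mul_cancel hq0.ne',
        ENNReal.rpow_one]

/-- The good-`λ` inequality: on each Whitney cube of `{T f > t}` the maximum principle replaces `f`
by its restriction to the triple of the cube, to which the testing condition applies. The hypothesis
`hmax` is the maximum principle for neighbourhoods containing a ball of `1 / (36 n)` times their
radius, the ratio of the side `l` of a Whitney cube to the radius `36 n l` of a ball which contains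
its triple and for which half the radius reaches the complement. -/
lemma measure_two_mul_lt_le (hn : 1 ≤ n) (hp : 1 < p) (hK : KernelBounds C δ K)
    (hΦ : IsCutoffClass A L Φ) [IsLocallyFiniteMeasure σ] {C₁ D : ℝ≥0}
    (hmax : ∀ (σ : Measure (RSp n)) (f : RSp n → ℂ), LocallyIntegrable f σ →
      ∀ (ρ : ℝ) (x z : RSp n) (E : Set (RSp n)), 0 < ρ → MeasurableSet E →
        Metric.ball x (1 / (36 * n) * ρ) ⊆ E → E ⊆ Metric.closedBall x ρ → ‖x - z‖ ≤ ρ / 2 →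
          maxOp K σ Φ f x ≤ maxOp K σ Φ (E.indicator f) x +
            (maxOp K σ Φ f z + C₁ * maxCube σ f x))
    (hD : ∀ (a : RSp n) (l : ℝ), 0 < l → ∀ f : RSp n → ℂ, MemLp f (ENNReal.ofReal p) σ →
      ∫⁻ x in cube a l, maxOp K σ Φ ((cube a l).indicator f) x ∂ω ≤
        D * eLpNorm f (ENNReal.ofReal p) (σ.restrict (cube a l)) *
          ω (cube a l) ^ (1 / p.conjExponent))
    (hf : MemLp f (ENNReal.ofReal p) σ) {t κ β : ℝ≥0} (ht : 0 < t) (hκ : 0 < κ)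
    (hβ : C₁ * β ≤ 1 / 2) (hne : ∃ z, maxOp K σ Φ f z ≤ t) :
    ω {x | ((2 * t : ℝ≥0) : ℝ≥0∞) < maxOp K σ Φ f x} ≤
      ω {x | ((β * t : ℝ≥0) : ℝ≥0∞) < maxCube σ f x} +
      (((D / (t / 2 * κ) : ℝ≥0) : ℝ≥0∞) ^ p * (2 * 4 ^ n * ∫⁻ y, ‖f y‖ₑ ^ p ∂σ) +
        (κ : ℝ≥0∞) ^ p.conjExponent * (2 * 4 ^ n * ω {x | (t : ℝ≥0∞) < maxOp K σ Φ f x})) := by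
  have hn0 : (0 : ℝ) < n := by exact_mod_cast hn
  have hloc : LocallyIntegrable f σ := hf.locallyIntegrable (by simpa using hp.le)
  set Ω := {x | (t : ℝ≥0∞) < maxOp K σ Φ f x} with hΩdef
  have hΩ : IsOpen Ω := (hK.lowerSemicontinuous_maxOp hΦ hloc).isOpen_preimage t
  obtain ⟨z₀, hz₀⟩ := hne
  obtain ⟨ι, _, a, l, hW⟩ := exists_isWhitneyCover hn hΩ ⟨z₀, fun h => not_lt.2 hz₀ h⟩
  let G : ι → Set (RSp n) := fun i => tripleCube (a i) (l i) ∩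
    {x | ((t / 2 : ℝ≥0) : ℝ≥0∞) < maxOp K σ Φ ((tripleCube (a i) (l i)).indicator f) x}
  have hsub : {x | ((2 * t : ℝ≥0) : ℝ≥0∞) < maxOp K σ Φ f x} ⊆
      {x | ((β * t : ℝ≥0) : ℝ≥0∞) < maxCube σ f x} ∪ ⋃ i, G i := by
    intro x hx
    replace hx : ((2 * t : ℝ≥0) : ℝ≥0∞) < maxOp K σ Φ f x := hx
    rw [mem_union, or_iff_not_imp_left]
    intro hMx
    replace hMx : maxCube σ f x ≤ ((β * t : ℝ≥0) : ℝ≥0∞) := not_lt.1 hMx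
    have hxΩ : x ∈ Ω := by
      refine lt_of_le_of_lt ?_ hx
      exact ENNReal.coe_le_coe.2 (le_mul_of_one_le_left zero_le (by norm_num))
    obtain ⟨i, hi⟩ := mem_iUnion.1 (hW.cover hxΩ)
    have hl := hW.pos i
    obtain ⟨z, hz, hzx⟩ := hW.near i
    refine mem_iUnion.2 ⟨i, cube_subset_tripleCube hl.le hi, ?_⟩
    have hball : Metric.ball x (1 / (36 * n) * (36 * n * l i)) ⊆ tripleCube (a i) (l i) := by
      have : 1 / (36 * n) * (36 * n * l i) = l i := by field_simp
      rw [this]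
      exact ball_subset_tripleCube hi
    have hball2 : tripleCube (a i) (l i) ⊆ Metric.closedBall x (36 * n * l i) := by
      refine (cube_subset_closedBall (by positivity) (cube_subset_tripleCube hl.le hi)).trans
        (Metric.closedBall_subset_closedBall ?_)
      nlinarith [mul_pos hn0 hl]
    have hmp := hmax σ f hloc (36 * n * l i) x z (tripleCube (a i) (l i)) (by positivity)
      (measurableSet_cube _ _) hball hball2 ((hzx x hi).trans (by linarith))
    have hz' : maxOp K σ Φ f z ≤ t := not_lt.1 hz
    change ((t / 2 : ℝ≥0) : ℝ≥0∞) < maxOp K σ Φ ((tripleCube (a i) (l i)).indicator f) x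
    by_contra hcon
    have h1 : maxOp K σ Φ f x ≤ ((2 * t : ℝ≥0) : ℝ≥0∞) := by
      calc maxOp K σ Φ f x
          ≤ ((t / 2 : ℝ≥0) : ℝ≥0∞) + (t + C₁ * ((β * t : ℝ≥0) : ℝ≥0∞)) :=
            hmp.trans (add_le_add (not_lt.1 hcon) (add_le_add hz' (by gcongr)))
        _ = ((t / 2 + (t + C₁ * β * t) : ℝ≥0) : ℝ≥0∞) := by push_cast; ring
        _ ≤ ((2 * t : ℝ≥0) : ℝ≥0∞) := by
            refine ENNReal.coe_le_coe.2 ?_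
            calc t / 2 + (t + C₁ * β * t) ≤ t / 2 + (t + 1 / 2 * t) := by gcongr
              _ = 2 * t := by
                rw [← NNReal.coe_inj]; push_cast; ring
    exact absurd hx (not_lt.2 h1)
  refine (measure_mono hsub).trans ((measure_union_le _ _).trans ?_)
  gcongr
  refine (measure_iUnion_le _).trans ?_
  have hG : ∀ i, ω (G i) ≤ ((D / (t / 2 * κ) : ℝ≥0) : ℝ≥0∞) ^ p *
      (σ.withDensity fun y => ‖f y‖ₑ ^ p) (tripleCube (a i) (l i)) +
        (κ : ℝ≥0∞) ^ p.conjExponent * ω (tripleCube (a i) (l i)) := fun i => by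
    rw [withDensity_apply _
      (show MeasurableSet (tripleCube (a i) (l i)) from measurableSet_cube _ _)]
    exact measure_cube_lt_le hp hK hΦ
      (hD _ _ (by have := hW.pos i; positivity) f hf) hf (by positivity) hκ
  refine (ENNReal.tsum_le_tsum hG).trans ?_
  rw [ENNReal.tsum_add, ENNReal.tsum_mul_left, ENNReal.tsum_mul_left]
  gcongr
  · refine (hW.tsum_measure_le hΩ.measurableSet _).trans ?_
    gcongr
    rw [withDensity_apply _ hΩ.measurableSet]
    exact setLIntegral_le_lintegral _ _
  · exact hW.tsum_measure_le hΩ.measurableSet _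

/-- Iteration of `h(2t) ≤ h(t)/2 + B` for a function that is bounded near `0`. -/
lemma le_two_mul_of_forall_le_half_add {h : ℝ≥0 → ℝ≥0∞} {B : ℝ≥0∞}
    (hstep : ∀ t, 0 < t → h (2 * t) ≤ h t / 2 + B) {t : ℝ≥0} (ht : 0 < t) {G : ℝ≥0∞} (hG : G ≠ ∞)
    (hbd : ∀ s, 0 < s → s ≤ t → h s ≤ G) : h t ≤ 2 * B := by
  have hiter : ∀ m : ℕ, h t ≤ h (t / 2 ^ m) / 2 ^ m + 2 * B := by
    intro m
    have hgen : ∀ m : ℕ, ∀ s, 0 < s → h (2 ^ m * s) ≤ h s / 2 ^ m + 2 * B := by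
      intro m
      induction m with
      | zero => intro s _; simp
      | succ m ih =>
        intro s hs
        rw [pow_succ, mul_comm, mul_comm (2 ^ m) 2, ← mul_assoc, mul_comm s 2, mul_assoc,
          mul_comm s]
        refine (hstep _ (by positivity)).trans ?_
        refine (add_le_add (ENNReal.div_le_div_right (ih s hs) 2) le_rfl).trans (le_of_eq ?_)
        rw [ENNReal.add_div, mul_comm 2 B, ENNReal.mul_div_cancel_right (by simp) (by simp),
          add_assoc, ← mul_two, div_eq_mul_inv, div_eq_mul_inv, div_eq_mul_inv,
          pow_succ (2 : ℝ≥0∞), ENNReal.mul_inv (by simp) (by simp), mul_assoc]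
    have := hgen m (t / 2 ^ m) (by positivity)
    rwa [mul_div_cancel₀ _ (by positivity)] at this
  have hlim : Filter.Tendsto (fun m : ℕ => G * (1 / 2 : ℝ≥0∞) ^ m + 2 * B) Filter.atTop
      (𝓝 (G * 0 + 2 * B)) := by
    refine Filter.Tendsto.add ?_ tendsto_const_nhds
    refine ENNReal.Tendsto.const_mul ?_ (Or.inr hG)
    exact ENNReal.tendsto_pow_atTop_nhds_zero_of_lt_one (by
      rw [one_div]; exact ENNReal.one_half_lt_one)
  rw [mul_zero, zero_add] at hlim
  refine ge_of_tendsto' hlim fun m => (hiter m).trans ?_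
  gcongr
  rw [div_eq_mul_inv, one_div, ENNReal.inv_pow]
  gcongr
  exact hbd _ (by positivity) (div_le_self zero_le (one_le_pow₀ (by norm_num)))

lemma WeakTypeBound.rpow_mul_measure_le (hp : 1 < p) {S : (RSp n → ℂ) → RSp n → ℝ≥0∞} {c : ℝ≥0}
    (h : weakNorm p ω (S f) ≤ c * eLpNorm f (ENNReal.ofReal p) σ) (t : ℝ≥0) :
    (t : ℝ≥0∞) ^ p * ω {x | (t : ℝ≥0∞) < S f x} ≤ (c : ℝ≥0∞) ^ p * ∫⁻ y, ‖f y‖ₑ ^ p ∂σ := by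
  have hp0 : 0 < p := by linarith
  refine ((weakNorm_le_iff hp0).1 h t).trans_eq ?_
  rw [eLpNorm_ofReal_eq hp0, ENNReal.mul_rpow_of_nonneg _ _ hp0.le, ← ENNReal.rpow_mul,
    one_div_mul_cancel hp0.ne', ENNReal.rpow_one]

lemma WeakTypeBound.rpow_mul_measure_scale_le (hp : 1 < p)
    {S : (RSp n → ℂ) → RSp n → ℝ≥0∞} {c : ℝ≥0}
    (h : weakNorm p ω (S f) ≤ c * eLpNorm f (ENNReal.ofReal p) σ) {b : ℝ≥0} (hb : 0 < b)
    (t : ℝ≥0) : (t : ℝ≥0∞) ^ p * ω {x | ((b * t : ℝ≥0) : ℝ≥0∞) < S f x} ≤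
      ((c / b : ℝ≥0) : ℝ≥0∞) ^ p * ∫⁻ y, ‖f y‖ₑ ^ p ∂σ := by
  have hp0 : 0 < p := by linarith
  have h1 := rpow_mul_measure_le hp h (b * t)
  have hb' : (t : ℝ≥0∞) = ((1 / b : ℝ≥0) : ℝ≥0∞) * ((b * t : ℝ≥0) : ℝ≥0∞) := by
    rw [← ENNReal.coe_mul]; congr 1; field_simp
  rw [hb', ENNReal.mul_rpow_of_nonneg _ _ hp0.le, mul_assoc]
  refine (mul_le_mul' le_rfl h1).trans_eq ?_
  rw [← mul_assoc, ← ENNReal.mul_rpow_of_nonneg _ _ hp0.le, ← ENNReal.coe_mul]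
  congr 3; field_simp

/-- A function of compact support has its maximal singular integral controlled by its maximal
function far away from the support. -/
lemma KernelBounds.maxOp_le_maxCube (hK : KernelBounds C δ K) (hΦ : IsCutoffClass A L Φ) {R : ℝ}
    (hR : 0 < R) (hsupp : ∀ y, f y ≠ 0 → ‖y‖ ≤ R) {x : RSp n} (hx : 2 * R ≤ ‖x‖) :
    maxOp K σ Φ f x ≤ ENNReal.ofReal (C * 6 ^ n) * maxCube σ f x := by
  have hx0 : 0 < ‖x‖ := by linarith
  have hC := hK.nonneg
  have h1 : maxOp K σ Φ f x ≤ ENNReal.ofReal (C / (‖x‖ / 2) ^ n) * ∫⁻ y, ‖f y‖ₑ ∂σ :=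
    hK.maxOp_le_of_support hΦ (by positivity) fun y hy => by
      have := hsupp y hy
      have h2 := norm_sub_norm_le x y
      linarith
  have h2 : ∫⁻ y, ‖f y‖ₑ ∂σ ≤ ∫⁻ y in Metric.closedBall x (3 * ‖x‖ / 2), ‖f y‖ₑ ∂σ := by
    rw [← lintegral_indicator Metric.isClosed_closedBall.measurableSet]
    refine lintegral_mono fun y => ?_
    by_cases hy : f y = 0
    · simp [hy]
    · rw [indicator_of_mem]
      rw [Metric.mem_closedBall, dist_eq_norm]
      have := hsupp y hy
      have h2 := norm_sub_le y x
      linarith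
  calc maxOp K σ Φ f x ≤ ENNReal.ofReal (C / (‖x‖ / 2) ^ n) *
        (ENNReal.ofReal ((2 * (3 * ‖x‖ / 2)) ^ n) * maxCube σ f x) := by
        refine h1.trans ?_
        gcongr
        exact h2.trans (setLIntegral_closedBall_le σ f (by positivity)
          (Metric.mem_closedBall_self (by positivity)))
    _ = _ := by
        rw [← mul_assoc, ← ENNReal.ofReal_mul (by positivity)]
        congr 2
        have : 2 * (3 * ‖x‖ / 2) = 6 * (‖x‖ / 2) := by ring
        rw [this, mul_pow]
        field_simp

/-- For integrable `f` of compact support the maximal singular integral decays at infinity, so that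
no level set is the whole space and each has a Whitney covering. -/
lemma KernelBounds.exists_maxOp_le (hn : 1 ≤ n) (hK : KernelBounds C δ K)
    (hΦ : IsCutoffClass A L Φ) {R : ℝ} (hR : 0 < R) (hsupp : ∀ y, f y ≠ 0 → ‖y‖ ≤ R)
    (hint : Integrable f σ) {t : ℝ≥0} (ht : 0 < t) : ∃ z, maxOp K σ Φ f z ≤ t := by
  have hC := hK.nonneg
  obtain ⟨I, hI⟩ : ∃ I : ℝ≥0, (I : ℝ≥0∞) = ∫⁻ y, ‖f y‖ₑ ∂σ :=
    ⟨_, ENNReal.coe_toNNReal hint.2.ne⟩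
  set s : ℝ := 1 + C * I / t with hs
  have hs1 : 1 ≤ s := by rw [hs]; simp; positivity
  refine ⟨EuclideanSpace.single ⟨0, hn⟩ (R + s), ?_⟩
  refine (hK.maxOp_le_of_support hΦ (r := s) (by linarith) fun y hy => ?_).trans ?_
  · have h1 := hsupp y hy
    have h2 := norm_sub_norm_le (EuclideanSpace.single (⟨0, hn⟩ : Fin n) (R + s)) y
    rw [PiLp.norm_single, Real.norm_eq_abs, abs_of_nonneg (by linarith)] at h2
    linarith
  · rw [← hI, ← ENNReal.ofReal_coe_nnreal, ← ENNReal.ofReal_mul (by positivity),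
      ← ENNReal.ofReal_coe_nnreal (p := t)]
    refine ENNReal.ofReal_le_ofReal ?_
    have h3 : s ≤ s ^ n := le_self_pow₀ hs1 (by omega)
    have ht' : (0 : ℝ) < t := ht
    rw [div_mul_eq_mul_div, div_le_iff₀ (by positivity)]
    calc C * I ≤ t * s := by rw [hs, mul_add, mul_div_cancel₀ _ ht'.ne']; linarith
      _ ≤ t * s ^ n := by gcongr

end

section
variable {n : ℕ} {A C L p : ℝ} {δ : ℝ → ℝ} {K : RSp n → RSp n → ℂ} {σ ω : Measure (RSp n)}
  {Φ : Set (RSp n → ℝ)}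

lemma lintegral_rpow_ne_top_of_memLp (hp : 0 < p) {f : RSp n → ℂ}
    (hf : MemLp f (ENNReal.ofReal p) σ) : ∫⁻ y, ‖f y‖ₑ ^ p ∂σ ≠ ∞ := by
  have h := hf.2
  rw [eLpNorm_ofReal_eq hp] at h
  intro htop
  rw [htop, ENNReal.top_rpow_of_pos (by positivity)] at h
  exact lt_irrefl _ h

/-- A maximal truncation is the limit of its values on compactly supported pieces of `f`, since
each truncation only sees a bounded part of `f`. -/
lemma rpow_mul_measure_le_of_forall_indicator
    (hΦ : IsCutoffClass A L Φ) {f : RSp n → ℂ} {B : ℝ≥0∞} {t : ℝ≥0}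
    (h : ∀ m : ℕ, (t : ℝ≥0∞) ^ p *
      ω {x | (t : ℝ≥0∞) < maxOp K σ Φ ((Metric.closedBall 0 (m : ℝ)).indicator f) x} ≤ B) :
    (t : ℝ≥0∞) ^ p * ω {x | (t : ℝ≥0∞) < maxOp K σ Φ f x} ≤ B := by
  let S : ℕ → Set (RSp n) := fun m =>
    {x | (t : ℝ≥0∞) < maxOp K σ Φ ((Metric.closedBall 0 (m : ℝ)).indicator f) x}
  let U : ℕ → Set (RSp n) := fun m => ⋂ k ≥ m, S k
  have hmono : Monotone U := fun m m' hmm' =>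
    biInter_subset_biInter_left fun k (hk : k ≥ m') => hmm'.trans hk
  have hsub : {x | (t : ℝ≥0∞) < maxOp K σ Φ f x} ⊆ ⋃ m, U m := by
    intro x (hx : (t : ℝ≥0∞) < maxOp K σ Φ f x)
    rw [maxOp, lt_iSup_iff] at hx
    obtain ⟨φ, hx⟩ := hx
    rw [lt_iSup_iff] at hx
    obtain ⟨hφ, hx⟩ := hx
    obtain ⟨R, hR, hR0⟩ := (hΦ.isCutoff φ hφ).zero_far
    obtain ⟨m, hm⟩ := exists_nat_ge (‖x‖ + R)
    refine mem_iUnion.2 ⟨m, mem_iInter₂.2 fun k hk => ?_⟩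
    have heq : truncOp K σ φ ((Metric.closedBall 0 (k : ℝ)).indicator f) x =
        truncOp K σ φ f x := by
      unfold truncOp
      congr 1 with y
      by_cases hy : y ∈ Metric.closedBall (0 : RSp n) (k : ℝ)
      · rw [indicator_of_mem hy]
      · rw [IsCutoff.cutKernel_eq_zero (hR0 _ ?_), zero_mul, zero_mul]
        rw [mem_closedBall_zero_iff, not_le] at hy
        have h1 : (m : ℝ) ≤ k := by exact_mod_cast hk
        have h2 := norm_sub_norm_le y x
        rw [norm_sub_rev] at h2
        linarith
    change (t : ℝ≥0∞) < _
    rw [← heq] at hx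
    exact hx.trans_le (enorm_truncOp_le_maxOp K σ hφ _ _)
  calc (t : ℝ≥0∞) ^ p * ω {x | (t : ℝ≥0∞) < maxOp K σ Φ f x}
      ≤ (t : ℝ≥0∞) ^ p * ω (⋃ m, U m) := by gcongr
    _ = ⨆ m, (t : ℝ≥0∞) ^ p * ω (U m) := by rw [hmono.measure_iUnion, ENNReal.mul_iSup]
    _ ≤ B := iSup_le fun m => le_trans (by
        gcongr
        exact biInter_subset_of_mem (show m ≥ m from le_rfl)) (h m)

/-- The testing condition implies the weak type inequality, given the weak type inequality for the
maximal function. The good-`λ` inequality is iterated for `f` of compact support, where the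
comparison with the maximal function far away gives the a priori bound. -/
theorem CubeTesting.weakTypeBound_maxOp (hn : 1 ≤ n) (hp : 1 < p) (hK : KernelBounds C δ K)
    (hΦ : IsCutoffClass A L Φ) [IsLocallyFiniteMeasure σ] [IsLocallyFiniteMeasure ω]
    (hM : WeakTypeBound p σ ω (maxCube σ)) (hD : CubeTesting p σ ω (maxOp K σ Φ)) :
    WeakTypeBound p σ ω (maxOp K σ Φ) := by
  have hn0 : (0 : ℝ) < n := by exact_mod_cast hn
  have hp0 : 0 < p := by linarith
  have hq0 : 0 < p.conjExponent := (Real.HolderConjugate.conjExponent hp).symm.pos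
  have hC := hK.nonneg
  obtain ⟨C₁, hmax⟩ := hK.exists_maximum_principle hΦ (θ := 1 / (36 * n)) (by positivity)
  obtain ⟨D, hD⟩ := hD
  obtain ⟨CM, hM⟩ := hM
  set β : ℝ≥0 := 1 / (2 * (C₁ + 1)) with hβ
  have hβ0 : 0 < β := by positivity
  have hβ1 : C₁ * β ≤ 1 / 2 := by
    rw [hβ, mul_one_div, div_le_div_iff₀ (by positivity) (by positivity)]
    calc C₁ * 2 ≤ (C₁ + 1) * 2 := by gcongr; exact le_self_add
      _ = 1 * (2 * (C₁ + 1)) := by ring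
  -- `κ` is chosen so that the term to be absorbed gets the factor `1 / 2`.
  set κ : ℝ≥0 := (1 / (4 * 4 ^ n * 2 ^ p)) ^ (1 / p.conjExponent) with hκ
  have hκ0 : 0 < κ := by positivity
  have hκ1 : κ ^ p.conjExponent * (2 * 4 ^ n) * 2 ^ p = 1 / 2 := by
    rw [hκ, ← NNReal.rpow_mul, one_div_mul_cancel hq0.ne', NNReal.rpow_one]
    field_simp
    norm_num
  set B : ℝ≥0 := 2 ^ p * ((CM / β) ^ p + (2 * D / κ) ^ p * (2 * 4 ^ n)) with hB
  have hcpt : ∀ f : RSp n → ℂ, MemLp f (ENNReal.ofReal p) σ → ∀ R : ℝ, 0 < R →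
      (∀ y, f y ≠ 0 → ‖y‖ ≤ R) → ∀ t : ℝ≥0, 0 < t →
      (t : ℝ≥0∞) ^ p * ω {x | (t : ℝ≥0∞) < maxOp K σ Φ f x} ≤
        2 * (B * ∫⁻ y, ‖f y‖ₑ ^ p ∂σ) := by
    intro f hf R hR hsupp t ht
    have hN := lintegral_rpow_ne_top_of_memLp hp0 hf
    set N := ∫⁻ y, ‖f y‖ₑ ^ p ∂σ with hNdef
    have hloc : LocallyIntegrable f σ := hf.locallyIntegrable (by simpa using hp.le)
    have hint : Integrable f σ := by
      refine (integrableOn_iff_integrable_of_support_subset ?_).1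
        (LocallyIntegrable.integrableOn_closedBall hloc 0 R)
      intro y hy
      rw [mem_closedBall_zero_iff]
      exact hsupp y hy
    have hMs : ∀ b s : ℝ≥0, 0 < b → (s : ℝ≥0∞) ^ p *
        ω {x | ((b * s : ℝ≥0) : ℝ≥0∞) < maxCube σ f x} ≤ ((CM / b : ℝ≥0) : ℝ≥0∞) ^ p * N :=
      fun b s hb => WeakTypeBound.rpow_mul_measure_scale_le (S := maxCube σ) hp (hM f hf) hb s
    refine le_two_mul_of_forall_le_half_add
      (h := fun t : ℝ≥0 => (t : ℝ≥0∞) ^ p * ω {x | (t : ℝ≥0∞) < maxOp K σ Φ f x})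
      (fun s hs => ?_) ht
      (G := (t : ℝ≥0∞) ^ p * ω (Metric.closedBall 0 (2 * R)) +
        ((CM / (1 / (Real.toNNReal (C * 6 ^ n) + 1)) : ℝ≥0) : ℝ≥0∞) ^ p * N) ?_
      (fun s hs hst => ?_)
    · -- The good-`λ` inequality at height `s`.
      have hgood := measure_two_mul_lt_le hn hp hK hΦ hmax hD hf hs hκ0 hβ1
        (hK.exists_maxOp_le hn hΦ hR hsupp hint hs)
      have h1 : ((2 * s : ℝ≥0) : ℝ≥0∞) ^ p = (2 : ℝ≥0∞) ^ p * (s : ℝ≥0∞) ^ p := by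
        rw [ENNReal.coe_mul, ENNReal.mul_rpow_of_nonneg _ _ hp0.le]; rfl
      have h2 : (s : ℝ≥0∞) ^ p * ((D / (s / 2 * κ) : ℝ≥0) : ℝ≥0∞) ^ p =
          ((2 * D / κ : ℝ≥0) : ℝ≥0∞) ^ p := by
        rw [← ENNReal.mul_rpow_of_nonneg _ _ hp0.le, ← ENNReal.coe_mul]
        congr 2; field_simp
      have h3 : (κ : ℝ≥0∞) ^ p.conjExponent * (2 * 4 ^ n) * 2 ^ p = 1 / 2 := by
        have := congrArg (fun z : ℝ≥0 => (z : ℝ≥0∞)) hκ1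
        simp only [ENNReal.coe_mul, ENNReal.coe_rpow_of_nonneg _ hq0.le,
          ENNReal.coe_rpow_of_nonneg _ hp0.le] at this
        rw [ENNReal.coe_div two_ne_zero] at this
        simpa using this
      have hBN : (B : ℝ≥0∞) * N = 2 ^ p * (((CM / β : ℝ≥0) : ℝ≥0∞) ^ p * N) +
          2 ^ p * (((2 * D / κ : ℝ≥0) : ℝ≥0∞) ^ p * (2 * 4 ^ n * N)) := by
        rw [hB, ENNReal.coe_mul, ENNReal.coe_add, ENNReal.coe_mul,
          ENNReal.coe_rpow_of_nonneg _ hp0.le, ENNReal.coe_rpow_of_nonneg _ hp0.le,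
          ENNReal.coe_rpow_of_nonneg _ hp0.le]
        push_cast
        ring
      set F := ω {x | (s : ℝ≥0∞) < maxOp K σ Φ f x}
      set G' := ω {x | ((β * s : ℝ≥0) : ℝ≥0∞) < maxCube σ f x}
      calc ((2 * s : ℝ≥0) : ℝ≥0∞) ^ p * ω {x | ((2 * s : ℝ≥0) : ℝ≥0∞) < maxOp K σ Φ f x}
          ≤ 2 ^ p * (s : ℝ≥0∞) ^ p * (G' + (((D / (s / 2 * κ) : ℝ≥0) : ℝ≥0∞) ^ p *
              (2 * 4 ^ n * N) + (κ : ℝ≥0∞) ^ p.conjExponent * (2 * 4 ^ n * F))) := by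
            rw [h1]; gcongr
        _ = 2 ^ p * ((s : ℝ≥0∞) ^ p * G') + (2 ^ p * (((s : ℝ≥0∞) ^ p *
              ((D / (s / 2 * κ) : ℝ≥0) : ℝ≥0∞) ^ p) * (2 * 4 ^ n * N)) +
              ((κ : ℝ≥0∞) ^ p.conjExponent * (2 * 4 ^ n) * 2 ^ p) * ((s : ℝ≥0∞) ^ p * F)) := by
            ring
        _ ≤ 2 ^ p * (((CM / β : ℝ≥0) : ℝ≥0∞) ^ p * N) +
              (2 ^ p * (((2 * D / κ : ℝ≥0) : ℝ≥0∞) ^ p * (2 * 4 ^ n * N)) +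
                1 / 2 * ((s : ℝ≥0∞) ^ p * F)) := by
            rw [h2, h3]
            exact add_le_add (mul_le_mul_right (hMs β s hβ0) _) le_rfl
        _ = _ := by
            rw [hBN, ← add_assoc, add_comm, ENNReal.div_eq_inv_mul,
              ENNReal.div_eq_inv_mul, mul_one]
    · refine ENNReal.add_ne_top.2 ⟨ENNReal.mul_ne_top
        (ENNReal.rpow_ne_top_of_nonneg hp0.le ENNReal.coe_ne_top)
        (isCompact_closedBall _ _).measure_lt_top.ne, ENNReal.mul_ne_top
        (ENNReal.rpow_ne_top_of_nonneg hp0.le ENNReal.coe_ne_top) hN⟩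
    · -- The a priori bound at small heights.
      set c : ℝ≥0 := Real.toNNReal (C * 6 ^ n) + 1 with hc
      have hc0 : 0 < c := by positivity
      have hsub : {x | (s : ℝ≥0∞) < maxOp K σ Φ f x} ⊆ Metric.closedBall 0 (2 * R) ∪
          {x | ((1 / c * s : ℝ≥0) : ℝ≥0∞) < maxCube σ f x} := by
        intro x (hx : (s : ℝ≥0∞) < maxOp K σ Φ f x)
        rw [mem_union, or_iff_not_imp_left]
        intro hxR
        rw [mem_closedBall_zero_iff, not_le] at hxR
        have h1 : (s : ℝ≥0∞) < c * maxCube σ f x := by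
          refine (hx.trans_le (hK.maxOp_le_maxCube hΦ hR hsupp hxR.le)).trans_le ?_
          gcongr
          exact ENNReal.coe_le_coe.2 le_self_add
        change ((1 / c * s : ℝ≥0) : ℝ≥0∞) < maxCube σ f x
        have h2 : ((1 / c * s : ℝ≥0) : ℝ≥0∞) = s / c := by
          rw [← ENNReal.coe_div hc0.ne']; congr 1; field_simp
        rw [h2]
        exact ENNReal.div_lt_of_lt_mul' h1
      calc (s : ℝ≥0∞) ^ p * ω {x | (s : ℝ≥0∞) < maxOp K σ Φ f x}
          ≤ (s : ℝ≥0∞) ^ p * (ω (Metric.closedBall 0 (2 * R)) +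
              ω {x | ((1 / c * s : ℝ≥0) : ℝ≥0∞) < maxCube σ f x}) := by
            gcongr
            exact (measure_mono hsub).trans (measure_union_le _ _)
        _ ≤ _ := by
            rw [mul_add]
            refine add_le_add ?_ (hMs (1 / c) s (by positivity))
            gcongr
  refine ⟨(2 * B) ^ (1 / p), fun f hf => ?_⟩
  rw [weakNorm_le_iff hp0]
  intro t
  rcases eq_or_ne t 0 with rfl | ht
  · simp [hp0]
  refine rpow_mul_measure_le_of_forall_indicator hΦ fun m => ?_
  have hf' : MemLp ((Metric.closedBall (0 : RSp n) (m : ℝ)).indicator f) (ENNReal.ofReal p) σ :=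
    hf.indicator Metric.isClosed_closedBall.measurableSet
  refine (hcpt _ hf' (m + 1) (by positivity) (fun y hy => ?_) t (pos_iff_ne_zero.2 ht)).trans ?_
  · by_contra hcon
    refine hy (indicator_of_notMem (fun hmem => hcon ?_) _)
    rw [mem_closedBall_zero_iff] at hmem
    linarith
  · rw [eLpNorm_ofReal_eq hp0, ENNReal.mul_rpow_of_nonneg _ _ hp0.le, ← ENNReal.rpow_mul,
      one_div_mul_cancel hp0.ne', ENNReal.rpow_one, ← ENNReal.coe_rpow_of_nonneg _ hp0.le,
      ← NNReal.rpow_mul, one_div_mul_cancel hp0.ne', NNReal.rpow_one,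
      show ((2 * B : ℝ≥0) : ℝ≥0∞) = 2 * B from ENNReal.coe_mul 2 B, mul_assoc]
    gcongr with y
    exact enorm_indicator_le_enorm_self f y

/-- The weak type inequality for the maximal truncations is equivalent to the testing condition. -/
theorem weakTypeBound_maxOp_iff (hn : 1 ≤ n) (hp : 1 < p) (hK : IsSizeSmoothKernel K)
    (hΦ : IsCutoffClass A L Φ) [IsLocallyFiniteMeasure σ] [IsLocallyFiniteMeasure ω]
    (hM : WeakTypeBound p σ ω (maxCube σ)) :
    WeakTypeBound p σ ω (maxOp K σ Φ) ↔ CubeTesting p σ ω (maxOp K σ Φ) := by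
  obtain ⟨C, δ, hK⟩ := hK.exists_kernelBounds
  refine ⟨fun h => h.cubeTesting hp fun f hf => ?_, fun h => h.weakTypeBound_maxOp hn hp hK hΦ hM⟩
  exact (hK.lowerSemicontinuous_maxOp hΦ
    (hf.locallyIntegrable (by simpa using hp.le))).measurable

end

/-! ### The two families of cutoff functions -/

lemma exists_lipschitz_of_eventually_const {f : ℝ → ℝ}
    (hf : ContDiff ℝ ((⊤ : ℕ∞) : WithTop ℕ∞) f) {a b c d : ℝ} (ha : ∀ t ≤ a, f t = c)
    (hb : ∀ t, b ≤ t → f t = d) : ∃ L : ℝ, 0 ≤ L ∧ ∀ s t, |f s - f t| ≤ L * |s - t| := by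
  have hcont : Continuous (deriv f) := hf.continuous_deriv (by exact_mod_cast le_top)
  obtain ⟨M, hM⟩ := (isCompact_Icc (a := a) (b := b)).exists_bound_of_continuousOn
    hcont.continuousOn
  have hbd : ∀ t, ‖deriv f t‖ ≤ max M 0 := by
    intro t
    by_cases ht : t ∈ Icc a b
    · exact (hM t ht).trans (le_max_left _ _)
    · have h0 : deriv f t = 0 := by
        rw [mem_Icc, not_and_or, not_le, not_le] at ht
        rcases ht with ht | ht
        · have : f =ᶠ[𝓝 t] fun _ => c := by
            filter_upwards [Iio_mem_nhds ht] with s hs using ha s (le_of_lt hs)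
          rw [this.deriv_eq, deriv_const]
        · have : f =ᶠ[𝓝 t] fun _ => d := by
            filter_upwards [Ioi_mem_nhds ht] with s hs using hb s (le_of_lt hs)
          rw [this.deriv_eq, deriv_const]
      simp [h0]
  refine ⟨max M 0, le_max_right _ _, fun s t => ?_⟩
  exact convex_univ.norm_image_sub_le_of_norm_deriv_le
    (fun x _ => (hf.differentiable (by simp)).differentiableAt) (fun x _ => hbd x)
    (mem_univ t) (mem_univ s)

section
variable {ζ η : ℝ → ℝ}

lemma IsCutoffPair.zeta_mem (h : IsCutoffPair ζ η) (t : ℝ) : ζ t ∈ Icc (0 : ℝ) 1 :=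
  ⟨(h.zeta_zero _ (min_le_right t (1 / 2))).symm.le.trans (h.zeta_mono (min_le_left _ _)),
    (h.zeta_mono (le_max_left t 1)).trans (h.zeta_one _ (le_max_right _ _)).le⟩

lemma IsCutoffPair.eta_mem (h : IsCutoffPair ζ η) (t : ℝ) : η t ∈ Icc (0 : ℝ) 1 :=
  ⟨(h.eta_zero _ (le_max_right t 2)).symm.le.trans (h.eta_anti (le_max_left _ _)),
    (h.eta_anti (min_le_left t 1)).trans (h.eta_one _ (min_le_right _ _)).le⟩

lemma half_norm_le_of_norm_sub_le {n : ℕ} {v w : RSp n} (h : ‖v - w‖ ≤ ‖v‖ / 2) :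
    ‖v‖ / 2 ≤ ‖w‖ := by
  have := norm_sub_norm_le v w
  linarith

/-- A Lipschitz profile that is constant on `[2, ∞)`, applied to `‖v‖ / ε`, is Lipschitz at the
scale of its argument. -/
lemma regular_radial {n : ℕ} {g : ℝ → ℝ} {L c ε : ℝ} (hL : 0 ≤ L)
    (hg : ∀ s t, |g s - g t| ≤ L * |s - t|) (hc : ∀ t, 2 ≤ t → g t = c) (hε : 0 < ε) (v w : RSp n)
    (h : ‖v - w‖ ≤ ‖v‖ / 2) :
    |g (‖v‖ / ε) - g (‖w‖ / ε)| * ‖v‖ ≤ 4 * L * ‖v - w‖ := by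
  have hw := half_norm_le_of_norm_sub_le h
  by_cases hv : 4 * ε ≤ ‖v‖
  · rw [hc _ (by rw [le_div_iff₀ hε]; linarith), hc _ (by rw [le_div_iff₀ hε]; linarith)]
    simp only [sub_self, abs_zero, zero_mul]
    positivity
  · have h1 : |‖v‖ / ε - ‖w‖ / ε| ≤ ‖v - w‖ / ε := by
      rw [← sub_div, abs_div, abs_of_pos hε]
      gcongr
      exact abs_norm_sub_norm_le v w
    calc |g (‖v‖ / ε) - g (‖w‖ / ε)| * ‖v‖ ≤ (L * (‖v - w‖ / ε)) * (4 * ε) := by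
          gcongr
          · exact (hg _ _).trans (by gcongr)
          · exact (not_le.1 hv).le
      _ = 4 * L * ‖v - w‖ := by field_simp

lemma regular_mul {n : ℕ} {φ ψ : RSp n → ℝ} {L M : ℝ} {v w : RSp n}
    (hφ : |φ v - φ w| * ‖v‖ ≤ L * ‖v - w‖) (hψ : |ψ v - ψ w| * ‖v‖ ≤ M * ‖v - w‖)
    (hφ1 : |φ w| ≤ 1) (hψ1 : |ψ v| ≤ 1) :
    |φ v * ψ v - φ w * ψ w| * ‖v‖ ≤ (L + M) * ‖v - w‖ := by
  have h1 : φ v * ψ v - φ w * ψ w = (φ v - φ w) * ψ v + φ w * (ψ v - ψ w) := by ring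
  calc |φ v * ψ v - φ w * ψ w| * ‖v‖
      ≤ (|φ v - φ w| * |ψ v| + |φ w| * |ψ v - ψ w|) * ‖v‖ := by
        rw [h1]
        gcongr
        exact (abs_add_le _ _).trans_eq (by rw [abs_mul, abs_mul])
    _ ≤ (|φ v - φ w| * 1 + 1 * |ψ v - ψ w|) * ‖v‖ := by gcongr
    _ = |φ v - φ w| * ‖v‖ + |ψ v - ψ w| * ‖v‖ := by ring
    _ ≤ (L + M) * ‖v - w‖ := by rw [add_mul]; exact add_le_add hφ hψ

/-- The centred cutoff functions. -/
def flatCutoffs (n : ℕ) (ζ η : ℝ → ℝ) : Set (RSp n → ℝ) :=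
  {φ | ∃ ε R : ℝ, (0 < ε ∧ ε < R) ∧ φ = fun v => ζ (‖v‖ / ε) * η (‖v‖ / R)}

/-- The noncentred cutoff functions of controlled eccentricity. -/
def naturalCutoffs (n : ℕ) (ζ η : ℝ → ℝ) : Set (RSp n → ℝ) :=
  {φ | ∃ (ε : Fin n × Fin 2 → ℝ) (R : ℝ),
    ((∀ i, 0 < ε i ∧ ε i < R) ∧ ∀ i j, ε i / ε j ∈ Icc (1 / 4 : ℝ) 4) ∧
      φ = fun v => boxCutoff ζ ε v * η (‖v‖ / R)}

lemma maxFlat_eq_maxOp {n : ℕ} (ζ η : ℝ → ℝ) (K : RSp n → RSp n → ℂ) (σ : Measure (RSp n)) :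
    maxFlat ζ η K σ = maxOp K σ (flatCutoffs n ζ η) := by
  ext f x
  refine le_antisymm ?_ ?_
  · unfold maxFlat
    refine iSup_le fun ε => iSup_le fun R => iSup_le fun h => ?_
    exact enorm_truncOp_le_maxOp K σ (Φ := flatCutoffs n ζ η) ⟨ε, R, h, rfl⟩ f x
  · rw [maxOp]
    refine iSup₂_le fun φ hφ => ?_
    obtain ⟨ε, R, h, rfl⟩ := hφ
    unfold maxFlat
    exact le_iSup_of_le ε (le_iSup_of_le R (le_iSup_of_le h le_rfl))

lemma maxNatural_eq_maxOp {n : ℕ} (ζ η : ℝ → ℝ) (K : RSp n → RSp n → ℂ) (σ : Measure (RSp n)) :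
    maxNatural ζ η K σ = maxOp K σ (naturalCutoffs n ζ η) := by
  ext f x
  refine le_antisymm ?_ ?_
  · unfold maxNatural
    refine iSup_le fun ε => iSup_le fun R => iSup_le fun h => ?_
    exact enorm_truncOp_le_maxOp K σ (Φ := naturalCutoffs n ζ η) ⟨ε, R, h, rfl⟩ f x
  · rw [maxOp]
    refine iSup₂_le fun φ hφ => ?_
    obtain ⟨ε, R, h, rfl⟩ := hφ
    unfold maxNatural
    exact le_iSup_of_le ε (le_iSup_of_le R (le_iSup_of_le h le_rfl))

lemma IsCutoffPair.eta_norm_div_eq_zero {n : ℕ} (h : IsCutoffPair ζ η) {R : ℝ} (hR : 0 < R)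
    {v : RSp n} (hv : 2 * R ≤ ‖v‖) : η (‖v‖ / R) = 0 :=
  h.eta_zero _ (by rwa [le_div_iff₀ hR])

lemma IsCutoffPair.eta_norm_div_eq_one {n : ℕ} (h : IsCutoffPair ζ η) {R : ℝ} (hR : 0 < R)
    {v : RSp n} (hv : ‖v‖ ≤ R) : η (‖v‖ / R) = 1 :=
  h.eta_one _ (by rwa [div_le_one hR])

lemma abs_mul_le_one_of_mem {a b : ℝ} (ha : a ∈ Icc (0 : ℝ) 1) (hb : b ∈ Icc (0 : ℝ) 1) :
    |a * b| ≤ 1 := by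
  rw [abs_of_nonneg (mul_nonneg ha.1 hb.1)]
  exact mul_le_one₀ ha.2 hb.1 hb.2

lemma abs_le_one_of_mem {a : ℝ} (ha : a ∈ Icc (0 : ℝ) 1) : |a| ≤ 1 := by
  rw [abs_of_nonneg ha.1]; exact ha.2

/-- The centred truncations form a cutoff class: the hole is enlarged to the radius `ρ` by replacing
`ε` with `2 ρ`, unless the support of the cutoff already lies within `‖v‖ ≤ 4 ρ`. -/
lemma IsCutoffPair.exists_isCutoffClass_flat (n : ℕ) (h : IsCutoffPair ζ η) :
    ∃ A L, IsCutoffClass A L (flatCutoffs n ζ η) := by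
  obtain ⟨Lζ, hLζ0, hLζ⟩ := exists_lipschitz_of_eventually_const h.smooth_zeta h.zeta_zero
    h.zeta_one
  obtain ⟨Lη, hLη0, hLη⟩ := exists_lipschitz_of_eventually_const h.smooth_eta h.eta_one
    h.eta_zero
  have hz0 : ∀ {ε : ℝ} {v : RSp n}, 0 < ε → 2 * ‖v‖ ≤ ε → ζ (‖v‖ / ε) = 0 := fun hε hv =>
    h.zeta_zero _ (by rw [div_le_iff₀ hε]; linarith)
  have hz1 : ∀ {ε : ℝ} {v : RSp n}, 0 < ε → ε ≤ ‖v‖ → ζ (‖v‖ / ε) = 1 := fun hε hv =>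
    h.zeta_one _ (by rwa [le_div_iff₀ hε, one_mul])
  refine ⟨4, 4 * Lζ + 4 * Lη, by norm_num, by positivity, ?_, ?_, ?_⟩
  · rintro φ ⟨ε, R, ⟨hε, hεR⟩, rfl⟩
    have hR : 0 < R := hε.trans hεR
    have hcζ := h.smooth_zeta.continuous
    have hcη := h.smooth_eta.continuous
    refine ⟨by fun_prop, fun v => abs_mul_le_one_of_mem (h.zeta_mem _) (h.eta_mem _),
      ⟨ε / 2, by positivity, fun v hv => ?_⟩, ⟨2 * R, by positivity, fun v hv => ?_⟩,
      fun v w hvw => ?_⟩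
    · rw [hz0 hε (by linarith), zero_mul]
    · rw [h.eta_norm_div_eq_zero hR hv, mul_zero]
    · exact regular_mul (φ := fun v => ζ (‖v‖ / ε)) (ψ := fun v => η (‖v‖ / R))
        (regular_radial hLζ0 hLζ (fun t ht => h.zeta_one t (by linarith)) hε v w hvw)
        (regular_radial hLη0 hLη h.eta_zero hR v w hvw)
        (abs_le_one_of_mem (h.zeta_mem _)) (abs_le_one_of_mem (h.eta_mem _))
  · rintro φ ⟨ε, R, ⟨hε, hεR⟩, rfl⟩ ρ hρ
    have hR : 0 < R := hε.trans hεR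
    by_cases h1 : 2 * ρ ≤ ε
    · exact Or.inr ⟨_, ⟨ε, R, ⟨hε, hεR⟩, rfl⟩, fun v hv => by
        rw [hz0 hε (by linarith), zero_mul], fun v _ => rfl⟩
    · push Not at h1
      by_cases h2 : 2 * ρ < R
      · refine Or.inr ⟨_, ⟨2 * ρ, R, ⟨by positivity, h2⟩, rfl⟩, fun v hv => ?_, fun v hv => ?_⟩
        · rw [hz0 (by positivity) (by linarith), zero_mul]
        · simp only; rw [hz1 hε (by linarith), hz1 (by positivity) (by linarith)]
      · refine Or.inl fun v hv => ?_
        simp only; rw [h.eta_norm_div_eq_zero hR (by linarith), mul_zero]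
  · intro ρ R hρ
    have hR' : 0 < max R (3 * ρ) := lt_max_of_lt_right (by positivity)
    refine ⟨_, ⟨2 * ρ, max R (3 * ρ), ⟨by positivity, lt_max_of_lt_right (by linarith)⟩, rfl⟩,
      fun v hv => ?_, fun v hv hvR => ?_⟩
    · rw [hz0 (by positivity) (by linarith), zero_mul]
    · rw [hz1 (by positivity) (by linarith),
        h.eta_norm_div_eq_one hR' (hvR.trans (le_max_left _ _)), one_mul]

/-- At most one of the two profiles is nonzero at a given `t`. -/
lemma IsCutoffPair.box_factor_mem (h : IsCutoffPair ζ η) {a b t : ℝ} (ha : 0 < a) (hb : 0 < b) :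
    1 - (ζ (t / a) + ζ (-t / b)) ∈ Icc (0 : ℝ) 1 := by
  have h1 := h.zeta_mem (t / a)
  have h2 := h.zeta_mem (-t / b)
  rcases le_total 0 t with ht | ht
  · have h3 : ζ (-t / b) = 0 := h.zeta_zero _ (by
      have : -t / b ≤ 0 := div_nonpos_of_nonpos_of_nonneg (by linarith) hb.le
      linarith)
    rw [h3, add_zero]
    exact ⟨by linarith [h1.2], by linarith [h1.1]⟩
  · have h3 : ζ (t / a) = 0 := h.zeta_zero _ (by
      have : t / a ≤ 0 := div_nonpos_of_nonpos_of_nonneg ht ha.le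
      linarith)
    rw [h3, zero_add]
    exact ⟨by linarith [h2.2], by linarith [h2.1]⟩

section box
variable {n : ℕ} {ε : Fin n × Fin 2 → ℝ}

lemma IsCutoffPair.boxCutoff_mem (h : IsCutoffPair ζ η) (hε : ∀ i, 0 < ε i) (v : RSp n) :
    boxCutoff ζ ε v ∈ Icc (0 : ℝ) 1 := by
  have h1 : 0 ≤ ∏ k, (1 - (ζ (v k / ε (k, 0)) + ζ (-v k / ε (k, 1)))) :=
    Finset.prod_nonneg fun k _ => (h.box_factor_mem (hε _) (hε _)).1
  have h2 : ∏ k, (1 - (ζ (v k / ε (k, 0)) + ζ (-v k / ε (k, 1)))) ≤ 1 :=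
    Finset.prod_le_one (fun k _ => (h.box_factor_mem (hε _) (hε _)).1)
      fun k _ => (h.box_factor_mem (hε _) (hε _)).2
  rw [boxCutoff]
  constructor <;> linarith

lemma IsCutoffPair.boxCutoff_eq_zero (h : IsCutoffPair ζ η) (hε : ∀ i, 0 < ε i) {v : RSp n}
    (hv : ∀ i, 2 * ‖v‖ ≤ ε i) : boxCutoff ζ ε v = 0 := by
  rw [boxCutoff, Finset.prod_eq_one, sub_self]
  intro k _
  have h1 := abs_le.1 (abs_apply_le_norm v k)
  rw [h.zeta_zero, h.zeta_zero, add_zero, sub_zero]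
  · rw [div_le_iff₀ (hε _)]; linarith [hv (k, 1)]
  · rw [div_le_iff₀ (hε _)]; linarith [hv (k, 0)]

/-- Outside the box one of the factors of the product vanishes. -/
lemma IsCutoffPair.boxCutoff_eq_one (h : IsCutoffPair ζ η) (hε : ∀ i, 0 < ε i) {v : RSp n} {b : ℝ}
    (hb : 0 ≤ b) (hεb : ∀ i, ε i ≤ b) (hv : n * b < ‖v‖) : boxCutoff ζ ε v = 1 := by
  obtain ⟨k, hk⟩ : ∃ k, b < |v k| := by
    by_contra hcon
    push Not at hcon
    exact absurd hv (not_lt.2 (norm_le_of_forall_abs_le hb hcon))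
  rw [boxCutoff, Finset.prod_eq_zero (Finset.mem_univ k), sub_zero]
  have hmem := h.box_factor_mem (t := v k) (hε (k, 0)) (hε (k, 1))
  have h1 := h.zeta_mem (v k / ε (k, 0))
  have h2 := h.zeta_mem (-v k / ε (k, 1))
  rcases lt_abs.1 hk with hk | hk
  · have h3 := h.zeta_one (v k / ε (k, 0)) (by
      rw [le_div_iff₀ (hε _)]; linarith [hεb (k, 0)])
    rw [h3] at hmem ⊢
    linarith [hmem.1, h2.1]
  · have h3 := h.zeta_one (-v k / ε (k, 1)) (by
      rw [le_div_iff₀ (hε _)]; linarith [hεb (k, 1)])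
    rw [h3] at hmem ⊢
    linarith [hmem.1, h1.1]

lemma abs_prod_sub_prod_le {ι : Type*} (s : Finset ι) {a b : ι → ℝ}
    (ha : ∀ i, a i ∈ Icc (0 : ℝ) 1) (hb : ∀ i, b i ∈ Icc (0 : ℝ) 1) :
    |∏ i ∈ s, a i - ∏ i ∈ s, b i| ≤ ∑ i ∈ s, |a i - b i| := by
  classical
  induction s using Finset.induction_on with
  | empty => simp
  | insert i s hi ih =>
    rw [Finset.prod_insert hi, Finset.prod_insert hi, Finset.sum_insert hi]
    have h1 : a i * ∏ j ∈ s, a j - b i * ∏ j ∈ s, b j =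
        (a i - b i) * ∏ j ∈ s, a j + b i * (∏ j ∈ s, a j - ∏ j ∈ s, b j) := by ring
    have h2 : |∏ j ∈ s, a j| ≤ 1 := by
      rw [abs_of_nonneg (Finset.prod_nonneg fun j _ => (ha j).1)]
      exact Finset.prod_le_one (fun j _ => (ha j).1) fun j _ => (ha j).2
    rw [h1]
    refine (abs_add_le _ _).trans ?_
    rw [abs_mul, abs_mul]
    exact add_le_add (mul_le_of_le_one_right (abs_nonneg _) h2)
      ((mul_le_of_le_one_left (abs_nonneg _) (abs_le_one_of_mem (hb i))).trans ih)

/-- A box cutoff whose sides are comparable to `e` is constant for `‖v‖` beyond a multiple of `e`,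
and Lipschitz at the scale `e` below. -/
lemma IsCutoffPair.regular_boxCutoff (h : IsCutoffPair ζ η) {L e : ℝ} (hL : 0 ≤ L)
    (hζ : ∀ s t, |ζ s - ζ t| ≤ L * |s - t|) (he : 0 < e) (hε : ∀ i, e / 4 ≤ ε i ∧ ε i ≤ 4 * e)
    (v w : RSp n) (hvw : ‖v - w‖ ≤ ‖v‖ / 2) :
    |boxCutoff ζ ε v - boxCutoff ζ ε w| * ‖v‖ ≤ 64 * n ^ 2 * L * ‖v - w‖ := by
  have hw := half_norm_le_of_norm_sub_le hvw
  have hε0 : ∀ i, 0 < ε i := fun i => lt_of_lt_of_le (by positivity) (hε i).1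
  by_cases hv : 8 * n * e < ‖v‖
  · have hn0 : (0 : ℝ) ≤ n * e := by positivity
    rw [h.boxCutoff_eq_one hε0 (b := 4 * e) (by positivity) (fun i => (hε i).2) (by nlinarith),
      h.boxCutoff_eq_one hε0 (b := 4 * e) (by positivity) (fun i => (hε i).2) (by nlinarith)]
    simp only [sub_self, abs_zero, zero_mul]
    positivity
  · have hterm : ∀ (i : Fin n × Fin 2) (s t : ℝ), |s - t| ≤ ‖v - w‖ →
        |ζ (s / ε i) - ζ (t / ε i)| ≤ L * (‖v - w‖ * (4 / e)) := by
      intro i s t hst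
      refine (hζ _ _).trans ?_
      rw [← sub_div, abs_div, abs_of_pos (hε0 i), div_eq_mul_inv]
      have h1 : (ε i)⁻¹ ≤ 4 / e := by
        rw [inv_le_comm₀ (hε0 i) (by positivity), inv_div]
        exact (hε i).1
      have h2 := (hε0 i).le
      gcongr
    have h1 : |boxCutoff ζ ε v - boxCutoff ζ ε w| ≤
        ∑ _k : Fin n, 2 * (L * (‖v - w‖ * (4 / e))) := by
      rw [boxCutoff, boxCutoff, abs_sub_comm]
      have h2 : ∀ a b : ℝ, 1 - a - (1 - b) = b - a := fun a b => by ring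
      rw [h2]
      refine (abs_prod_sub_prod_le _ (fun k => h.box_factor_mem (hε0 _) (hε0 _))
        fun k => h.box_factor_mem (hε0 _) (hε0 _)).trans ?_
      gcongr with k
      have hk : |v k - w k| ≤ ‖v - w‖ := abs_apply_le_norm (v - w) k
      have h3 : ∀ a b c d : ℝ, 1 - (a + b) - (1 - (c + d)) = (c - a) + (d - b) :=
        fun a b c d => by ring
      rw [h3, two_mul]
      refine (abs_add_le _ _).trans (add_le_add (hterm _ _ _ ?_) (hterm _ _ _ ?_))
      · rwa [abs_sub_comm]
      · rwa [neg_sub_neg]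
    calc |boxCutoff ζ ε v - boxCutoff ζ ε w| * ‖v‖
        ≤ (∑ _k : Fin n, 2 * (L * (‖v - w‖ * (4 / e)))) * (8 * n * e) := by
          gcongr; exact not_lt.1 hv
      _ = 64 * n ^ 2 * L * ‖v - w‖ := by
          rw [Finset.sum_const, Finset.card_univ, Fintype.card_fin, nsmul_eq_mul]
          field_simp
          ring

end box

/-- The noncentred truncations form a cutoff class: the hole is enlarged by replacing the box with a
symmetric one. Since all `ε i` are comparable, a box with one side below `2 ρ` has all of them below
`8 ρ`, and the cutoff is unchanged for `‖v‖ ≥ (8 n + 1) ρ`. -/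
lemma IsCutoffPair.exists_isCutoffClass_natural {n : ℕ} (hn : 1 ≤ n) (h : IsCutoffPair ζ η) :
    ∃ A L, IsCutoffClass A L (naturalCutoffs n ζ η) := by
  have hn1 : (1 : ℝ) ≤ n := by exact_mod_cast hn
  obtain ⟨Lζ, hLζ0, hLζ⟩ := exists_lipschitz_of_eventually_const h.smooth_zeta h.zeta_zero
    h.zeta_one
  obtain ⟨Lη, hLη0, hLη⟩ := exists_lipschitz_of_eventually_const h.smooth_eta h.eta_one
    h.eta_zero
  let i₀ : Fin n × Fin 2 := (⟨0, hn⟩, 0)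
  have hratio : ∀ ε : Fin n × Fin 2 → ℝ, (∀ i, 0 < ε i) →
      (∀ i j, ε i / ε j ∈ Icc (1 / 4 : ℝ) 4) → ∀ i j, ε j / 4 ≤ ε i ∧ ε i ≤ 4 * ε j := by
    intro ε hε hr i j
    obtain ⟨h1, h2⟩ := hr i j
    rw [le_div_iff₀ (hε j)] at h1
    rw [div_le_iff₀ (hε j)] at h2
    exact ⟨by linarith, h2⟩
  have hconst : ∀ e R : ℝ, 0 < e → e < R → ((∀ _i : Fin n × Fin 2, 0 < e ∧ e < R) ∧
      ∀ _i _j : Fin n × Fin 2, e / e ∈ Icc (1 / 4 : ℝ) 4) := fun e R he heR =>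
    ⟨fun _ => ⟨he, heR⟩, fun _ _ => by rw [div_self he.ne']; norm_num⟩
  refine ⟨8 * n + 1, 64 * n ^ 2 * Lζ + 4 * Lη, by linarith, by positivity, ?_, ?_, ?_⟩
  · rintro φ ⟨ε, R, ⟨hεR, hr⟩, rfl⟩
    have hε : ∀ i, 0 < ε i := fun i => (hεR i).1
    have hR : 0 < R := (hε i₀).trans (hεR i₀).2
    have hcζ := h.smooth_zeta.continuous
    have hcη := h.smooth_eta.continuous
    refine ⟨?_, fun v => abs_mul_le_one_of_mem (h.boxCutoff_mem hε _) (h.eta_mem _),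
      ⟨ε i₀ / 8, by have := hε i₀; positivity, fun v hv => ?_⟩,
      ⟨2 * R, by positivity, fun v hv => ?_⟩, fun v w hvw => ?_⟩
    · unfold boxCutoff
      fun_prop
    · rw [h.boxCutoff_eq_zero hε fun i => by linarith [(hratio ε hε hr i i₀).1], zero_mul]
    · rw [h.eta_norm_div_eq_zero hR hv, mul_zero]
    · exact regular_mul (φ := boxCutoff ζ ε) (ψ := fun v => η (‖v‖ / R))
        (h.regular_boxCutoff hLζ0 hLζ (hε i₀) (fun i => hratio ε hε hr i i₀) v w hvw)
        (regular_radial hLη0 hLη h.eta_zero hR v w hvw)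
        (abs_le_one_of_mem (h.boxCutoff_mem hε _)) (abs_le_one_of_mem (h.eta_mem _))
  · rintro φ ⟨ε, R, ⟨hεR, hr⟩, rfl⟩ ρ hρ
    have hε : ∀ i, 0 < ε i := fun i => (hεR i).1
    have hR : 0 < R := (hε i₀).trans (hεR i₀).2
    by_cases h1 : ∀ i, 2 * ρ ≤ ε i
    · exact Or.inr ⟨_, ⟨ε, R, ⟨hεR, hr⟩, rfl⟩, fun v hv => by
        rw [h.boxCutoff_eq_zero hε fun i => by linarith [h1 i], zero_mul],
        fun v _ => rfl⟩
    · push Not at h1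
      obtain ⟨j, hj⟩ := h1
      have h8 : ∀ i, ε i ≤ 8 * ρ := fun i => by linarith [(hratio ε hε hr i j).2]
      have hnρ : ∀ {v : RSp n}, (8 * n + 1) * ρ ≤ ‖v‖ → n * (8 * ρ) < ‖v‖ := fun hv => by
        nlinarith
      by_cases h2 : 2 * ρ < R
      · refine Or.inr ⟨_, ⟨fun _ => 2 * ρ, R, hconst _ _ (by positivity) h2, rfl⟩,
          fun v hv => ?_, fun v hv => ?_⟩
        · rw [h.boxCutoff_eq_zero (fun _ => by positivity) fun i => by linarith, zero_mul]
        · simp only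
          rw [h.boxCutoff_eq_one hε (by positivity) h8 (hnρ hv),
            h.boxCutoff_eq_one (fun _ => by positivity) (b := 8 * ρ) (by positivity)
              (fun _ => by linarith) (hnρ hv)]
      · refine Or.inl fun v hv => ?_
        simp only
        rw [h.eta_norm_div_eq_zero hR (by nlinarith), mul_zero]
  · intro ρ R hρ
    have hR' : 0 < max R (3 * ρ) := lt_max_of_lt_right (by positivity)
    refine ⟨_, ⟨fun _ => 2 * ρ, max R (3 * ρ),
      hconst _ _ (by positivity) (lt_max_of_lt_right (by linarith)), rfl⟩,
      fun v hv => ?_, fun v hv hvR => ?_⟩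
    · rw [h.boxCutoff_eq_zero (fun _ => by positivity) fun i => by linarith, zero_mul]
    · rw [h.boxCutoff_eq_one (fun _ => by positivity) (b := 8 * ρ) (by positivity)
          (fun _ => by linarith) (by nlinarith),
        h.eta_norm_div_eq_one hR' (hvR.trans (le_max_left _ _)), one_mul]

end

/-! ### The `A_p` condition and the maximal function -/

section
variable {n : ℕ} {p : ℝ} {σ ω : Measure (RSp n)}

lemma one_div_conjExponent (hp : 1 < p) : 1 / p.conjExponent = 1 - 1 / p := by
  rw [Real.conjExponent]
  have : p - 1 ≠ 0 := by linarith
  field_simp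

/-- The powers of the volumes combine to `|Q|`, because `1 / p + 1 / p' = 1`. -/
lemma apCondition_iff (hp : 1 < p) :
    ApCondition p σ ω ↔ ∃ C : ℝ≥0, ∀ (a : RSp n) (l : ℝ), 0 < l →
      ω (cube a l) ^ (1 / p) * σ (cube a l) ^ (1 / p.conjExponent) ≤
        C * ENNReal.ofReal (l ^ n) := by
  have hp0 : 0 < p := by linarith
  have h1 : 0 ≤ 1 / p := by positivity
  have h2 : 0 ≤ 1 / p.conjExponent := by
    rw [one_div_conjExponent hp, sub_nonneg, div_le_one hp0]; exact hp.le
  refine exists_congr fun C => forall_congr' fun a => forall_congr' fun l =>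
    forall_congr' fun hl => ?_
  have hV0 := volume_cube_ne_zero a hl
  have hVt := volume_cube_ne_top a hl
  rw [volume_cube a hl.le] at *
  set V := ENNReal.ofReal (l ^ n)
  have key : (ω (cube a l) / V) ^ (1 / p) * (σ (cube a l) / V) ^ (1 / p.conjExponent) =
      ω (cube a l) ^ (1 / p) * σ (cube a l) ^ (1 / p.conjExponent) / V := by
    rw [ENNReal.div_rpow_of_nonneg _ _ h1, ENNReal.div_rpow_of_nonneg _ _ h2]
    have hV : V = V ^ (1 / p) * V ^ (1 / p.conjExponent) := by
      rw [← ENNReal.rpow_add _ _ hV0 hVt, one_div_conjExponent hp]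
      simp
    nth_rewrite 3 [hV]
    simp only [ENNReal.div_eq_inv_mul]
    rw [ENNReal.mul_inv (Or.inr (ENNReal.rpow_ne_top_of_nonneg h2 hVt))
      (Or.inl (ENNReal.rpow_ne_top_of_nonneg h1 hVt))]
    ring
  rw [key, ENNReal.div_le_iff hV0 hVt]

/-- The concentric dilate by the factor `5` of the cube with lower corner `a` and side `l`. -/
def quintupleCube {n : ℕ} (a : RSp n) (l : ℝ) : Set (RSp n) :=
  cube (centeredCorner a (2 * l)) (5 * l)

lemma cube_subset_quintupleCube {a : RSp n} {l : ℝ} (hl : 0 ≤ l) :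
    cube a l ⊆ quintupleCube a l := fun x hx i => by
  have := hx i
  simp only [mem_Icc, centeredCorner_apply] at this ⊢
  constructor <;> linarith

lemma cube_subset_quintupleCube_of_inter {a b : RSp n} {l m : ℝ}
    (h : (cube a l ∩ cube b m).Nonempty) (hlm : l ≤ 2 * m) : cube a l ⊆ quintupleCube b m := by
  obtain ⟨z, hz1, hz2⟩ := h
  intro x hx i
  have h1 := hz1 i
  have h2 := hz2 i
  have h3 := hx i
  simp only [mem_Icc, centeredCorner_apply] at h1 h2 h3 ⊢
  constructor <;> linarith

lemma interior_cube_nonempty (a : RSp n) {l : ℝ} (hl : 0 < l) : (interior (cube a l)).Nonempty := by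
  refine ⟨centeredCorner a (-(l / 2)), mem_interior.2
    ⟨Metric.ball (centeredCorner a (-(l / 2))) (l / 2), fun x hx i => ?_, Metric.isOpen_ball,
      Metric.mem_ball_self (by positivity)⟩⟩
  rw [Metric.mem_ball, dist_eq_norm] at hx
  have := (abs_apply_le_norm _ i).trans hx.le
  rw [PiLp.sub_apply, abs_le, centeredCorner_apply] at this
  rw [mem_Icc]
  constructor <;> linarith

lemma setLIntegral_le_rpow_mul_rpow (hp : 1 < p) {f : RSp n → ℂ}
    (hf : AEStronglyMeasurable f σ) (E : Set (RSp n)) :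
    ∫⁻ y in E, ‖f y‖ₑ ∂σ ≤ (∫⁻ y in E, ‖f y‖ₑ ^ p ∂σ) ^ (1 / p) *
      σ E ^ (1 / p.conjExponent) := by
  have h := ENNReal.lintegral_mul_le_Lp_mul_Lq (σ.restrict E) (Real.HolderConjugate.conjExponent hp)
    hf.restrict.enorm (aemeasurable_const (b := (1 : ℝ≥0∞)))
  simpa using h

/-- One selected cube: Hölder's inequality on the cube and the `A_p` condition on its dilate. -/
lemma rpow_mul_measure_quintupleCube_le (hp : 1 < p) {C : ℝ≥0}
    (hA : ∀ (a : RSp n) (l : ℝ), 0 < l →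
      ω (cube a l) ^ (1 / p) * σ (cube a l) ^ (1 / p.conjExponent) ≤ C * ENNReal.ofReal (l ^ n))
    {f : RSp n → ℂ} (hf : AEStronglyMeasurable f σ) {a : RSp n} {l : ℝ} (hl : 0 < l) {t : ℝ≥0}
    (ht : t * ENNReal.ofReal (l ^ n) ≤ ∫⁻ y in cube a l, ‖f y‖ₑ ∂σ) :
    (t : ℝ≥0∞) ^ p * ω (quintupleCube a l) ≤
      ((C * 5 ^ n : ℝ≥0) : ℝ≥0∞) ^ p * ∫⁻ y in cube a l, ‖f y‖ₑ ^ p ∂σ := by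
  have hp0 : 0 < p := by linarith
  have h2 : 0 ≤ 1 / p.conjExponent := by
    rw [one_div_conjExponent hp, sub_nonneg, div_le_one hp0]; exact hp.le
  set V := ENNReal.ofReal (l ^ n) with hV
  have hV0 : V ≠ 0 := by rw [hV, ne_eq, ENNReal.ofReal_eq_zero, not_le]; positivity
  have hVt : V ≠ ∞ := ENNReal.ofReal_ne_top
  set F := ∫⁻ y in cube a l, ‖f y‖ₑ ^ p ∂σ
  have h5 : ENNReal.ofReal ((5 * l) ^ n) = ((5 ^ n : ℝ≥0) : ℝ≥0∞) * V := by
    rw [mul_pow, ENNReal.ofReal_mul (by positivity), ENNReal.ofReal_pow (by norm_num)]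
    simp [hV]
  have key : (t : ℝ≥0∞) * ω (quintupleCube a l) ^ (1 / p) ≤
      ((C * 5 ^ n : ℝ≥0) : ℝ≥0∞) * F ^ (1 / p) := by
    rw [← ENNReal.mul_le_mul_iff_left hV0 hVt]
    calc (t : ℝ≥0∞) * ω (quintupleCube a l) ^ (1 / p) * V
        = t * V * ω (quintupleCube a l) ^ (1 / p) := by ring
      _ ≤ (F ^ (1 / p) * σ (quintupleCube a l) ^ (1 / p.conjExponent)) *
            ω (quintupleCube a l) ^ (1 / p) := by
          refine mul_le_mul' (ht.trans ((setLIntegral_le_rpow_mul_rpow hp hf _).trans ?_)) le_rfl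
          gcongr
          exact cube_subset_quintupleCube hl.le
      _ = F ^ (1 / p) * (ω (quintupleCube a l) ^ (1 / p) *
            σ (quintupleCube a l) ^ (1 / p.conjExponent)) := by ring
      _ ≤ F ^ (1 / p) * (C * ENNReal.ofReal ((5 * l) ^ n)) := by
          exact mul_le_mul' le_rfl (hA _ _ (by positivity))
      _ = _ := by rw [h5]; push_cast; ring
  have h3 := ENNReal.rpow_le_rpow key hp0.le
  rwa [ENNReal.mul_rpow_of_nonneg _ _ hp0.le, ENNReal.mul_rpow_of_nonneg _ _ hp0.le,
    ← ENNReal.rpow_mul, ← ENNReal.rpow_mul, one_div_mul_cancel hp0.ne', ENNReal.rpow_one,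
    ENNReal.rpow_one] at h3

/-- The `A_p` condition implies the weak type inequality for the maximal function, by a Vitali
covering of the level set. No doubling of `ω` is needed because the `A_p` condition also holds on
the dilated cubes. -/
theorem ApCondition.weakTypeBound_maxCube (hp : 1 < p) (h : ApCondition p σ ω) :
    WeakTypeBound p σ ω (maxCube σ) := by
  have hp0 : 0 < p := by linarith
  obtain ⟨C, hA⟩ := (apCondition_iff hp).1 h
  refine ⟨C * 5 ^ n, fun f hf => ?_⟩
  rw [weakNorm_le_iff hp0]
  intro t
  rw [eLpNorm_ofReal_eq hp0, ENNReal.mul_rpow_of_nonneg _ _ hp0.le, ← ENNReal.rpow_mul,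
    one_div_mul_cancel hp0.ne', ENNReal.rpow_one]
  -- The level set is exhausted by the unions of its cubes of side at most `N`.
  let T : ℕ → Set (RSp n × ℝ) := fun N =>
    {q | (0 < q.2 ∧ q.2 ≤ N) ∧ t * ENNReal.ofReal (q.2 ^ n) ≤ ∫⁻ y in cube q.1 q.2, ‖f y‖ₑ ∂σ}
  let U : ℕ → Set (RSp n) := fun N => ⋃ q ∈ T N, cube q.1 q.2
  have hU : Monotone U := fun N M hNM => biUnion_subset_biUnion_left fun q hq =>
    ⟨⟨hq.1.1, hq.1.2.trans (by exact_mod_cast hNM)⟩, hq.2⟩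
  have hsub : {x | (t : ℝ≥0∞) < maxCube σ f x} ⊆ ⋃ N, U N := by
    intro x (hx : (t : ℝ≥0∞) < maxCube σ f x)
    unfold maxCube at hx
    simp only [lt_iSup_iff] at hx
    obtain ⟨a, l, ⟨hl, hxa⟩, hx⟩ := hx
    obtain ⟨N, hN⟩ := exists_nat_ge l
    refine mem_iUnion.2 ⟨N, mem_biUnion (x := (a, l)) ⟨⟨hl, hN⟩, ?_⟩ hxa⟩
    rw [ENNReal.lt_div_iff_mul_lt (Or.inl (volume_cube_ne_zero a hl))
      (Or.inl (volume_cube_ne_top a hl)), volume_cube a hl.le] at hx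
    exact hx.le
  have hbound : ∀ N, (t : ℝ≥0∞) ^ p * ω (U N) ≤
      ((C * 5 ^ n : ℝ≥0) : ℝ≥0∞) ^ p * ∫⁻ y, ‖f y‖ₑ ^ p ∂σ := by
    intro N
    obtain ⟨u, huT, hdisj, hcov⟩ := Vitali.exists_disjoint_subfamily_covering_enlargement
      (fun q : RSp n × ℝ => cube q.1 q.2) (T N) (fun q => q.2) 2 (by norm_num)
      (fun q hq => hq.1.1.le) N (fun q hq => hq.1.2)
      (fun q hq => (interior_cube_nonempty q.1 hq.1.1).mono interior_subset)
    have hcount : u.Countable := hdisj.countable_of_nonempty_interior fun q hq =>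
      interior_cube_nonempty q.1 (huT hq).1.1
    have hUsub : U N ⊆ ⋃ q ∈ u, quintupleCube q.1 q.2 := by
      refine iUnion₂_subset fun q hq => ?_
      obtain ⟨b, hb, hqb, hle⟩ := hcov q hq
      exact (cube_subset_quintupleCube_of_inter hqb hle).trans
        (subset_biUnion_of_mem (u := fun q : RSp n × ℝ => quintupleCube q.1 q.2) hb)
    have : Countable u := hcount.to_subtype
    calc (t : ℝ≥0∞) ^ p * ω (U N)
        ≤ (t : ℝ≥0∞) ^ p * ∑' q : u, ω (quintupleCube q.1.1 q.1.2) := by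
          gcongr
          exact (measure_mono hUsub).trans (measure_biUnion_le ω hcount _)
      _ = ∑' q : u, (t : ℝ≥0∞) ^ p * ω (quintupleCube q.1.1 q.1.2) := ENNReal.tsum_mul_left.symm
      _ ≤ ∑' q : u, ((C * 5 ^ n : ℝ≥0) : ℝ≥0∞) ^ p *
            (σ.withDensity fun y => ‖f y‖ₑ ^ p) (cube q.1.1 q.1.2) := by
          refine ENNReal.tsum_le_tsum fun q => ?_
          rw [withDensity_apply _ (measurableSet_cube _ _)]
          exact rpow_mul_measure_quintupleCube_le hp hA hf.1 (huT q.2).1.1 (huT q.2).2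
      _ = ((C * 5 ^ n : ℝ≥0) : ℝ≥0∞) ^ p *
            (σ.withDensity fun y => ‖f y‖ₑ ^ p) (⋃ q ∈ u, cube q.1 q.2) := by
          rw [ENNReal.tsum_mul_left,
            measure_biUnion hcount hdisj fun q _ => measurableSet_cube q.1 q.2]
      _ ≤ _ := by
          gcongr
          refine (measure_mono (subset_univ _)).trans_eq ?_
          rw [withDensity_apply _ MeasurableSet.univ, setLIntegral_univ]
  calc (t : ℝ≥0∞) ^ p * ω {x | (t : ℝ≥0∞) < maxCube σ f x}
      ≤ (t : ℝ≥0∞) ^ p * ω (⋃ N, U N) := by gcongr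
    _ = ⨆ N, (t : ℝ≥0∞) ^ p * ω (U N) := by rw [hU.measure_iUnion, ENNReal.mul_iSup]
    _ ≤ _ := iSup_le hbound

end

/-! ### Untruncated singular integrals -/

lemma ae_tendsto_lintegral_closedBall_div {n : ℕ} {F : RSp n → ℝ≥0∞} (hF : AEMeasurable F)
    (hF' : ∫⁻ y, F y ≠ ∞) :
    ∀ᵐ x : RSp n, Filter.Tendsto (fun r => (∫⁻ y in Metric.closedBall x r, F y) /
      volume (Metric.closedBall x r)) (𝓝[>] 0) (𝓝 (F x)) := by
  filter_upwards [(Besicovitch.vitaliFamily (volume : Measure (RSp n))).ae_tendsto_lintegral_div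
    hF hF'] with x hx
  exact hx.comp (Besicovitch.tendsto_filterAt volume x)

lemma volume_closedBall_eq {n : ℕ} (x : RSp n) {r : ℝ} (hr : 0 ≤ r) :
    volume (Metric.closedBall x r) =
      ENNReal.ofReal (r ^ n) * volume (Metric.closedBall (0 : RSp n) 1) := by
  rw [Measure.addHaar_closedBall' volume x hr, finrank_euclideanSpace_fin]

lemma volume_closedBall_ne_zero {n : ℕ} (x : RSp n) {r : ℝ} (hr : 0 < r) :
    volume (Metric.closedBall x r) ≠ 0 := (Metric.measure_closedBall_pos volume x hr).ne'

lemma volume_closedBall_ne_top {n : ℕ} (x : RSp n) (r : ℝ) :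
    volume (Metric.closedBall x r) ≠ ∞ := (isCompact_closedBall x r).measure_lt_top.ne

/-- Almost everywhere an integrable function is bounded by a multiple of its maximal function. -/
lemma exists_enorm_le_maxCube (n : ℕ) : ∃ c : ℝ≥0, ∀ g : RSp n → ℂ, Integrable g →
    ∀ᵐ x, ‖g x‖ₑ ≤ c * maxCube volume g x := by
  set v := volume (Metric.closedBall (0 : RSp n) 1) with hv
  have hv0 : v ≠ 0 := volume_closedBall_ne_zero 0 one_pos
  have hvt : v ≠ ∞ := volume_closedBall_ne_top 0 1
  obtain ⟨c, hc⟩ : ∃ c : ℝ≥0, (c : ℝ≥0∞) = 2 ^ n / v :=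
    ⟨_, ENNReal.coe_toNNReal (ENNReal.div_ne_top (by simp) hv0)⟩
  refine ⟨c, fun g hg => ?_⟩
  filter_upwards [ae_tendsto_lintegral_closedBall_div hg.1.enorm hg.2.ne] with x hx
  refine le_of_tendsto hx ?_
  filter_upwards [self_mem_nhdsWithin] with r (hr : 0 < r)
  rw [ENNReal.div_le_iff (volume_closedBall_ne_zero x hr) (volume_closedBall_ne_top x r)]
  refine (setLIntegral_closedBall_le volume g hr (Metric.mem_closedBall_self hr.le)).trans_eq ?_
  rw [volume_closedBall_eq x hr.le, hc, mul_pow, ENNReal.ofReal_mul (by positivity),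
    ENNReal.ofReal_pow (by norm_num)]
  rw [show ENNReal.ofReal 2 = 2 by simp]
  calc 2 ^ n * ENNReal.ofReal (r ^ n) * maxCube volume g x
      = (2 ^ n / v * v) * ENNReal.ofReal (r ^ n) * maxCube volume g x := by
        rw [ENNReal.div_mul_cancel hv0 hvt]
    _ = _ := by ring

section
variable {n : ℕ} {A C L p : ℝ} {δ : ℝ → ℝ} {K : RSp n → RSp n → ℂ} {σ ω : Measure (RSp n)}
  {Φ : Set (RSp n → ℝ)}

lemma maxOp_congr_ae {f g : RSp n → ℂ} (h : f =ᵐ[σ] g) : maxOp K σ Φ f = maxOp K σ Φ g := by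
  ext x
  unfold maxOp truncOp
  refine iSup_congr fun φ => iSup_congr fun _ => ?_
  congr 1
  refine integral_congr_ae ?_
  filter_upwards [h] with y hy
  rw [hy]

lemma maxCube_congr_ae {f g : RSp n → ℂ} (h : f =ᵐ[σ] g) : maxCube σ f = maxCube σ g := by
  ext x
  unfold maxCube
  refine iSup_congr fun a => iSup_congr fun l => iSup_congr fun _ => ?_
  congr 1
  refine lintegral_congr_ae (ae_restrict_of_ae ?_)
  filter_upwards [h] with y hy
  rw [hy]

/-- The integral over the complement of a ball around `x`, evaluated at a point `z` of half the
ball, is a truncation at `z`; hence it is bounded by the maximal truncation and the maximal function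
at the centre. -/
lemma KernelBounds.exists_enorm_integral_le (hK : KernelBounds C δ K) (hΦ : IsCutoffClass A L Φ) :
    ∃ C₁ : ℝ≥0, ∀ (σ : Measure (RSp n)) (f : RSp n → ℂ), LocallyIntegrable f σ →
      ∀ R : ℝ, (∀ y, f y ≠ 0 → ‖y‖ ≤ R) → ∀ (x z : RSp n) (r : ℝ), 0 < r →
        z ∈ Metric.closedBall x (r / 2) →
          ‖∫ y, K z y * (Metric.ball x r)ᶜ.indicator f y ∂σ‖ₑ ≤
            maxOp K σ Φ f x + C₁ * maxCube σ f x := by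
  obtain ⟨C₁, hC₁⟩ := hK.exists_truncOp_compl_le hΦ (θ := 1 / 3) (by norm_num)
  have hA := hΦ.one_lt
  refine ⟨C₁, fun σ f hf R hR x z r hr hz => ?_⟩
  obtain ⟨φ, hφ, -, hφ1⟩ := hΦ.exists_one (r / (2 * A)) (‖z‖ + R) (by positivity)
  rw [Metric.mem_closedBall, dist_eq_norm] at hz
  have heq : ∫ y, K z y * (Metric.ball x r)ᶜ.indicator f y ∂σ =
      truncOp K σ φ ((Metric.ball x r)ᶜ.indicator f) z := by
    unfold truncOp
    congr 1 with y
    by_cases hy : y ∈ (Metric.ball x r)ᶜ ∧ f y ≠ 0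
    · have h1 : r ≤ ‖y - x‖ := by simpa [dist_eq_norm] using hy.1
      have h2 := hR y hy.2
      rw [cutKernel, hφ1, Complex.ofReal_one, mul_one]
      · have h3 : A * (r / (2 * A)) = r / 2 := by field_simp
        have h4 := norm_sub_le_norm_sub_add_norm_sub y z x
        rw [h3, norm_sub_rev]
        linarith
      · exact (norm_sub_le _ _).trans (by linarith)
    · have h0 : (Metric.ball x r)ᶜ.indicator f y = 0 := by
        by_cases h1 : y ∈ (Metric.ball x r)ᶜ
        · rw [indicator_of_mem h1]
          by_contra h2
          exact hy ⟨h1, h2⟩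
        · rw [indicator_of_notMem h1]
      rw [h0, mul_zero, mul_zero]
  rw [heq]
  refine hC₁ σ f hf (3 / 2 * r) z x x (Metric.ball x r) (by positivity)
    Metric.isOpen_ball.measurableSet ?_ ?_ (by linarith) ?_ φ hφ
  · refine Metric.ball_subset_ball' ?_
    rw [dist_eq_norm]; linarith
  · refine Metric.ball_subset_closedBall.trans (Metric.closedBall_subset_closedBall' ?_)
    rw [dist_comm, dist_eq_norm]; linarith
  · rw [Metric.mem_closedBall, dist_comm, dist_eq_norm]; linarith

lemma lpEnorm_rpow_eq {q : ℝ≥0∞} [Fact (1 ≤ q)] (hq : q ≠ ∞)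
    (g : Lp ℂ q (volume : Measure (RSp n))) :
    ‖g‖ₑ = (∫⁻ y, ‖g y‖ₑ ^ q.toReal) ^ (1 / q.toReal) := by
  have h1 : (1 : ℝ≥0∞) ≤ q := Fact.out
  rw [Lp.enorm_def, eLpNorm_eq_lintegral_rpow_enorm_toReal (by positivity) hq]

/-- The averages of `|T g|^q` over small balls around `x`: split `g` into the parts inside and
outside the ball of double radius, using boundedness for the first and the maximal truncation for
the second. -/
lemma IsStandardSIO.exists_average_le {q : ℝ≥0∞} [Fact (1 ≤ q)]
    {T : Lp ℂ q (volume : Measure (RSp n)) →L[ℂ] Lp ℂ q (volume : Measure (RSp n))}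
    (hT : IsStandardSIO q K T) (hK : KernelBounds C δ K) (hΦ : IsCutoffClass A L Φ) :
    ∃ C₁ : ℝ≥0, ∀ (g : Lp ℂ q (volume : Measure (RSp n))) (S : Set (RSp n)), IsCompact S →
      (∀ᵐ x, x ∉ S → g x = 0) → ∀ (x : RSp n) (r : ℝ), 0 < r →
      (∫⁻ z in Metric.closedBall x (r / 2), ‖T g z‖ₑ ^ q.toReal) ^ (1 / q.toReal) ≤
        ‖T‖ₑ * (∫⁻ y in Metric.closedBall x r, ‖g y‖ₑ ^ q.toReal) ^ (1 / q.toReal) +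
        (maxOp K volume Φ g x + C₁ * maxCube volume g x) *
          volume (Metric.closedBall x (r / 2)) ^ (1 / q.toReal) := by
  obtain ⟨C₁, hC₁⟩ := hK.exists_enorm_integral_le hΦ
  have hq1 : (1 : ℝ≥0∞) ≤ q := Fact.out
  have hQ : 1 ≤ q.toReal := by
    rw [← ENNReal.toReal_one]; exact ENNReal.toReal_mono hT.ne_top hq1
  have hQ0 : 0 < q.toReal := by linarith
  refine ⟨C₁, fun g S hS hgS x r hr => ?_⟩
  set N := maxOp K volume Φ g x + C₁ * maxCube volume g x with hN
  have hball : MeasurableSet (Metric.ball x r) := Metric.isOpen_ball.measurableSet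
  set g₁ := ((Lp.memLp g).indicator hball).toLp with hg₁
  set g₂ := ((Lp.memLp g).indicator hball.compl).toLp with hg₂
  have hg₁e : g₁ =ᵐ[volume] (Metric.ball x r).indicator g := MemLp.coeFn_toLp _
  have hg₂e : g₂ =ᵐ[volume] (Metric.ball x r)ᶜ.indicator g := MemLp.coeFn_toLp _
  have hsum : g = g₁ + g₂ := by
    refine Lp.ext ?_
    filter_upwards [hg₁e, hg₂e, Lp.coeFn_add g₁ g₂] with y h1 h2 h3
    rw [h3, Pi.add_apply, h1, h2, indicator_self_add_compl_apply]
  -- Outside the ball: the kernel representation of `T` is available on the half ball.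
  have hg₂S : ∀ᵐ y, y ∉ S ∩ (Metric.ball x r)ᶜ → g₂ y = 0 := by
    filter_upwards [hg₂e, hgS] with y h1 h2 h3
    rw [h1]
    by_cases hy : y ∈ (Metric.ball x r)ᶜ
    · rw [indicator_of_mem hy]; exact h2 fun h => h3 ⟨h, hy⟩
    · rw [indicator_of_notMem hy]
  have hrep := hT.rel g₂ (S ∩ (Metric.ball x r)ᶜ)
    (hS.inter_right Metric.isOpen_ball.isClosed_compl) hg₂S
  obtain ⟨R, hR⟩ := hS.isBounded.subset_closedBall 0
  have hgS' : g =ᵐ[volume] S.indicator g := by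
    filter_upwards [hgS] with y hy
    by_cases h : y ∈ S
    · rw [indicator_of_mem h]
    · rw [indicator_of_notMem h, hy h]
  have hloc : LocallyIntegrable (S.indicator g) (volume : Measure (RSp n)) :=
    ((Lp.memLp g).locallyIntegrable hq1).indicator hS.isClosed.measurableSet
  have hpt : ∀ᵐ z ∂volume.restrict (Metric.closedBall x (r / 2)),
      ‖T g z‖ₑ ≤ ‖T g₁ z‖ₑ + N := by
    have hadd : T g =ᵐ[volume] T g₁ + T g₂ := by
      rw [hsum, map_add]; exact Lp.coeFn_add _ _
    filter_upwards [ae_restrict_of_ae hadd, ae_restrict_of_ae hrep,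
      ae_restrict_mem Metric.isClosed_closedBall.measurableSet] with z h1 h2 hz
    have hz' : z ∉ S ∩ (Metric.ball x r)ᶜ := fun h =>
      h.2 (Metric.closedBall_subset_ball (by linarith) hz)
    rw [h1, Pi.add_apply, h2 hz']
    refine (enorm_add_le _ _).trans ?_
    gcongr
    have h3 : ∫ y, K z y * g₂ y = ∫ y, K z y * (Metric.ball x r)ᶜ.indicator (S.indicator g) y := by
      refine integral_congr_ae ?_
      filter_upwards [hg₂e, hgS'] with y h4 h5
      rw [h4]
      by_cases hy : y ∈ (Metric.ball x r)ᶜ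
      · rw [indicator_of_mem hy, indicator_of_mem hy, h5]
      · rw [indicator_of_notMem hy, indicator_of_notMem hy]
    rw [h3]
    refine (hC₁ volume (S.indicator g) hloc R (fun y hy => ?_) x z r hr hz).trans_eq ?_
    · have : y ∈ S := by
        by_contra h
        exact hy (indicator_of_notMem h _)
      simpa using hR this
    · rw [maxOp_congr_ae hgS'.symm, maxCube_congr_ae hgS'.symm]
  have hmeas : AEMeasurable (fun z => ‖T g₁ z‖ₑ) (volume.restrict (Metric.closedBall x (r / 2))) :=
    (Lp.aestronglyMeasurable (T g₁)).restrict.enorm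
  calc (∫⁻ z in Metric.closedBall x (r / 2), ‖T g z‖ₑ ^ q.toReal) ^ (1 / q.toReal)
      ≤ (∫⁻ z in Metric.closedBall x (r / 2),
          ((fun z => ‖T g₁ z‖ₑ) + (fun _ => N) : RSp n → ℝ≥0∞) z ^ q.toReal) ^ (1 / q.toReal) := by
        gcongr ?_ ^ _
        refine lintegral_mono_ae ?_
        filter_upwards [hpt] with z hz
        exact ENNReal.rpow_le_rpow hz hQ0.le
    _ ≤ (∫⁻ z in Metric.closedBall x (r / 2), ‖T g₁ z‖ₑ ^ q.toReal) ^ (1 / q.toReal) +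
          (∫⁻ _z in Metric.closedBall x (r / 2), N ^ q.toReal) ^ (1 / q.toReal) :=
        ENNReal.lintegral_Lp_add_le hmeas aemeasurable_const hQ
    _ ≤ _ := by
        refine add_le_add ?_ (le_of_eq ?_)
        · calc (∫⁻ z in Metric.closedBall x (r / 2), ‖T g₁ z‖ₑ ^ q.toReal) ^ (1 / q.toReal)
              ≤ (∫⁻ z, ‖T g₁ z‖ₑ ^ q.toReal) ^ (1 / q.toReal) := by
                gcongr; exact Measure.restrict_le_self
            _ = ‖T g₁‖ₑ := (lpEnorm_rpow_eq hT.ne_top _).symm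
            _ ≤ ‖T‖ₑ * ‖g₁‖ₑ := by
                simp only [← ofReal_norm]
                rw [← ENNReal.ofReal_mul (norm_nonneg _)]
                exact ENNReal.ofReal_le_ofReal (T.le_opNorm g₁)
            _ ≤ _ := by
                gcongr
                rw [lpEnorm_rpow_eq hT.ne_top]
                gcongr ?_ ^ _
                rw [← lintegral_indicator Metric.isClosed_closedBall.measurableSet]
                refine lintegral_mono_ae ?_
                filter_upwards [hg₁e] with y hy
                rw [hy]
                by_cases hyb : y ∈ Metric.ball x r
                · rw [indicator_of_mem hyb, indicator_of_mem (Metric.ball_subset_closedBall hyb)]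
                · rw [indicator_of_notMem hyb]; simp [hQ0]
        · rw [setLIntegral_const, ENNReal.mul_rpow_of_nonneg _ _ (by positivity),
            ← ENNReal.rpow_mul, mul_one_div_cancel hQ0.ne', ENNReal.rpow_one]

lemma mul_eq_mul_div_mul_mul (a x : ℝ≥0∞) {y v : ℝ≥0∞} (hy : y ≠ 0) (hy' : y ≠ ∞) (hv : v ≠ 0)
    (hv' : v ≠ ∞) : a * x = a * y * (x / (y * v)) * v := by
  calc a * x = a * (x / (y * v) * (y * v)) := by
        rw [ENNReal.div_mul_cancel (mul_ne_zero hy hv) (ENNReal.mul_ne_top hy' hv')]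
    _ = a * y * (x / (y * v)) * v := by ring

/-- Almost everywhere `|T g|` is bounded by the maximal truncation and the maximal function, as the
limit of its averages over shrinking balls. -/
lemma IsStandardSIO.exists_enorm_le {q : ℝ≥0∞} [Fact (1 ≤ q)]
    {T : Lp ℂ q (volume : Measure (RSp n)) →L[ℂ] Lp ℂ q (volume : Measure (RSp n))}
    (hT : IsStandardSIO q K T) (hK : KernelBounds C δ K) (hΦ : IsCutoffClass A L Φ) :
    ∃ C₂ : ℝ≥0, ∀ (g : Lp ℂ q (volume : Measure (RSp n))) (S : Set (RSp n)), IsCompact S →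
      (∀ᵐ x, x ∉ S → g x = 0) →
        ∀ᵐ x, ‖T g x‖ₑ ≤ maxOp K volume Φ g x + C₂ * maxCube volume g x := by
  obtain ⟨C₁, hC₁⟩ := hT.exists_average_le hK hΦ
  obtain ⟨c, hc⟩ := exists_enorm_le_maxCube n
  have hq1 : (1 : ℝ≥0∞) ≤ q := Fact.out
  have hQ : 1 ≤ q.toReal := by
    rw [← ENNReal.toReal_one]; exact ENNReal.toReal_mono hT.ne_top hq1
  have hQ0 : 0 < q.toReal := by linarith
  have hQ1 : 0 ≤ 1 / q.toReal := by positivity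
  have hLp : ∀ h : Lp ℂ q (volume : Measure (RSp n)), ∫⁻ y, ‖h y‖ₑ ^ q.toReal ≠ ∞ := by
    intro h htop
    have h1 := lpEnorm_rpow_eq hT.ne_top h
    rw [htop, ENNReal.top_rpow_of_pos (by positivity)] at h1
    exact enorm_ne_top h1
  refine ⟨‖T‖₊ * (2 ^ n) ^ (1 / q.toReal) * c + C₁, fun g S hS hgS => ?_⟩
  have hint : Integrable g (volume : Measure (RSp n)) := by
    have h1 : IntegrableOn g S (volume : Measure (RSp n)) :=
      ((Lp.memLp g).locallyIntegrable hq1).integrableOn_isCompact hS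
    refine (h1.integrable_indicator hS.isClosed.measurableSet).congr ?_
    filter_upwards [hgS] with y hy
    by_cases h : y ∈ S
    · rw [indicator_of_mem h]
    · rw [indicator_of_notMem h, hy h]
  filter_upwards [hc g hint,
    ae_tendsto_lintegral_closedBall_div ((Lp.aestronglyMeasurable (T g)).enorm.pow_const _)
      (hLp (T g)),
    ae_tendsto_lintegral_closedBall_div ((Lp.aestronglyMeasurable g).enorm.pow_const _)
      (hLp g)] with x h1 h2 h3
  obtain ⟨N, hN⟩ : ∃ N, N = maxOp K volume Φ g x + C₁ * maxCube volume g x := ⟨_, rfl⟩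
  have hhalf : Filter.Tendsto (fun r : ℝ => r / 2) (𝓝[>] 0) (𝓝[>] 0) := by
    refine tendsto_nhdsWithin_iff.2 ⟨?_, ?_⟩
    · have : Filter.Tendsto (fun r : ℝ => r / 2) (𝓝 0) (𝓝 (0 / 2)) := by
        exact (continuous_id.div_const 2).tendsto 0
      rw [zero_div] at this
      exact this.mono_left nhdsWithin_le_nhds
    · filter_upwards [self_mem_nhdsWithin] with r (hr : 0 < r)
      exact half_pos hr
  have h4 := ((ENNReal.continuous_rpow_const (y := 1 / q.toReal)).tendsto _).comp (h2.comp hhalf)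
  have h5 := ((ENNReal.continuous_rpow_const (y := 1 / q.toReal)).tendsto _).comp h3
  rw [← ENNReal.rpow_mul, mul_one_div_cancel hQ0.ne', ENNReal.rpow_one] at h4 h5
  have h6 := (ENNReal.Tendsto.const_mul (a := ‖T‖ₑ * (2 ^ n) ^ (1 / q.toReal)) h5 (Or.inr
    (ENNReal.mul_ne_top enorm_ne_top (ENNReal.rpow_ne_top_of_nonneg hQ1 (by simp))))).add
    (tendsto_const_nhds (x := N))
  have hle : ‖T g x‖ₑ ≤ ‖T‖ₑ * (2 ^ n) ^ (1 / q.toReal) * ‖g x‖ₑ + N := by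
    refine le_of_tendsto_of_tendsto h4 h6 ?_
    filter_upwards [self_mem_nhdsWithin] with r (hr : 0 < r)
    have hr2 : 0 < r / 2 := by positivity
    simp only [Function.comp]
    set v := volume (Metric.closedBall x (r / 2)) with hv
    have hv0 : v ≠ 0 := volume_closedBall_ne_zero x hr2
    have hvt : v ≠ ∞ := volume_closedBall_ne_top x _
    have hv2 : volume (Metric.closedBall x r) = 2 ^ n * v := by
      rw [hv, volume_closedBall_eq x hr.le, volume_closedBall_eq x hr2.le, ← mul_assoc]
      congr 1
      rw [show (2 : ℝ≥0∞) = ENNReal.ofReal 2 by simp, ← ENNReal.ofReal_pow (by norm_num),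
        ← ENNReal.ofReal_mul (by positivity), ← mul_pow]
      congr 2
      ring
    have hvq0 : v ^ (1 / q.toReal) ≠ 0 := by
      rw [ne_eq, ENNReal.rpow_eq_zero_iff]
      push Not
      exact ⟨fun h => absurd h hv0, fun h => absurd h hvt⟩
    have hvqt : v ^ (1 / q.toReal) ≠ ∞ := ENNReal.rpow_ne_top_of_nonneg hQ1 hvt
    rw [ENNReal.div_rpow_of_nonneg _ _ hQ1, ENNReal.div_le_iff hvq0 hvqt]
    have h7 : (∫⁻ z in Metric.closedBall x (r / 2), ‖T g z‖ₑ ^ q.toReal) ^ (1 / q.toReal) ≤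
        ‖T‖ₑ * (∫⁻ y in Metric.closedBall x r, ‖g y‖ₑ ^ q.toReal) ^ (1 / q.toReal) +
          N * v ^ (1 / q.toReal) := hN ▸ hC₁ g S hS hgS x r hr
    refine h7.trans_eq ?_
    rw [hv2, ENNReal.div_rpow_of_nonneg _ _ hQ1, ENNReal.mul_rpow_of_nonneg _ _ hQ1, add_mul]
    congr 1
    refine mul_eq_mul_div_mul_mul (y := ((2 : ℝ≥0∞) ^ n) ^ (1 / q.toReal)) _ _ ?_
      (ENNReal.rpow_ne_top_of_nonneg hQ1 (by simp)) hvq0 hvqt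
    rw [ne_eq, ENNReal.rpow_eq_zero_iff]
    push Not
    exact ⟨fun h => absurd h (by simp), fun h => absurd h (by simp)⟩
  calc ‖T g x‖ₑ ≤ ‖T‖ₑ * (2 ^ n) ^ (1 / q.toReal) * (c * maxCube volume g x) + N := by
        refine hle.trans ?_
        gcongr
    _ = _ := by
        rw [hN]
        push_cast
        rw [ENNReal.coe_rpow_of_nonneg _ hQ1, ← enorm_eq_nnnorm]
        push_cast
        ring

end

section
variable {n : ℕ} {A C L p : ℝ} {δ : ℝ → ℝ} {K : RSp n → RSp n → ℂ} {σ ω : Measure (RSp n)}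
  {Φ : Set (RSp n → ℝ)}

lemma maxOp_eq_of_density [IsLocallyFiniteMeasure σ] (hσ : σ ≪ volume) {f g : RSp n → ℂ}
    (hg : g =ᵐ[volume] fun x => f x * (((σ.rnDeriv volume x).toReal : ℝ) : ℂ)) :
    maxOp K volume Φ g = maxOp K σ Φ f := by
  ext x
  unfold maxOp truncOp
  refine iSup_congr fun φ => iSup_congr fun _ => ?_
  congr 1
  rw [← integral_rnDeriv_smul hσ]
  refine integral_congr_ae ?_
  filter_upwards [hg] with y hy
  rw [hy, Complex.real_smul]
  ring

lemma maxCube_eq_of_density [IsLocallyFiniteMeasure σ] (hσ : σ ≪ volume) {f g : RSp n → ℂ}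
    (hf : AEStronglyMeasurable f σ)
    (hg : g =ᵐ[volume] fun x => f x * (((σ.rnDeriv volume x).toReal : ℝ) : ℂ)) :
    maxCube volume g = maxCube σ f := by
  ext x
  unfold maxCube
  refine iSup_congr fun a => iSup_congr fun l => iSup_congr fun _ => ?_
  congr 1
  have hw : AEMeasurable (σ.rnDeriv volume) (volume.restrict (cube a l)) :=
    (Measure.measurable_rnDeriv σ volume).aemeasurable
  have hres : σ.restrict (cube a l) =
      (volume.restrict (cube a l)).withDensity (σ.rnDeriv volume) := by
    rw [← restrict_withDensity (measurableSet_cube a l), Measure.withDensity_rnDeriv_eq _ _ hσ]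
  have hf' : AEMeasurable (fun y => ‖f y‖ₑ)
      ((volume.restrict (cube a l)).withDensity (σ.rnDeriv volume)) := by
    rw [← hres]; exact hf.restrict.enorm
  rw [hres, lintegral_withDensity_eq_lintegral_mul₀' hw hf']
  refine lintegral_congr_ae (ae_restrict_of_ae ?_)
  filter_upwards [hg, Measure.rnDeriv_lt_top σ volume] with y hy hlt
  rw [hy, Pi.mul_apply, enorm_mul, mul_comm, ← ofReal_norm (((σ.rnDeriv volume y).toReal : ℝ) : ℂ),
    Complex.norm_real, Real.norm_eq_abs, abs_of_nonneg ENNReal.toReal_nonneg,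
    ENNReal.ofReal_toReal hlt.ne]

/-- The weak type inequality passes from the maximal truncations to the operator itself. -/
theorem IsStandardSIO.weakTypeBoundSIO (hp : 1 < p) {q : ℝ≥0∞} [Fact (1 ≤ q)]
    {T : Lp ℂ q (volume : Measure (RSp n)) →L[ℂ] Lp ℂ q (volume : Measure (RSp n))}
    (hT : IsStandardSIO q K T) (hΦ : IsCutoffClass A L Φ) [IsLocallyFiniteMeasure σ]
    (hσ : σ ≪ volume) (hω : ω ≪ volume) (hM : WeakTypeBound p σ ω (maxCube σ))
    (hW : WeakTypeBound p σ ω (maxOp K σ Φ)) : WeakTypeBoundSIO p σ ω q T := by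
  have hp0 : 0 < p := by linarith
  obtain ⟨C, δ, hK⟩ := hT.kernel.toIsSizeSmoothKernel.exists_kernelBounds
  obtain ⟨C₂, hC₂⟩ := hT.exists_enorm_le hK hΦ
  obtain ⟨CM, hM⟩ := hM
  obtain ⟨CW, hW⟩ := hW
  -- With these weights `t / 2 + C₂ b t ≤ t`: one of the two operators is large where `T g` is.
  set b : ℝ≥0 := 1 / (2 * (C₂ + 1)) with hb
  have hb0 : 0 < b := by positivity
  refine ⟨((CW / (1 / 2)) ^ p + (CM / b) ^ p) ^ (1 / p), fun f g hf hgf _ ⟨S, hS, hgS⟩ => ?_⟩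
  have hle := hC₂ g S hS hgS
  rw [maxOp_eq_of_density hσ hgf, maxCube_eq_of_density hσ hf.1 hgf] at hle
  rw [weakNorm_le_iff hp0]
  intro t
  have hsub : ∀ᵐ x ∂ω, x ∈ {x | (t : ℝ≥0∞) < ‖T g x‖ₑ} →
      x ∈ {x | ((1 / 2 * t : ℝ≥0) : ℝ≥0∞) < maxOp K σ Φ f x} ∪
        {x | ((b * t : ℝ≥0) : ℝ≥0∞) < maxCube σ f x} := by
    filter_upwards [hω.ae_le hle] with x hx (hxt : (t : ℝ≥0∞) < ‖T g x‖ₑ)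
    by_contra hcon
    rw [mem_union, not_or] at hcon
    have h1 : maxOp K σ Φ f x ≤ ((1 / 2 * t : ℝ≥0) : ℝ≥0∞) := not_lt.1 hcon.1
    have h2 : maxCube σ f x ≤ ((b * t : ℝ≥0) : ℝ≥0∞) := not_lt.1 hcon.2
    have h3 : ‖T g x‖ₑ ≤ t := by
      calc ‖T g x‖ₑ ≤ ((1 / 2 * t : ℝ≥0) : ℝ≥0∞) + C₂ * ((b * t : ℝ≥0) : ℝ≥0∞) :=
            hx.trans (add_le_add h1 (by gcongr))
        _ = ((1 / 2 * t + C₂ * b * t : ℝ≥0) : ℝ≥0∞) := by push_cast; ring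
        _ ≤ t := by
            refine ENNReal.coe_le_coe.2 ?_
            have h4 : C₂ * b ≤ 1 / 2 := by
              rw [hb, mul_one_div, div_le_div_iff₀ (by positivity) (by positivity)]
              calc C₂ * 2 ≤ (C₂ + 1) * 2 := by gcongr; exact le_self_add
                _ = 1 * (2 * (C₂ + 1)) := by ring
            calc 1 / 2 * t + C₂ * b * t ≤ 1 / 2 * t + 1 / 2 * t := by gcongr
              _ = t := by rw [← NNReal.coe_inj]; push_cast; ring
    exact absurd hxt (not_lt.2 h3)
  calc (t : ℝ≥0∞) ^ p * ω {x | (t : ℝ≥0∞) < ‖T g x‖ₑ}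
      ≤ (t : ℝ≥0∞) ^ p * (ω {x | ((1 / 2 * t : ℝ≥0) : ℝ≥0∞) < maxOp K σ Φ f x} +
          ω {x | ((b * t : ℝ≥0) : ℝ≥0∞) < maxCube σ f x}) := by
        gcongr
        exact (measure_mono_ae hsub).trans (measure_union_le _ _)
    _ ≤ ((CW / (1 / 2) : ℝ≥0) : ℝ≥0∞) ^ p * ∫⁻ y, ‖f y‖ₑ ^ p ∂σ +
          ((CM / b : ℝ≥0) : ℝ≥0∞) ^ p * ∫⁻ y, ‖f y‖ₑ ^ p ∂σ := by
        rw [mul_add]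
        exact add_le_add
          (WeakTypeBound.rpow_mul_measure_scale_le hp (hW f hf) (by positivity) t)
          (WeakTypeBound.rpow_mul_measure_scale_le hp (hM f hf) hb0 t)
    _ = _ := by
        have h : ((((CW / (1 / 2)) ^ p + (CM / b) ^ p) ^ (1 / p) : ℝ≥0) : ℝ≥0∞) ^ p =
            ((CW / (1 / 2) : ℝ≥0) : ℝ≥0∞) ^ p + ((CM / b : ℝ≥0) : ℝ≥0∞) ^ p := by
          rw [← ENNReal.coe_rpow_of_nonneg _ hp0.le, ← NNReal.rpow_mul,
            one_div_mul_cancel hp0.ne', NNReal.rpow_one, ENNReal.coe_add,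
            ENNReal.coe_rpow_of_nonneg _ hp0.le, ENNReal.coe_rpow_of_nonneg _ hp0.le]
        rw [eLpNorm_ofReal_eq hp0, ENNReal.mul_rpow_of_nonneg _ _ hp0.le, ← ENNReal.rpow_mul,
          one_div_mul_cancel hp0.ne', ENNReal.rpow_one, h, add_mul]

end

/-! ### Ellipticity and the weak type inequality on separated cubes -/

section
variable {n : ℕ} {A C L p c τ M s : ℝ} {δ : ℝ → ℝ} {K : RSp n → RSp n → ℂ}
  {σ ω : Measure (RSp n)} {Φ : Set (RSp n → ℝ)}

lemma corner_mem_cube (a : RSp n) {s : ℝ} (hs : 0 ≤ s) : a ∈ cube a s := fun i => by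
  rw [mem_Icc]; constructor <;> linarith

/-- The part of the cube with corner `a` and side `s` on which `K(z, ·)` is at least as large as an
elliptic kernel. -/
def ellipticPart (K : RSp n → RSp n → ℂ) (c : ℝ) (a z : RSp n) (s : ℝ) : Set (RSp n) :=
  cube a s ∩ {y | c / ‖z - y‖ ^ n ≤ ‖K z y‖}

/-- The conjugate phase of `K(z, ·)`, restricted to the elliptic part of a cube. -/
noncomputable def ellipticPhase (K : RSp n → RSp n → ℂ) (c : ℝ) (a z : RSp n) (s : ℝ) :
    RSp n → ℂ :=
  (ellipticPart K c a z s).indicator fun y => (starRingEnd ℂ) (K z y) / (‖K z y‖ : ℂ)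

lemma measurableSet_ellipticPart (hK : ∀ x, Measurable (K x)) (c : ℝ) (a z : RSp n) (s : ℝ) :
    MeasurableSet (ellipticPart K c a z s) := by
  have := hK z
  exact (measurableSet_cube a s).inter (measurableSet_le (by fun_prop) (by fun_prop))

lemma measurable_ellipticPhase (hK : ∀ x, Measurable (K x)) (c : ℝ) (a z : RSp n) (s : ℝ) :
    Measurable (ellipticPhase K c a z s) := by
  have := hK z
  refine Measurable.indicator ?_ (measurableSet_ellipticPart hK c a z s)
  exact (Complex.continuous_conj.measurable.comp this).div
    (Complex.measurable_ofReal.comp this.norm)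

lemma enorm_ellipticPhase_le (K : RSp n → RSp n → ℂ) (c : ℝ) (a z : RSp n) (s : ℝ) (y : RSp n) :
    ‖ellipticPhase K c a z s y‖ₑ ≤ (ellipticPart K c a z s).indicator (fun _ => 1) y := by
  unfold ellipticPhase
  by_cases hy : y ∈ ellipticPart K c a z s
  · rw [indicator_of_mem hy, indicator_of_mem hy, ← ofReal_norm, ← ENNReal.ofReal_one]
    refine ENNReal.ofReal_le_ofReal ?_
    rw [norm_div, RCLike.norm_conj, Complex.norm_real, norm_norm]
    exact div_self_le_one _
  · simp [hy]

lemma lintegral_enorm_ellipticPhase_rpow_le (hK : ∀ x, Measurable (K x)) (hp : 0 < p) (c : ℝ)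
    (a z : RSp n) (s : ℝ) :
    ∫⁻ y, ‖ellipticPhase K c a z s y‖ₑ ^ p ∂σ ≤ σ (ellipticPart K c a z s) := by
  rw [← lintegral_indicator_one (measurableSet_ellipticPart hK c a z s)]
  refine lintegral_mono fun y => (ENNReal.rpow_le_rpow (enorm_ellipticPhase_le K c a z s y)
    hp.le).trans ?_
  by_cases hy : y ∈ ellipticPart K c a z s <;> simp [hy, hp]

/-- On the cube at `z`, far from the cube at `a` in comparison with the common side `s`, the
kernel has almost the phase of `K(z, ·)`, so that no cancellation occurs in the integral of its
product with the conjugate phase. -/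
lemma KernelBounds.le_maxOp_ellipticPhase (hn : 1 ≤ n) (hK : KernelBounds C δ K)
    (hΦ : IsCutoffClass A L Φ) [IsLocallyFiniteMeasure σ] (hc : 0 < c) (hτ0 : 0 < τ)
    (hτ1 : τ ≤ 1 / 2) (hτ : C * δ τ ≤ c / 2) (hs : 0 < s) {a z x : RSp n}
    (h1 : (n + n / τ) * s ≤ ‖z - a‖) (h2 : ‖z - a‖ ≤ M * s) (hx : x ∈ cube z s) :
    ENNReal.ofReal (c / 2 / ((M + n) * s) ^ n) * σ (ellipticPart K c a z s) ≤
      maxOp K σ Φ (ellipticPhase K c a z s) x := by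
  have hA : 0 < A := by linarith [hΦ.one_lt]
  have hn1 : (1 : ℝ) ≤ n := by exact_mod_cast hn
  have hnτ : 2 * (n : ℝ) ≤ n / τ := by
    rw [le_div_iff₀ hτ0]; nlinarith
  obtain ⟨φ, hφ, -, hφ1⟩ := hΦ.exists_one (s / A) ((M + 2 * n) * s) (by positivity)
  set E := ellipticPart K c a z s with hE
  have hEm : MeasurableSet E := measurableSet_ellipticPart hK.meas c a z s
  have hEfin : σ E ≠ ∞ :=
    ((measure_mono inter_subset_left).trans_lt (measure_cube_ne_top σ a s).lt_top).ne
  set b := c / 2 / ((M + n) * s) ^ n with hb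
  have hMs : 0 < (M + n) * s := by
    have : 0 < (n + n / τ) * s := by positivity
    nlinarith
  have hb0 : 0 ≤ b := by positivity
  refine le_trans ?_ (enorm_truncOp_le_maxOp K σ hφ _ x)
  have hf : LocallyIntegrable (ellipticPhase K c a z s) σ := by
    refine Integrable.locallyIntegrable
      ⟨(measurable_ellipticPhase hK.meas c a z s).aestronglyMeasurable, ?_⟩
    refine lt_of_le_of_lt ?_ hEfin.lt_top
    simpa using lintegral_enorm_ellipticPhase_rpow_le (p := 1) hK.meas one_pos c a z s
  have hint := hK.integrable_cutKernel_mul hΦ.nonneg (hΦ.isCutoff φ hφ) hf x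
  -- The main term is `‖K z y‖`, and moving from `z` to `x` costs at most half of it.
  have hpt : ∀ y, E.indicator (fun _ => b) y ≤
      (cutKernel K φ x y * ellipticPhase K c a z s y).re := by
    intro y
    by_cases hy : y ∈ E
    · have hfy : ellipticPhase K c a z s y = (starRingEnd ℂ) (K z y) / (‖K z y‖ : ℂ) :=
        indicator_of_mem hy _
      rw [indicator_of_mem hy, hfy]
      have hya : ‖y - a‖ ≤ n * s :=
        norm_sub_le_of_mem_cube hs.le hy.1 (corner_mem_cube a hs.le)
      have hxz : ‖x - z‖ ≤ n * s :=
        norm_sub_le_of_mem_cube hs.le hx (corner_mem_cube z hs.le)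
      have hD1 : n / τ * s ≤ ‖z - y‖ := by
        have := norm_sub_norm_le (z - a) (y - a)
        rw [sub_sub_sub_cancel_right] at this
        linarith
      have hD2 : ‖z - y‖ ≤ (M + n) * s := by
        have := norm_sub_le (z - a) (y - a)
        rw [sub_sub_sub_cancel_right] at this
        linarith
      have hD0 : 0 < ‖z - y‖ := lt_of_lt_of_le (by positivity) hD1
      have hxy : x - y = (z - y) + (x - z) := by abel
      have h3 : s ≤ ‖x - y‖ := by
        have := norm_sub_le_norm_add (z - y) (x - z)
        rw [← hxy] at this
        nlinarith
      have h4 : ‖x - y‖ ≤ (M + 2 * n) * s := by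
        have := norm_add_le (z - y) (x - z)
        rw [← hxy] at this
        linarith
      have hφxy : φ (x - y) = 1 := hφ1 _ (by rw [mul_div_cancel₀ _ hA.ne']; exact h3) h4
      have hratio : ‖z - x‖ / ‖z - y‖ ≤ τ := by
        rw [div_le_iff₀ hD0, norm_sub_rev]
        refine hxz.trans ?_
        calc (n : ℝ) * s = τ * (n / τ * s) := by field_simp
          _ ≤ τ * ‖z - y‖ := by gcongr
      have hsm := hK.smooth z x y (by rintro rfl; simp at hD0) (hratio.trans hτ1)
      have hδ : δ (‖z - x‖ / ‖z - y‖) ≤ δ τ :=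
        hK.dini.mono ⟨by positivity, by linarith⟩ ⟨hτ0.le, by linarith⟩ hratio
      have hsm' : ‖K z y - K x y‖ ≤ c / 2 / ‖z - y‖ ^ n := by
        refine hsm.trans ?_
        gcongr
        exact (mul_le_mul_of_nonneg_left hδ hK.nonneg).trans hτ
      have hell : c / ‖z - y‖ ^ n ≤ ‖K z y‖ := hy.2
      have hk : 0 < ‖K z y‖ := lt_of_lt_of_le (by positivity) hell
      have hbD : b ≤ c / 2 / ‖z - y‖ ^ n := by rw [hb]; gcongr
      set w := (starRingEnd ℂ) (K z y) / (‖K z y‖ : ℂ) with hw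
      have hw1 : ‖w‖ = 1 := by
        rw [hw, norm_div, RCLike.norm_conj, Complex.norm_real, norm_norm, div_self hk.ne']
      have hzw : K z y * w = (‖K z y‖ : ℂ) := by
        have : (‖K z y‖ : ℂ) ≠ 0 := by exact_mod_cast hk.ne'
        rw [hw, mul_div_assoc', Complex.mul_conj, Complex.normSq_eq_norm_sq]
        push_cast
        field_simp
      have hdec : cutKernel K φ x y * w = (‖K z y‖ : ℂ) - (K z y - K x y) * w := by
        rw [cutKernel, hφxy, Complex.ofReal_one, mul_one, sub_mul, hzw]; ring
      have hre : ((K z y - K x y) * w).re ≤ c / 2 / ‖z - y‖ ^ n := by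
        refine (Complex.re_le_norm _).trans ?_
        rwa [norm_mul, hw1, mul_one]
      rw [hdec, Complex.sub_re, Complex.ofReal_re]
      have : c / ‖z - y‖ ^ n = c / 2 / ‖z - y‖ ^ n + c / 2 / ‖z - y‖ ^ n := by ring
      linarith
    · have hfy : ellipticPhase K c a z s y = 0 := indicator_of_notMem hy _
      rw [indicator_of_notMem hy, hfy]; simp
  have hle : b * σ.real E ≤ ‖truncOp K σ φ (ellipticPhase K c a z s) x‖ := by
    refine le_trans ?_ (Complex.re_le_norm _)
    have hre : (truncOp K σ φ (ellipticPhase K c a z s) x).re =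
        ∫ y, (cutKernel K φ x y * ellipticPhase K c a z s y).re ∂σ :=
      (integral_re hint).symm
    rw [hre]
    calc b * σ.real E = ∫ y, E.indicator (fun _ => b) y ∂σ := by
          rw [integral_indicator_const _ hEm, smul_eq_mul, mul_comm]
      _ ≤ _ := integral_mono
          ((integrable_indicator_iff hEm).2 (integrableOn_const hEfin)) hint.re hpt
  rw [← ofReal_norm]
  refine le_trans (le_of_eq ?_) (ENNReal.ofReal_le_ofReal hle)
  rw [ENNReal.ofReal_mul hb0, ofReal_measureReal hEfin]

/-- The weak type inequality tested on the conjugate phase of the kernel. -/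
lemma KernelBounds.rpow_measure_mul_le_of_weakTypeBound (hn : 1 ≤ n) (hp : 1 < p)
    (hK : KernelBounds C δ K) (hΦ : IsCutoffClass A L Φ) [IsLocallyFiniteMeasure σ] (hc : 0 < c)
    (hτ0 : 0 < τ) (hτ1 : τ ≤ 1 / 2) (hτ : C * δ τ ≤ c / 2) {B : ℝ≥0}
    (hW : ∀ f : RSp n → ℂ, MemLp f (ENNReal.ofReal p) σ →
      weakNorm p ω (maxOp K σ Φ f) ≤ B * eLpNorm f (ENNReal.ofReal p) σ)
    (hs : 0 < s) {a z : RSp n}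
    (h1 : (n + n / τ) * s ≤ ‖z - a‖) (h2 : ‖z - a‖ ≤ M * s) :
    ω (cube z s) ^ (1 / p) * σ (ellipticPart K c a z s) ^ (1 / p.conjExponent) ≤
      B * ENNReal.ofReal (4 * (M + n) ^ n / c) * ENNReal.ofReal (s ^ n) := by
  have hp0 : 0 < p := by linarith
  have hn1 : (1 : ℝ) ≤ n := by exact_mod_cast hn
  set E := ellipticPart K c a z s with hE
  have hEfin : σ E ≠ ∞ :=
    ((measure_mono inter_subset_left).trans_lt (measure_cube_ne_top σ a s).lt_top).ne
  have hq : 0 < 1 / p.conjExponent := by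
    rw [one_div_conjExponent hp, sub_pos, div_lt_one hp0]; exact hp
  have hM : 0 < M + n := by
    have : 0 < (n + n / τ) * s := by positivity
    nlinarith
  rcases eq_or_ne (σ E) 0 with h0 | h0
  · rw [h0, ENNReal.zero_rpow_of_pos hq, mul_zero]; exact zero_le
  set f := ellipticPhase K c a z s
  have hfint := lintegral_enorm_ellipticPhase_rpow_le (σ := σ) hK.meas hp0 c a z s
  have hnorm : eLpNorm f (ENNReal.ofReal p) σ ≤ σ E ^ (1 / p) := by
    rw [eLpNorm_ofReal_eq hp0]
    exact ENNReal.rpow_le_rpow hfint (by positivity)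
  have hmem : MemLp f (ENNReal.ofReal p) σ :=
    ⟨(measurable_ellipticPhase hK.meas c a z s).aestronglyMeasurable,
      hnorm.trans_lt (ENNReal.rpow_lt_top_of_nonneg (by positivity) hEfin)⟩
  -- Half of the lower bound for the maximal operator, so that the inequality becomes strict.
  set b := c / 2 / ((M + n) * s) ^ n with hb
  have hb0 : 0 < b := by positivity
  obtain ⟨t, ht⟩ : ∃ t : ℝ≥0, (t : ℝ≥0∞) = ENNReal.ofReal (b / 2) * σ E :=
    ⟨_, ENNReal.coe_toNNReal (ENNReal.mul_ne_top ENNReal.ofReal_ne_top hEfin)⟩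
  have hsub : cube z s ⊆ {x | (t : ℝ≥0∞) < maxOp K σ Φ f x} := by
    intro x hx
    refine lt_of_lt_of_le ?_
      (hK.le_maxOp_ellipticPhase hn hΦ hc hτ0 hτ1 hτ hs h1 h2 hx)
    rw [ht]
    exact ENNReal.mul_lt_mul_left h0 hEfin
      ((ENNReal.ofReal_lt_ofReal_iff hb0).2 (half_lt_self hb0))
  have hweak : (t : ℝ≥0∞) * ω (cube z s) ^ (1 / p) ≤ B * σ E ^ (1 / p) := by
    calc (t : ℝ≥0∞) * ω (cube z s) ^ (1 / p)
        ≤ (t : ℝ≥0∞) * ω {x | (t : ℝ≥0∞) < maxOp K σ Φ f x} ^ (1 / p) := by gcongr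
      _ ≤ weakNorm p ω (maxOp K σ Φ f) :=
          le_iSup (fun t : ℝ≥0 => (t : ℝ≥0∞) * ω {x | (t : ℝ≥0∞) < maxOp K σ Φ f x} ^ (1 / p)) t
      _ ≤ B * σ E ^ (1 / p) := (hW f hmem).trans (by gcongr)
  have hE1 : σ E = σ E ^ (1 / p) * σ E ^ (1 / p.conjExponent) := by
    rw [← ENNReal.rpow_add _ _ h0 hEfin, one_div_conjExponent hp]; simp
  have hEp0 : σ E ^ (1 / p) ≠ 0 := (ENNReal.rpow_pos (pos_iff_ne_zero.2 h0) hEfin).ne'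
  have hEpt : σ E ^ (1 / p) ≠ ∞ := ENNReal.rpow_ne_top_of_nonneg (by positivity) hEfin
  have hbinv : ENNReal.ofReal (4 * (M + n) ^ n / c) * ENNReal.ofReal (s ^ n) *
      ENNReal.ofReal (b / 2) = 1 := by
    rw [← ENNReal.ofReal_mul (by positivity), ← ENNReal.ofReal_mul (by positivity),
      ← ENNReal.ofReal_one, hb]
    congr 1
    rw [mul_pow]
    field_simp
    norm_num
  set G := ENNReal.ofReal (4 * (M + n) ^ n / c) * ENNReal.ofReal (s ^ n) with hG
  rw [← ENNReal.mul_le_mul_iff_right hEp0 hEpt]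
  calc σ E ^ (1 / p) * (ω (cube z s) ^ (1 / p) * σ E ^ (1 / p.conjExponent))
      = σ E * ω (cube z s) ^ (1 / p) := by nth_rewrite 3 [hE1]; ring
    _ = G * (ENNReal.ofReal (b / 2) * σ E * ω (cube z s) ^ (1 / p)) := by
        rw [← mul_assoc, ← mul_assoc, hbinv, one_mul]
    _ ≤ G * (B * σ E ^ (1 / p)) := by rw [← ht]; gcongr
    _ = σ E ^ (1 / p) * (B * ENNReal.ofReal (4 * (M + n) ^ n / c) * ENNReal.ofReal (s ^ n)) := by
        rw [hG]; ring

/-- For a family of kernels, each direction being elliptic for one of them, the weak type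
inequalities imply the `A_p` inequality for two cubes of equal side at comparable distance. -/
lemma exists_rpow_measure_cube_mul_le (hn : 1 ≤ n) (hp : 1 < p) (hΦ : IsCutoffClass A L Φ)
    [IsLocallyFiniteMeasure σ] (hc : 0 < c) {J : ℕ} {K : Fin J → RSp n → RSp n → ℂ}
    (hK : ∀ j, IsSizeSmoothKernel (K j))
    (hell : ∀ u : RSp n, ‖u‖ = 1 → ∃ j, ∀ (x : RSp n) (t : ℝ), 0 < t →
      c / t ^ n ≤ ‖K j x (x + t • u)‖)
    (hW : ∀ j, WeakTypeBound p σ ω (maxOp (K j) σ Φ)) :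
    ∃ N : ℝ, 0 < N ∧ ∀ M : ℝ, ∃ B : ℝ≥0, ∀ (a z : RSp n) (s : ℝ), 0 < s →
      N * s ≤ ‖z - a‖ → ‖z - a‖ ≤ M * s →
      ω (cube z s) ^ (1 / p) * σ (cube a s) ^ (1 / p.conjExponent) ≤
        B * ENNReal.ofReal (s ^ n) := by
  have hp0 : 0 < p := by linarith
  have hq : 0 < 1 / p.conjExponent := by
    rw [one_div_conjExponent hp, sub_pos, div_lt_one hp0]; exact hp
  choose C δ hKB using fun j => (hK j).exists_kernelBounds
  choose B hB using hW
  have hτ : ∀ j, ∃ τ, 0 < τ ∧ τ ≤ 1 / 2 ∧ C j * δ j τ ≤ c / 2 := by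
    intro j
    have hC := (hKB j).nonneg
    obtain ⟨τ, h0, h1, h2⟩ := (hKB j).dini.exists_lt (ε := c / 2 / (C j + 1)) (by positivity)
    refine ⟨τ, h0, h1, ?_⟩
    have hd := (hKB j).dini.nonneg (s := τ) ⟨h0.le, by linarith⟩
    calc C j * δ j τ ≤ (C j + 1) * (c / 2 / (C j + 1)) := by gcongr; linarith
      _ = c / 2 := by field_simp
  choose τ hτ0 hτ1 hτ using hτ
  have hnτ : ∀ j, 0 ≤ n / τ j := fun j => by have := hτ0 j; positivity
  -- The summand `1` keeps `z` out of the cube at `a` when the family is empty.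
  refine ⟨n + 1 + ∑ j, n / τ j, ?_, fun M => ⟨∑ j, B j * (4 * (M + n) ^ n / c).toNNReal, ?_⟩⟩
  · have := Finset.sum_nonneg fun j (_ : j ∈ Finset.univ) => hnτ j
    positivity
  intro a z s hs h1 h2
  have hpart : ∀ j, ω (cube z s) ^ (1 / p) *
      σ (ellipticPart (K j) c a z s) ^ (1 / p.conjExponent) ≤
      B j * ENNReal.ofReal (4 * (M + n) ^ n / c) * ENNReal.ofReal (s ^ n) := by
    intro j
    refine (hKB j).rpow_measure_mul_le_of_weakTypeBound hn hp hΦ hc (hτ0 j) (hτ1 j) (hτ j) (hB j)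
      hs (le_trans ?_ h1) h2
    have := Finset.single_le_sum (f := fun j => n / τ j) (fun j _ => hnτ j) (Finset.mem_univ j)
    gcongr
    linarith
  have hcov : cube a s ⊆ ⋃ j, ellipticPart (K j) c a z s := by
    intro y hy
    have hzy : z ≠ y := by
      rintro rfl
      have h3 := norm_sub_le_of_mem_cube hs.le hy (corner_mem_cube a hs.le)
      have h4 := Finset.sum_nonneg fun j (_ : j ∈ Finset.univ) => hnτ j
      nlinarith
    have hpos : 0 < ‖z - y‖ := norm_pos_iff.2 (sub_ne_zero.2 hzy)
    obtain ⟨j, hj⟩ := hell ((‖z - y‖)⁻¹ • (y - z)) (by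
      rw [norm_smul, norm_inv, norm_norm, norm_sub_rev y z, inv_mul_cancel₀ hpos.ne'])
    refine mem_iUnion.2 ⟨j, hy, ?_⟩
    have := hj z ‖z - y‖ hpos
    rw [smul_smul, mul_inv_cancel₀ hpos.ne', one_smul, add_sub_cancel] at this
    exact this
  have hsum : σ (cube a s) ^ (1 / p.conjExponent) ≤
      ∑ j, σ (ellipticPart (K j) c a z s) ^ (1 / p.conjExponent) := by
    refine (ENNReal.rpow_le_rpow ((measure_mono hcov).trans
      (measure_iUnion_fintype_le σ _)) hq.le).trans ?_
    refine Finset.le_sum_of_subadditive (fun x : ℝ≥0∞ => x ^ (1 / p.conjExponent))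
      (ENNReal.zero_rpow_of_pos hq).le (fun x y => ENNReal.rpow_add_le_add_rpow x y hq.le ?_) _ _
    rw [one_div_conjExponent hp, sub_le_self_iff]
    positivity
  calc ω (cube z s) ^ (1 / p) * σ (cube a s) ^ (1 / p.conjExponent)
      ≤ ω (cube z s) ^ (1 / p) * ∑ j, σ (ellipticPart (K j) c a z s) ^ (1 / p.conjExponent) := by
        gcongr
    _ ≤ ∑ j, B j * ENNReal.ofReal (4 * (M + n) ^ n / c) * ENNReal.ofReal (s ^ n) := by
        rw [Finset.mul_sum]
        exact Finset.sum_le_sum fun j _ => hpart j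
    _ = _ := by
        rw [← Finset.sum_mul, ENNReal.ofNNReal_finsetSum]
        rfl

end

/-! ### Necessity of the `A_p` condition -/

section
variable {n : ℕ} {A L p : ℝ} {σ ω : Measure (RSp n)} {Φ : Set (RSp n → ℝ)}

/-- The integer vectors with coordinates between `-N` and `N`. -/
noncomputable def latticeBox (n N : ℕ) : Finset (Fin n → ℤ) :=
  Fintype.piFinset fun _ => Finset.Icc (-N : ℤ) N

lemma card_latticeBox (n N : ℕ) : (latticeBox n N).card = (2 * N + 1) ^ n := by
  rw [latticeBox, Fintype.card_piFinset_const, Int.card_Icc]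
  congr 1
  omega

/-- Whitney decomposition off the diagonal: two distinct points of a cube lie in two dyadic
subcubes of equal side whose distance is comparable with the side. -/
lemma exists_mem_cube_add_gridCorner {a x y : RSp n} {l : ℝ} (hl : 0 < l) (hx : x ∈ cube a l)
    (hy : y ∈ cube a l) (hxy : x ≠ y) (N : ℕ) :
    ∃ k : ℕ, ∃ m ∈ latticeBox n (2 ^ k), ∃ v ∈ latticeBox n (2 * N + 3),
      (∃ i, (N : ℤ) ≤ |v i|) ∧ y ∈ cube (a + gridCorner (l / 2 ^ k) m) (l / 2 ^ k) ∧
      x ∈ cube (a + gridCorner (l / 2 ^ k) m + gridCorner (l / 2 ^ k) v) (l / 2 ^ k) := by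
  obtain ⟨i₁, hi₁⟩ : ∃ i, x i ≠ y i := by
    by_contra! h
    exact hxy (PiLp.ext h)
  have : Nonempty (Fin n) := ⟨i₁⟩
  obtain ⟨i₀, hi₀⟩ := Finite.exists_max fun i => |x i - y i|
  set d := |x i₀ - y i₀| with hd
  have hd0 : 0 < d := lt_of_lt_of_le (abs_pos.2 (sub_ne_zero.2 hi₁)) (hi₀ i₁)
  have hdl : d ≤ l := by
    have h1 := hx i₀
    have h2 := hy i₀
    rw [mem_Icc] at h1 h2
    rw [hd, abs_le]; constructor <;> linarith
  have hex : ∃ k : ℕ, (N + 1) * l ≤ d * 2 ^ k := by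
    obtain ⟨k, hk⟩ := pow_unbounded_of_one_lt ((N + 1) * l / d) (one_lt_two (α := ℝ))
    exact ⟨k, by rw [div_lt_iff₀ hd0] at hk; linarith⟩
  classical
  set k := Nat.find hex with hk
  have hk1 : (N + 1) * l ≤ d * 2 ^ k := Nat.find_spec hex
  -- At the first scale at which the two points are separated they are not yet far apart.
  have hk2 : d * 2 ^ k ≤ 2 * ((N + 1) * l) := by
    rcases Nat.eq_zero_or_pos k with h0 | h0
    · rw [h0, pow_zero, mul_one]
      have : (0 : ℝ) ≤ N := Nat.cast_nonneg N
      nlinarith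
    · have h := Nat.find_min hex (Nat.sub_lt h0 one_pos)
      rw [not_le, ← hk] at h
      have h2 : (2 : ℝ) ^ k = 2 ^ (k - 1) * 2 := by rw [← pow_succ, Nat.sub_add_cancel h0]
      rw [h2]; linarith
  set s := l / 2 ^ k with hs
  have hs0 : 0 < s := by positivity
  have hls : l / s = 2 ^ k := by rw [hs]; field_simp
  have hds : d / s = d * 2 ^ k / l := by rw [hs]; field_simp
  have hd1 : N + 1 ≤ d / s := by rw [hds, le_div_iff₀ hl]; exact hk1
  have hd2 : d / s ≤ 2 * (N + 1) := by rw [hds, div_le_iff₀ hl]; linarith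
  have hfl : ∀ z : RSp n, ∀ i, a i + ⌊(z i - a i) / s⌋ * s ≤ z i ∧
      z i ≤ a i + ⌊(z i - a i) / s⌋ * s + s := by
    intro z i
    have h1 := Int.floor_le ((z i - a i) / s)
    have h2 := (Int.lt_floor_add_one ((z i - a i) / s)).le
    rw [le_div_iff₀ hs0] at h1
    rw [div_le_iff₀ hs0] at h2
    constructor <;> linarith
  have hv : ∀ i, |((⌊(x i - a i) / s⌋ - ⌊(y i - a i) / s⌋ : ℤ) : ℝ) - (x i - y i) / s| ≤ 1 := by
    intro i
    have h1 := Int.floor_le ((x i - a i) / s)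
    have h2 := Int.lt_floor_add_one ((x i - a i) / s)
    have h3 := Int.floor_le ((y i - a i) / s)
    have h4 := Int.lt_floor_add_one ((y i - a i) / s)
    have h5 : (x i - y i) / s = (x i - a i) / s - (y i - a i) / s := by ring
    rw [h5, abs_le]
    push_cast
    constructor <;> linarith
  refine ⟨k, fun i => ⌊(y i - a i) / s⌋, ?_, fun i => ⌊(x i - a i) / s⌋ - ⌊(y i - a i) / s⌋,
    ?_, ⟨i₀, ?_⟩, ?_, ?_⟩
  · rw [latticeBox, Fintype.mem_piFinset]
    intro i
    have h := hy i
    rw [mem_Icc] at h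
    rw [Finset.mem_Icc]
    constructor
    · have : (0 : ℤ) ≤ ⌊(y i - a i) / s⌋ := Int.floor_nonneg.2 (div_nonneg (by linarith) hs0.le)
      have h2 : (0 : ℤ) ≤ ((2 ^ k : ℕ) : ℤ) := Int.natCast_nonneg _
      linarith
    · have h2 : (y i - a i) / s ≤ 2 ^ k := by
        rw [← hls]; gcongr; linarith
      have h3 := (Int.floor_le ((y i - a i) / s)).trans h2
      rw [← Int.cast_le (R := ℝ)]
      push_cast
      exact h3
  · rw [latticeBox, Fintype.mem_piFinset]
    intro i
    rw [Finset.mem_Icc, ← abs_le]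
    have h1 : |(x i - y i) / s| ≤ 2 * (N + 1) := by
      rw [abs_div, abs_of_pos hs0]
      exact le_trans (by gcongr; exact hi₀ i) hd2
    have h2 := abs_le.1 (hv i)
    have h3 := abs_le.1 h1
    have h4 : |((⌊(x i - a i) / s⌋ - ⌊(y i - a i) / s⌋ : ℤ) : ℝ)| ≤ 2 * N + 3 := by
      rw [abs_le]; constructor <;> linarith
    exact_mod_cast h4
  · have h1 : (N : ℝ) + 1 ≤ |(x i₀ - y i₀) / s| := by
      rw [abs_div, abs_of_pos hs0]; exact hd1
    have h2 := hv i₀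
    rw [abs_sub_comm] at h2
    have h3 := abs_sub_abs_le_abs_sub ((x i₀ - y i₀) / s)
      ((⌊(x i₀ - a i₀) / s⌋ - ⌊(y i₀ - a i₀) / s⌋ : ℤ) : ℝ)
    have h4 : (N : ℝ) ≤ |((⌊(x i₀ - a i₀) / s⌋ - ⌊(y i₀ - a i₀) / s⌋ : ℤ) : ℝ)| := by linarith
    exact_mod_cast h4
  · intro i
    rw [PiLp.add_apply, gridCorner_apply]
    exact hfl y i
  · intro i
    have h := hfl x i
    rw [PiLp.add_apply, PiLp.add_apply, gridCorner_apply, gridCorner_apply, mem_Icc]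
    push_cast
    constructor <;> linarith

/-- The product measure does not charge the diagonal: only the countably many atoms of `σ`
contribute, and `ω` vanishes on them. -/
lemma prod_diagonal_eq_zero [SFinite σ] [SFinite ω] (h : ∀ x, σ {x} * ω {x} = 0) :
    (ω.prod σ) (diagonal (RSp n)) = 0 := by
  rw [Measure.measure_prod_null measurableSet_diagonal]
  have hc : {x : RSp n | 0 < σ {x}}.Countable :=
    Measure.countable_meas_level_set_pos (g := id) measurable_id
  have h0 : ω {x | 0 < σ {x}} = 0 := by
    rw [← biUnion_of_singleton {x | 0 < σ {x}}, measure_biUnion_null_iff hc]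
    intro x (hx : 0 < σ {x})
    exact (mul_eq_zero.1 (h x)).resolve_left hx.ne'
  filter_upwards [measure_eq_zero_iff_ae_notMem.1 h0] with x (hx : ¬ 0 < σ {x})
  have : Prod.mk x ⁻¹' diagonal (RSp n) = {x} := by
    ext y; simp [eq_comm]
  rw [this]
  exact nonpos_iff_eq_zero.1 (not_lt.1 hx)

/-- The exponents of each factor add up to `1`; they are nonnegative, so that no finiteness is
needed. -/
lemma mul_eq_rpow_mul (hp : 1 < p) (a b : ℝ≥0∞) {θ : ℝ} (hθ0 : 0 < θ) (h1 : θ * (1 / p) ≤ 1)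
    (h2 : θ * (1 / p.conjExponent) ≤ 1) :
    a * b = (a ^ (1 / p) * b ^ (1 / p.conjExponent)) ^ θ *
      (a ^ (1 - θ * (1 / p)) * b ^ (1 - θ * (1 / p.conjExponent))) := by
  have hp0 : 0 < p := by linarith
  have hq : 0 < 1 / p.conjExponent := by
    rw [one_div_conjExponent hp, sub_pos, div_lt_one hp0]; exact hp
  have h3 : ∀ (c : ℝ≥0∞) {r : ℝ}, 0 ≤ r → r ≤ 1 → c = c ^ r * c ^ (1 - r) := by
    intro c r hr0 hr1
    rw [← ENNReal.rpow_add_of_nonneg _ _ hr0 (by linarith)]; simp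
  calc a * b = (a ^ (θ * (1 / p)) * a ^ (1 - θ * (1 / p))) *
        (b ^ (θ * (1 / p.conjExponent)) * b ^ (1 - θ * (1 / p.conjExponent))) := by
        rw [← h3 a (by positivity) h1, ← h3 b (by positivity) h2]
    _ = _ := by
        rw [ENNReal.mul_rpow_of_nonneg _ _ hθ0.le, ← ENNReal.rpow_mul, ← ENNReal.rpow_mul,
          mul_comm (1 / p), mul_comm (1 / p.conjExponent)]
        ring

/-- The bound for one pair of separated cubes, `P` and `P'`, inside a cube `Q`. -/
lemma measure_inter_mul_measure_inter_le (hp : 1 < p) {P P' Q : Set (RSp n)} {θ : ℝ} {V : ℝ≥0∞}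
    (hθ0 : 0 < θ) (h1 : θ * (1 / p) ≤ 1) (h2 : θ * (1 / p.conjExponent) ≤ 1)
    (hV : ω P ^ (1 / p) * σ P' ^ (1 / p.conjExponent) ≤ V) :
    ω (P ∩ Q) * σ (P' ∩ Q) ≤
      V ^ θ * (ω Q ^ (1 - θ * (1 / p)) * σ Q ^ (1 - θ * (1 / p.conjExponent))) := by
  have hp0 : 0 < p := by linarith
  have hq : 0 < 1 / p.conjExponent := by
    rw [one_div_conjExponent hp, sub_pos, div_lt_one hp0]; exact hp
  rw [mul_eq_rpow_mul hp _ _ hθ0 h1 h2]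
  have h1' : 0 ≤ 1 - θ * (1 / p) := by linarith
  have h2' : 0 ≤ 1 - θ * (1 / p.conjExponent) := by linarith
  refine mul_le_mul' (ENNReal.rpow_le_rpow (le_trans ?_ hV) hθ0.le) ?_
  · gcongr <;> exact inter_subset_left
  · gcongr <;> exact inter_subset_right

/-- The mass of `Q × Q` is carried by the Whitney pairs of subcubes. The exponent `θ > 1` makes the
sum over the scales converge geometrically. -/
lemma exists_measure_mul_measure_le (hn : 1 ≤ n) (hp : 1 < p) [IsLocallyFiniteMeasure σ]
    [IsLocallyFiniteMeasure ω] (hdiag : ∀ x, σ {x} * ω {x} = 0) {θ N : ℝ} (hθ1 : 1 < θ)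
    (h1 : θ * (1 / p) ≤ 1) (h2 : θ * (1 / p.conjExponent) ≤ 1)
    (H : ∀ M : ℝ, ∃ B : ℝ≥0, ∀ (a z : RSp n) (s : ℝ), 0 < s →
      N * s ≤ ‖z - a‖ → ‖z - a‖ ≤ M * s →
      ω (cube z s) ^ (1 / p) * σ (cube a s) ^ (1 / p.conjExponent) ≤
        B * ENNReal.ofReal (s ^ n)) :
    ∃ G : ℝ≥0, ∀ (a : RSp n) (l : ℝ), 0 < l → ω (cube a l) * σ (cube a l) ≤
      G * ENNReal.ofReal (l ^ n) ^ θ * (ω (cube a l) ^ (1 - θ * (1 / p)) *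
        σ (cube a l) ^ (1 - θ * (1 / p.conjExponent))) := by
  have hθ0 : 0 < θ := by linarith
  set R := 2 * ⌈N⌉₊ + 3 with hR
  obtain ⟨B, hB⟩ := H (n * R)
  set u : ℝ≥0∞ := 2 ^ n with hu
  have hu1 : 1 < u := one_lt_pow₀ (by norm_num) (by omega)
  have hu0 : u ≠ 0 := (zero_lt_one.trans hu1).ne'
  have hut : u ≠ ∞ := ENNReal.pow_ne_top (by norm_num)
  -- Halving the side multiplies the number of pairs by `2 ^ n` and each term by `2 ^ (-n θ)`.
  set r : ℝ≥0∞ := u * u⁻¹ ^ θ with hr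
  have hr1 : r < 1 := by
    have : r = u ^ (1 - θ) := by
      rw [hr, ENNReal.inv_rpow, ← ENNReal.rpow_neg, sub_eq_add_neg, ENNReal.rpow_add _ _ hu0 hut,
        ENNReal.rpow_one]
    rw [this]
    exact ENNReal.rpow_lt_one_of_one_lt_of_neg hu1 (by linarith)
  obtain ⟨G, hG⟩ : ∃ G : ℝ≥0, (G : ℝ≥0∞) =
      3 ^ n * (2 * R + 1) ^ n * (B : ℝ≥0∞) ^ θ * (1 - r)⁻¹ := by
    refine ⟨_, ENNReal.coe_toNNReal (ENNReal.mul_ne_top (ENNReal.mul_ne_top (ENNReal.mul_ne_top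
      (ENNReal.pow_ne_top (by norm_num)) (ENNReal.pow_ne_top ?_)) ?_) ?_)⟩
    · exact_mod_cast ENNReal.natCast_ne_top (2 * R + 1)
    · exact ENNReal.rpow_ne_top_of_nonneg hθ0.le ENNReal.coe_ne_top
    · exact ENNReal.inv_ne_top.2 (tsub_pos_of_lt hr1).ne'
  refine ⟨G, fun a l hl => ?_⟩
  set Q := cube a l with hQ
  set X := ω Q ^ (1 - θ * (1 / p)) * σ Q ^ (1 - θ * (1 / p.conjExponent)) with hX
  classical
  set V := (latticeBox n R).filter fun v => ∃ i, (⌈N⌉₊ : ℤ) ≤ |v i| with hV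
  let P : ℕ → (Fin n → ℤ) → (Fin n → ℤ) → Set (RSp n) := fun k m v =>
    cube (a + gridCorner (l / 2 ^ k) m + gridCorner (l / 2 ^ k) v) (l / 2 ^ k)
  let P' : ℕ → (Fin n → ℤ) → Set (RSp n) := fun k m =>
    cube (a + gridCorner (l / 2 ^ k) m) (l / 2 ^ k)
  have hcov : Q ×ˢ Q ⊆ diagonal (RSp n) ∪
      ⋃ k, ⋃ m ∈ latticeBox n (2 ^ k), ⋃ v ∈ V, (P k m v ∩ Q) ×ˢ (P' k m ∩ Q) := by
    rintro ⟨x, y⟩ ⟨hx, hy⟩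
    by_cases hxy : x = y
    · exact Or.inl hxy
    · obtain ⟨k, m, hm, v, hv, hi, h3, h4⟩ := exists_mem_cube_add_gridCorner hl hx hy hxy ⌈N⌉₊
      refine Or.inr (mem_iUnion.2 ⟨k, mem_biUnion hm (mem_biUnion (x := v) ?_ ?_)⟩)
      · exact Finset.mem_filter.2 ⟨hv, hi⟩
      · exact ⟨⟨h4, hx⟩, ⟨h3, hy⟩⟩
  have hterm : ∀ k m, ∀ v ∈ V, ω (P k m v ∩ Q) * σ (P' k m ∩ Q) ≤
      (B * ENNReal.ofReal ((l / 2 ^ k) ^ n)) ^ θ * X := by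
    intro k m v hv
    have hs : 0 < l / 2 ^ k := by positivity
    obtain ⟨hvR, i, hi⟩ := Finset.mem_filter.1 hv
    rw [latticeBox, Fintype.mem_piFinset] at hvR
    refine measure_inter_mul_measure_inter_le hp hθ0 h1 h2 (hB _ _ _ hs ?_ ?_)
    · rw [add_sub_cancel_left]
      refine le_trans ?_ (abs_apply_le_norm _ i)
      rw [gridCorner_apply, abs_mul, abs_of_pos hs]
      gcongr
      refine (Nat.le_ceil N).trans ?_
      rw [← Int.cast_abs]
      exact_mod_cast hi
    · rw [add_sub_cancel_left, mul_assoc]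
      refine norm_le_of_forall_abs_le (by positivity) fun j => ?_
      rw [gridCorner_apply, abs_mul, abs_of_pos hs]
      gcongr
      have := abs_le.2 (Finset.mem_Icc.1 (hvR j))
      have h := (Int.cast_le (R := ℝ)).2 this
      rwa [Int.cast_abs, Int.cast_natCast] at h
  have hcardV : (V.card : ℝ≥0∞) ≤ (2 * R + 1) ^ n := by
    have := Finset.card_filter_le (latticeBox n R) fun v => ∃ i, (⌈N⌉₊ : ℤ) ≤ |v i|
    rw [card_latticeBox] at this
    exact_mod_cast this
  have hcardm : ∀ k : ℕ, ((latticeBox n (2 ^ k)).card : ℝ≥0∞) ≤ 3 ^ n * u ^ k := by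
    intro k
    rw [card_latticeBox, hu, ← pow_mul, mul_comm n k, pow_mul, ← mul_pow]
    have h3 : 1 ≤ 2 ^ k := Nat.one_le_two_pow
    have h4 : (2 * 2 ^ k + 1) ^ n ≤ (3 * 2 ^ k) ^ n := Nat.pow_le_pow_left (by omega) n
    exact_mod_cast h4
  have hscale : ∀ k : ℕ, ENNReal.ofReal ((l / 2 ^ k) ^ n) = ENNReal.ofReal (l ^ n) * u⁻¹ ^ k := by
    intro k
    rw [div_pow, ENNReal.ofReal_div_of_pos (by positivity), ← pow_mul, mul_comm k n, pow_mul,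
      ENNReal.ofReal_pow (p := 2 ^ n) (by positivity), ENNReal.ofReal_pow zero_le_two,
      ENNReal.ofReal_ofNat, div_eq_mul_inv, ENNReal.inv_pow]
  have hmeas : ∀ k, ∑ m ∈ latticeBox n (2 ^ k), ∑ v ∈ V, ω (P k m v ∩ Q) * σ (P' k m ∩ Q) ≤
      3 ^ n * (2 * R + 1) ^ n * (B : ℝ≥0∞) ^ θ * ENNReal.ofReal (l ^ n) ^ θ * X * r ^ k := by
    intro k
    calc ∑ m ∈ latticeBox n (2 ^ k), ∑ v ∈ V, ω (P k m v ∩ Q) * σ (P' k m ∩ Q)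
        ≤ ∑ m ∈ latticeBox n (2 ^ k), ∑ v ∈ V,
            (B * ENNReal.ofReal ((l / 2 ^ k) ^ n)) ^ θ * X :=
          Finset.sum_le_sum fun m _ => Finset.sum_le_sum fun v hv => hterm k m v hv
      _ = (latticeBox n (2 ^ k)).card * (V.card *
            ((B * ENNReal.ofReal ((l / 2 ^ k) ^ n)) ^ θ * X)) := by
          rw [Finset.sum_const, Finset.sum_const, nsmul_eq_mul, nsmul_eq_mul]
      _ ≤ (3 ^ n * u ^ k) * ((2 * R + 1) ^ n *
            ((B * ENNReal.ofReal ((l / 2 ^ k) ^ n)) ^ θ * X)) := by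
          gcongr
          exact hcardm k
      _ = _ := by
          rw [hscale, ENNReal.mul_rpow_of_nonneg _ _ hθ0.le, ENNReal.mul_rpow_of_nonneg _ _ hθ0.le,
            ← ENNReal.rpow_natCast_mul, mul_comm (k : ℝ) θ, ENNReal.rpow_mul_natCast, hr, mul_pow]
          ring
  calc ω Q * σ Q = (ω.prod σ) (Q ×ˢ Q) := (Measure.prod_prod _ _).symm
    _ ≤ (ω.prod σ) (diagonal (RSp n)) + ∑' k, ∑ m ∈ latticeBox n (2 ^ k), ∑ v ∈ V,
          (ω.prod σ) ((P k m v ∩ Q) ×ˢ (P' k m ∩ Q)) := by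
        refine (measure_mono hcov).trans ((measure_union_le _ _).trans ?_)
        refine add_le_add le_rfl ((measure_iUnion_le _).trans ?_)
        refine ENNReal.tsum_le_tsum fun k => (measure_biUnion_finset_le _ _).trans ?_
        exact Finset.sum_le_sum fun m _ => measure_biUnion_finset_le _ _
    _ ≤ ∑' k, 3 ^ n * (2 * R + 1) ^ n * (B : ℝ≥0∞) ^ θ * ENNReal.ofReal (l ^ n) ^ θ * X *
          r ^ k := by
        rw [prod_diagonal_eq_zero hdiag, zero_add]
        simp only [Measure.prod_prod]
        exact ENNReal.tsum_le_tsum hmeas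
    _ = _ := by
        rw [ENNReal.tsum_mul_left, ENNReal.tsum_geometric, hG]
        ring

/-- If no point is charged by both measures, the `A_p` inequality for separated cubes of equal side
implies the `A_p` condition. -/
theorem apCondition_of_separated (hn : 1 ≤ n) (hp : 1 < p) [IsLocallyFiniteMeasure σ]
    [IsLocallyFiniteMeasure ω] (hdiag : ∀ x, σ {x} * ω {x} = 0) {N : ℝ}
    (H : ∀ M : ℝ, ∃ B : ℝ≥0, ∀ (a z : RSp n) (s : ℝ), 0 < s →
      N * s ≤ ‖z - a‖ → ‖z - a‖ ≤ M * s →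
      ω (cube z s) ^ (1 / p) * σ (cube a s) ^ (1 / p.conjExponent) ≤
        B * ENNReal.ofReal (s ^ n)) : ApCondition p σ ω := by
  have hp0 : 0 < p := by linarith
  have hα : 0 < 1 / p := by positivity
  have hq : 0 < 1 / p.conjExponent := by
    rw [one_div_conjExponent hp, sub_pos, div_lt_one hp0]; exact hp
  -- The largest exponent for which the two remaining powers are nonnegative is `θ = γ⁻¹ > 1`.
  set γ := max (1 / p) (1 / p.conjExponent) with hγ
  have hγ0 : 0 < γ := lt_max_of_lt_left hα
  have hγ1 : γ < 1 := by
    rw [hγ, one_div_conjExponent hp]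
    exact max_lt ((div_lt_one hp0).2 hp) (by linarith)
  have hθ1 : 1 < γ⁻¹ := (one_lt_inv₀ hγ0).2 hγ1
  have h1 : γ⁻¹ * (1 / p) ≤ 1 := by
    rw [inv_mul_le_iff₀ hγ0, mul_one]; exact le_max_left _ _
  have h2 : γ⁻¹ * (1 / p.conjExponent) ≤ 1 := by
    rw [inv_mul_le_iff₀ hγ0, mul_one]; exact le_max_right _ _
  obtain ⟨G, hG⟩ := exists_measure_mul_measure_le hn hp hdiag hθ1 h1 h2 H
  refine (apCondition_iff hp).2 ⟨G ^ γ, fun a l hl => ?_⟩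
  have hWt := measure_cube_ne_top ω a l
  have hSt := measure_cube_ne_top σ a l
  rcases eq_or_ne (ω (cube a l)) 0 with hW0 | hW0
  · rw [hW0, ENNReal.zero_rpow_of_pos hα, zero_mul]; exact zero_le
  rcases eq_or_ne (σ (cube a l)) 0 with hS0 | hS0
  · rw [hS0, ENNReal.zero_rpow_of_pos hq, mul_zero]; exact zero_le
  have h := hG a l hl
  rw [mul_eq_rpow_mul hp _ _ (by positivity) h1 h2] at h
  rw [ENNReal.mul_le_mul_iff_left
    (mul_ne_zero (ENNReal.rpow_pos (pos_iff_ne_zero.2 hW0) hWt).ne'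
      (ENNReal.rpow_pos (pos_iff_ne_zero.2 hS0) hSt).ne')
    (ENNReal.mul_ne_top (ENNReal.rpow_ne_top_of_nonneg (by linarith) hWt)
      (ENNReal.rpow_ne_top_of_nonneg (by linarith) hSt))] at h
  have h3 := ENNReal.rpow_le_rpow h hγ0.le
  rw [ENNReal.coe_rpow_of_nonneg _ hγ0.le]
  rwa [ENNReal.mul_rpow_of_nonneg _ _ hγ0.le, ← ENNReal.rpow_mul, ← ENNReal.rpow_mul,
    inv_mul_cancel₀ hγ0.ne', ENNReal.rpow_one, ENNReal.rpow_one] at h3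

end

theorem mainTheorem1 (n : ℕ) (hn : 1 ≤ n) (p : ℝ) (hp : 1 < p)
    (σ ω : Measure (RSp n)) [IsLocallyFiniteMeasure σ] [IsLocallyFiniteMeasure ω]
    (ζ η : ℝ → ℝ) (hcut : IsCutoffPair ζ η) :
    (∀ K : RSp n → RSp n → ℂ, IsSizeSmoothKernel K → WeakTypeBound p σ ω (maxCube σ) →
      (WeakTypeBound p σ ω (maxNatural ζ η K σ) ↔ CubeTesting p σ ω (maxNatural ζ η K σ))) ∧
    (∀ K : RSp n → RSp n → ℂ, IsSizeSmoothKernel K → WeakTypeBound p σ ω (maxCube σ) →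
      (WeakTypeBound p σ ω (maxFlat ζ η K σ) ↔ CubeTesting p σ ω (maxFlat ζ η K σ))) ∧
    (∀ (K : RSp n → RSp n → ℂ) (q : ℝ≥0∞) [Fact (1 ≤ q)]
      (T : Lp ℂ q (volume : Measure (RSp n)) →L[ℂ] Lp ℂ q (volume : Measure (RSp n))),
      IsStandardSIO q K T → σ ≪ volume → ω ≪ volume → WeakTypeBound p σ ω (maxCube σ) →
      (WeakTypeBound p σ ω (maxNatural ζ η K σ) ∨ WeakTypeBound p σ ω (maxFlat ζ η K σ)) →
      WeakTypeBoundSIO p σ ω q T) ∧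
    (∀ (c : ℝ) (J : ℕ) (K : Fin J → RSp n → RSp n → ℂ), 0 < c →
      (∀ j, IsStandardKernel (K j)) →
      (∀ u : RSp n, ‖u‖ = 1 → ∃ j, ∀ (x : RSp n) (t : ℝ), 0 < t →
        c / t ^ n ≤ ‖K j x (x + t • u)‖) →
      (∀ x, σ {x} * ω {x} = 0) →
      ((∀ j, WeakTypeBound p σ ω (maxFlat ζ η (K j) σ)) ↔
        (ApCondition p σ ω ∧ ∀ j, CubeTesting p σ ω (maxFlat ζ η (K j) σ)))) := by
  obtain ⟨A₁, L₁, hN⟩ := hcut.exists_isCutoffClass_natural hn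
  obtain ⟨A₂, L₂, hF⟩ := hcut.exists_isCutoffClass_flat n
  simp only [maxNatural_eq_maxOp, maxFlat_eq_maxOp]
  refine ⟨fun K hK hM => weakTypeBound_maxOp_iff hn hp hK hN hM,
    fun K hK hM => weakTypeBound_maxOp_iff hn hp hK hF hM,
    fun K q _ T hT hσ hω hM hW => ?_, fun c J K hc hK hell hdiag => ⟨fun hW => ?_, ?_⟩⟩
  · exact hW.elim (hT.weakTypeBoundSIO hp hN hσ hω hM) (hT.weakTypeBoundSIO hp hF hσ hω hM)
  · obtain ⟨N, -, H⟩ := exists_rpow_measure_cube_mul_le hn hp hF hc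
      (fun j => (hK j).toIsSizeSmoothKernel) hell hW
    have hA := apCondition_of_separated hn hp hdiag H
    exact ⟨hA, fun j => (weakTypeBound_maxOp_iff hn hp (hK j).toIsSizeSmoothKernel hF
      (hA.weakTypeBound_maxCube hp)).1 (hW j)⟩
  · rintro ⟨hA, hD⟩ j
    exact (weakTypeBound_maxOp_iff hn hp (hK j).toIsSizeSmoothKernel hF
      (hA.weakTypeBound_maxCube hp)).2 (hD j)
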